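/- Setting. Let $S\subset\mathbb R^3$ be a surface of revolution parametrized by $(f(u)\cos\phi,f(u)\sin\phi,g(u))$, $u\in I$, whose profile curve $u\mapsto(f(u),g(u))$ is smooth, unit speed and without self-intersections, with $f>0$ in the interior of $I$. It is of one of four kinds: spherical ($I=[c,d]$, $f(c)=f(d)=0$), hyperboloidal ($I=(c,d)$, $-\infty\le c<d\le\infty$), toroidal ($I=[c,d]$, with the profile a smooth closed curve and $f(c)=f(d)>0$; $f,g$ are then extended periodically to $\mathbb R$), or paraboloidal ($I=[c,d)$, $-\infty<c<d\le\infty$, $f(c)=0$). Let $J$ be the interior of $I$ ($J=\mathbb R$ in the toroidal case), and assume that $f$ is real analytic on $J$. Put $h=-ff''+(f')^2$ on $J$. An analytic central potential on $S$ is a real analytic function $V=V(u)$ on $J$ (with the period of the profile curve, in the toroidal case); potentials are required to be non-constant. A particle of mass $m>0$ moves according to Hamilton's equations for $$H=\frac{p_u^2}{2m}+\frac{p_\phi^2}{2mf(u)^2}+V(u),\qquad u\in J.$$ A non-singular orbit is a solution defined for all $t\ge 0$. It is bounded if its image in $\mathbb R^3$ is bounded, circular if $u$ is constant, and closed if the motion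 in $\mathbb R^3$ is periodic. Say that $V$ has the closed orbit property if it has at least one bounded non-singular non-circular orbit and all its bounded non-singular orbits are closed. Two potentials are regarded as the same if $V=\alpha W+\gamma$ on $J$ with constants $\alpha\ne0$ and $\gamma$. Theorem. 1. There are at most two analytic central potentials on $S$ with the closed orbit property. 2. There are exactly two if and only if $h$ is constant, equal to $b^2$ for some positive rational number $b$, and $f'$ has no zero in $J$. 3. Suppose that $h\equiv b^2$ with $b$ a positive rational number. Then $1/f^2$ has an antiderivative $\Theta$ on $J$ with $f'/f=-b^2\Theta$. If $f'$ has no zero in $J$, the potentials with the closed orbit property are exactly $V_1=a\Theta+\mathrm{const}$ with a constant $a$ such that $af'>0$ on $J$, and $V_2=k/\Theta^2+\mathrm{const}$ with $k>0$. If $f'$ has a zero in $J$ (so that $k/\Theta^2$ has a pole there, and is not an analytic potential on $S$), they are exactly $V_1=a\Theta+\mathrm{const}$ with $a\neq0$. 4. Suppose that $h$ is not constant and that for some constant $\beta\in\mathbb R$ the equation $$\beta^4-5\left(-f''f+(f')^2\right)\beta^2-5f''(f')^2f+4(f'')^2f^2-3f'''f'f^2+4(f')^4=0$$ holds on $J$.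 Then there is at most one analytic central potential on $S$ with the closed orbit property. Moreover there is an antiderivative $\Theta$ of $1/f^2$ on $J$ such that, if a potential $V$ has the closed orbit property, then $\Theta$ has no zero in $J$ and $V=k/\Theta^2+\mathrm{const}$ for some constant $k\ne0$. -/

import Mathlib

open Set
open scoped ContDiff

noncomputable section

/-- The four kinds of surfaces of revolution. -/
inductive SurfaceKind where
  | spherical
  | hyperboloidal
  | toroidal
  | paraboloidal

/-- The condition on the parameter interval `I` and on the ends of the profile curve
`u ↦ (f u, 0, g u)`, for each kind of surface, together with the absence of self-intersections.
In the toroidal case the closed smooth profile curve on `[c, d]` is extended periodically to `ℝ`. -/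
def IsProfileOfKind (I : Set ℝ) (f g : ℝ → ℝ) : SurfaceKind → Prop
  | .spherical => ∃ c d : ℝ, c < d ∧ I = Icc c d ∧ f c = 0 ∧ f d = 0 ∧
      InjOn (fun u => (f u, g u)) I
  | .hyperboloidal => ∃ c d : EReal, c < d ∧ I = {u : ℝ | c < (u : EReal) ∧ (u : EReal) < d} ∧
      InjOn (fun u => (f u, g u)) I
  | .toroidal => ∃ c d : ℝ, c < d ∧ I = Icc c d ∧ 0 < f c ∧
      Function.Periodic f (d - c) ∧ Function.Periodic g (d - c) ∧
      ContDiff ℝ ∞ f ∧ ContDiff ℝ ∞ g ∧ InjOn (fun u => (f u, g u)) (Ico c d)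
  | .paraboloidal => ∃ (c : ℝ) (d : EReal), (c : EReal) < d ∧
      I = {u : ℝ | c ≤ u ∧ (u : EReal) < d} ∧ f c = 0 ∧ InjOn (fun u => (f u, g u)) I

/-- A surface of revolution in `ℝ³`, given by its kind and its unit speed profile curve
`u ↦ (f u, 0, g u)`, `u ∈ I`, which is rotated about the `z`-axis. -/
structure SurfaceOfRevolution where
  kind : SurfaceKind
  I : Set ℝ
  f : ℝ → ℝ
  g : ℝ → ℝ
  smooth_f : ContDiffOn ℝ ∞ f I
  smooth_g : ContDiffOn ℝ ∞ g I
  f_pos : ∀ u ∈ interior I, 0 < f u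
  unit_speed : ∀ u ∈ interior I, deriv f u ^ 2 + deriv g u ^ 2 = 1
  profile : IsProfileOfKind I f g kind

namespace SurfaceOfRevolution

/-- The range of the coordinate `u` for a moving particle: the interior of the parameter interval
(the poles are removed), and the universal cover `ℝ` of the closed profile curve of a torus. -/
def chart (S : SurfaceOfRevolution) : Set ℝ :=
  match S.kind with
  | .toroidal => univ
  | _ => interior S.I

/-- The parametrization `x(u, φ) = (f(u) cos φ, f(u) sin φ, g(u))`. -/
def point (S : SurfaceOfRevolution) (u φ : ℝ) : EuclideanSpace ℝ (Fin 3) :=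
  !₂[S.f u * Real.cos φ, S.f u * Real.sin φ, S.g u]

/-- The function `h = - f f'' + (f')²`. -/
def h (S : SurfaceOfRevolution) (u : ℝ) : ℝ :=
  -(S.f u * iteratedDeriv 2 S.f u) + deriv S.f u ^ 2

/-- The fourth order condition
`β⁴ - 5(-f''f + (f')²)β² - 5f''(f')²f + 4(f'')²f² - 3f'''f'f² + 4(f')⁴ = 0` on the surface. -/
def FourthOrderCondition (S : SurfaceOfRevolution) (β : ℝ) : Prop :=
  ∀ u ∈ S.chart,
    β ^ 4 - 5 * (-(iteratedDeriv 2 S.f u * S.f u) + deriv S.f u ^ 2) * β ^ 2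
      - 5 * iteratedDeriv 2 S.f u * deriv S.f u ^ 2 * S.f u
      + 4 * iteratedDeriv 2 S.f u ^ 2 * S.f u ^ 2
      - 3 * iteratedDeriv 3 S.f u * deriv S.f u * S.f u ^ 2
      + 4 * deriv S.f u ^ 4 = 0

/-- `Θ` is an antiderivative of `1 / f²`. -/
def IsTheta (S : SurfaceOfRevolution) (Θ : ℝ → ℝ) : Prop :=
  ∀ u ∈ S.chart, HasDerivAt Θ (1 / S.f u ^ 2) u

/-- An analytic central potential on `S`: an analytic function of `u` alone, away from the points
where `f = 0`. The second condition says that `V` is a function on the surface; it only matters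
for tori, where it says that `V` has the period of the profile curve. -/
structure IsCentralPotential (S : SurfaceOfRevolution) (V : ℝ → ℝ) : Prop where
  analytic : AnalyticOnNhd ℝ V S.chart
  descends : ∀ u ∈ S.chart, ∀ v ∈ S.chart, S.f u = S.f v → S.g u = S.g v → V u = V v

/-- A non-singular orbit, i.e. one that exists for all times `t ≥ 0`, of a particle of mass `m` in
the central field with potential `V`: a solution `(u, φ, p_u, p_φ)` on `[0, ∞)` of Hamilton's
equations for `H = p_u² / (2m) + p_φ² / (2 m f(u)²) + V(u)`. -/
structure IsNonsingularOrbit (S : SurfaceOfRevolution) (m : ℝ) (V : ℝ → ℝ)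
    (u φ pu pφ : ℝ → ℝ) : Prop where
  mem : ∀ t, 0 ≤ t → u t ∈ S.chart
  u_dot : ∀ t, 0 ≤ t → HasDerivWithinAt u (pu t / m) (Ici 0) t
  φ_dot : ∀ t, 0 ≤ t → HasDerivWithinAt φ (pφ t / (m * S.f (u t) ^ 2)) (Ici 0) t
  pu_dot : ∀ t, 0 ≤ t → HasDerivWithinAt pu
    (pφ t ^ 2 * deriv S.f (u t) / (m * S.f (u t) ^ 3) - deriv V (u t)) (Ici 0) t
  pφ_dot : ∀ t, 0 ≤ t → HasDerivWithinAt pφ 0 (Ici 0) t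

/-- The orbit stays in a bounded region of `ℝ³`. -/
def IsBoundedOrbit (S : SurfaceOfRevolution) (u φ : ℝ → ℝ) : Prop :=
  Bornology.IsBounded ((fun t => S.point (u t) (φ t)) '' Ici 0)

/-- The orbit is closed: the particle's motion in `ℝ³` is periodic. -/
def IsClosedOrbit (S : SurfaceOfRevolution) (u φ : ℝ → ℝ) : Prop :=
  ∃ T : ℝ, 0 < T ∧ ∀ t, 0 ≤ t → S.point (u (t + T)) (φ (t + T)) = S.point (u t) (φ t)

/-- The orbit is circular: `u` is constant. -/
def IsCircularOrbit (u : ℝ → ℝ) : Prop :=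
  ∃ u₀ : ℝ, ∀ t, 0 ≤ t → u t = u₀

/-- `V` is an analytic central potential on `S`, with a force that is not identically zero, that
has at least one bounded non-singular non-circular orbit and all of whose bounded non-singular
orbits are closed. -/
structure IsClosedOrbitPotential (S : SurfaceOfRevolution) (m : ℝ) (V : ℝ → ℝ) : Prop where
  central : S.IsCentralPotential V
  nonconstant : ∃ u ∈ S.chart, ∃ v ∈ S.chart, V u ≠ V v
  exists_noncircular : ∃ u φ pu pφ : ℝ → ℝ, S.IsNonsingularOrbit m V u φ pu pφ ∧
    S.IsBoundedOrbit u φ ∧ ¬ IsCircularOrbit u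
  closed : ∀ u φ pu pφ : ℝ → ℝ, S.IsNonsingularOrbit m V u φ pu pφ →
    S.IsBoundedOrbit u φ → S.IsClosedOrbit u φ

/-- Two potentials agree up to a non-zero multiplicative constant and an additive constant. -/
def SamePotential (S : SurfaceOfRevolution) (V W : ℝ → ℝ) : Prop :=
  ∃ a c : ℝ, a ≠ 0 ∧ ∀ u ∈ S.chart, V u = a * W u + c

/-- Up to multiplicative and additive constants there are at most two potentials on `S` all of
whose bounded non-singular orbits are closed. -/
def AtMostTwo (S : SurfaceOfRevolution) (m : ℝ) : Prop :=
  ∃ V₁ V₂ : ℝ → ℝ, ∀ V, S.IsClosedOrbitPotential m V →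
    S.SamePotential V V₁ ∨ S.SamePotential V V₂

/-- Up to multiplicative and additive constants there are exactly two such potentials on `S`. -/
def ExactlyTwo (S : SurfaceOfRevolution) (m : ℝ) : Prop :=
  ∃ V₁ V₂ : ℝ → ℝ, S.IsClosedOrbitPotential m V₁ ∧ S.IsClosedOrbitPotential m V₂ ∧
    ¬ S.SamePotential V₁ V₂ ∧
    ∀ V, S.IsClosedOrbitPotential m V → S.SamePotential V V₁ ∨ S.SamePotential V V₂

/-- Up to multiplicative and additive constants there is at most one such potential on `S`. -/
def AtMostOne (S : SurfaceOfRevolution) (m : ℝ) : Prop :=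
  ∀ V W, S.IsClosedOrbitPotential m V → S.IsClosedOrbitPotential m W → S.SamePotential V W

end SurfaceOfRevolution

end

/-! ### Geometry of the chart and of points on the surface -/

open Set
open scoped ContDiff
noncomputable section

open Filter Topology

namespace SurfaceOfRevolution

variable (S : SurfaceOfRevolution)

/-! Let `Θ` be an antiderivative of `1 / f²`, let `D` be differentiation with respect to `Θ`, and
let `F = 1 / (2 f²)`. An orbit with angular momentum `L` moves in `u` like a particle in the
effective potential `W = V + μ F` with `μ = L² / m`.

Necessity. If all bounded orbits close, none can approach a critical point of `W` asymptotically
(`not_lt_near_critical`). Hence, when `W` is not constant, its critical points are strict minima and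
there is at most one (`critical_unique`); in particular tori carry no such potential. The increase
of `φ` during one oscillation must be a rational multiple of `2 π` (`angle_rational`) and depends
continuously on the well (`continuous_wellAngle`), so it is one constant `2 π r` for all wells over
some interval (`exists_angle_eq`). By Abel inversion in the energy, an angle independent of the
energy means that the width of the well, measured in `Θ`, is proportional to the square root of the
height above the bottom (`width_of_wellAngle_eq`). Expanding this law to fourth order at the bottom
yields `D²W = b² μ`, with `b = 1 / r`, and `3 D²W D⁴W = 5 (D³W)²` (`isochronous_conditions`). Every
point of the interval is the bottom of a well for `μ = -V' / F'`, so `μ` and the derivatives of `F`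
can be eliminated. What remains is `D²V DF - DV D²F = -b² DV` and `3 DV D³V = 4 (D²V)²`
(`differential_equations`).

The second equation integrates explicitly (`classification`). Either `DV` is constant, and then `h =
D²F = b²`; or `V = k / y² + c` for an antiderivative `y` of `1 / f²` with `y (h - b²) = 3 f' / f`.
The latter equation determines `y`, even if two different values of `b` are allowed
(`IsTheta.eqOn_of_oscillator`). So each type contributes at most one potential, and a nonconstant
`h` rules out the first type.

Sufficiency. If `h = b²`, normalize `Θ` by `f' / f = -b² Θ`. Then `1 / f² = b² Θ² + κ`, so the
centrifugal term is quadratic in `Θ`. With `φ` in the role of time, `Θ` (for `V = a Θ`) or `Θ²` (for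
`V = k / Θ²`) performs a harmonic motion of frequency `b` or `2 b` about a constant
(`eq_cos_add_sin_of_rotation`), and a rational `b` closes the orbit (`isClosedOrbit_of_periodic`).
For the plane, `f = u` and `Θ = -1 / u`, these are the Kepler problem and the harmonic oscillator.
Orbits with `L = 0` need a separate argument: they are either unbounded or singular, by a Riccati
estimate that uses `|f'| ≤ 1` (`nonneg_of_ray`). -/

theorem chart_eq_interior {S : SurfaceOfRevolution} (hk : S.kind ≠ .toroidal) :
    S.chart = interior S.I := by
  unfold chart
  cases h : S.kind <;> simp_all

theorem chart_eq_univ {S : SurfaceOfRevolution} (hk : S.kind = .toroidal) :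
    S.chart = univ := by
  unfold chart
  simp [hk]

theorem ordConnected_I : S.I.OrdConnected := by
  have hp := S.profile
  cases h : S.kind <;> rw [h] at hp
  · obtain ⟨c, d, -, hI, -⟩ := hp
    rw [hI]; exact ordConnected_Icc
  · obtain ⟨c, d, -, hI, -⟩ := hp
    rw [hI]
    exact ⟨fun x hx y hy z hz => ⟨hx.1.trans_le (EReal.coe_le_coe_iff.2 hz.1),
      (EReal.coe_le_coe_iff.2 hz.2).trans_lt hy.2⟩⟩
  · obtain ⟨c, d, -, hI, -⟩ := hp
    rw [hI]; exact ordConnected_Icc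
  · obtain ⟨c, d, -, hI, -⟩ := hp
    rw [hI]
    exact ⟨fun x hx y hy z hz => ⟨hx.1.trans hz.1,
      (EReal.coe_le_coe_iff.2 hz.2).trans_lt hy.2⟩⟩

theorem convex_chart : Convex ℝ S.chart := by
  by_cases hk : S.kind = .toroidal
  · rw [chart_eq_univ hk]; exact convex_univ
  · rw [chart_eq_interior hk]; exact S.ordConnected_I.convex.interior

theorem isOpen_chart : IsOpen S.chart := by
  by_cases hk : S.kind = .toroidal
  · rw [chart_eq_univ hk]; exact isOpen_univ
  · rw [chart_eq_interior hk]; exact isOpen_interior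

theorem ordConnected_chart : S.chart.OrdConnected := S.convex_chart.ordConnected

theorem isPreconnected_chart : IsPreconnected S.chart := S.convex_chart.isPreconnected

theorem chart_mem_nhds {u : ℝ} (hu : u ∈ S.chart) : S.chart ∈ 𝓝 u :=
  S.isOpen_chart.mem_nhds hu

theorem chart_nonempty : S.chart.Nonempty := by
  by_cases hk : S.kind = .toroidal
  · rw [chart_eq_univ hk]; exact univ_nonempty
  rw [chart_eq_interior hk]
  suffices H : ∃ a b : ℝ, a < b ∧ Ioo a b ⊆ S.I by
    obtain ⟨a, b, hab, hsub⟩ := H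
    exact (nonempty_Ioo.2 hab).mono (interior_maximal hsub isOpen_Ioo)
  have hp := S.profile
  cases h : S.kind <;> rw [h] at hp
  · obtain ⟨c, d, hcd, hI, -⟩ := hp
    exact ⟨c, d, hcd, hI ▸ Ioo_subset_Icc_self⟩
  · obtain ⟨c, d, hcd, hI, -⟩ := hp
    obtain ⟨a, hca, had⟩ := EReal.lt_iff_exists_real_btwn.1 hcd
    obtain ⟨b, hab, hbd⟩ := EReal.lt_iff_exists_real_btwn.1 had
    refine ⟨a, b, EReal.coe_lt_coe_iff.1 hab, ?_⟩
    rw [hI]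
    exact fun x hx => ⟨hca.trans (EReal.coe_lt_coe_iff.2 hx.1),
      (EReal.coe_lt_coe_iff.2 hx.2).trans hbd⟩
  · exact absurd h hk
  · obtain ⟨c, d, hcd, hI, -⟩ := hp
    obtain ⟨b, hab, hbd⟩ := EReal.lt_iff_exists_real_btwn.1 hcd
    refine ⟨c, b, EReal.coe_lt_coe_iff.1 hab, ?_⟩
    rw [hI]
    exact fun x hx => ⟨hx.1.le, (EReal.coe_lt_coe_iff.2 hx.2).trans hbd⟩

theorem f_pos_of_mem_chart {u : ℝ} (hu : u ∈ S.chart) : 0 < S.f u := by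
  by_cases hk : S.kind = .toroidal
  · have hp := S.profile
    have hpos := S.f_pos
    rw [hk] at hp
    obtain ⟨c, d, hcd, hI, hc, hper, -⟩ := hp
    rw [hI, interior_Icc] at hpos
    have hP : 0 < d - c := sub_pos.2 hcd
    obtain ⟨v, hv, huv⟩ := hper.exists_mem_Ico hP u c
    rw [huv]
    -- `f_pos` speaks only of the interior of one period; at the endpoint the positivity is part of
    -- the toroidal profile.
    rcases hv.1.eq_or_lt with h | h
    · exact h ▸ hc
    · exact hpos v ⟨h, by linarith [hv.2]⟩
  · rw [chart_eq_interior hk] at hu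
    exact S.f_pos u hu

theorem abs_deriv_f_le_one {S : SurfaceOfRevolution} (hk : S.kind ≠ .toroidal) {u : ℝ}
    (hu : u ∈ S.chart) : |deriv S.f u| ≤ 1 := by
  rw [chart_eq_interior hk] at hu
  have := S.unit_speed u hu
  exact abs_le_one_iff_mul_self_le_one.2 (by nlinarith [sq_nonneg (deriv S.g u)])

theorem continuousOn_g : ContinuousOn S.g S.chart := by
  by_cases hk : S.kind = .toroidal
  · have hp := S.profile
    rw [hk] at hp
    obtain ⟨c, d, -, -, -, -, -, -, hg, -⟩ := hp
    exact hg.continuous.continuousOn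
  · rw [chart_eq_interior hk]
    exact S.smooth_g.continuousOn.mono interior_subset

theorem eq_of_profile_eq {S : SurfaceOfRevolution} (hk : S.kind ≠ .toroidal) {u v : ℝ}
    (hu : u ∈ S.chart) (hv : v ∈ S.chart) (hf : S.f u = S.f v) (hg : S.g u = S.g v) : u = v := by
  rw [chart_eq_interior hk] at hu hv
  have H : InjOn (fun u => (S.f u, S.g u)) S.I := by
    have hp := S.profile
    cases h : S.kind <;> rw [h] at hp
    · obtain ⟨c, d, -, -, -, -, H⟩ := hp; exact H
    · obtain ⟨c, d, -, -, H⟩ := hp; exact H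
    · exact absurd h hk
    · obtain ⟨c, d, -, -, -, H⟩ := hp; exact H
  exact H (interior_subset hu) (interior_subset hv) (Prod.ext hf hg)

/-- On a torus the chart is the universal cover, where the profile is injective only modulo its
period. The period serves as `ε`: two parameters of the same profile point differ by an integer
multiple of it. For the other kinds any `ε` will do. -/
theorem exists_local_profile_injective : ∃ ε > 0, ∀ u ∈ S.chart, ∀ v ∈ S.chart,
    |u - v| < ε → S.f u = S.f v → S.g u = S.g v → u = v := by
  by_cases hk : S.kind = .toroidal
  · have hp := S.profile
    rw [hk] at hp
    obtain ⟨c, d, hcd, -, -, hf, hg, -, -, hinj⟩ := hp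
    have hP : 0 < d - c := sub_pos.2 hcd
    refine ⟨d - c, hP, fun u _ v _ huv hfe hge => ?_⟩
    have key : ∀ w, toIcoMod hP c w ∈ Ico c d ∧ S.f (toIcoMod hP c w) = S.f w ∧
        S.g (toIcoMod hP c w) = S.g w := by
      intro w
      refine ⟨?_, ?_, ?_⟩
      · have := toIcoMod_mem_Ico hP c w
        rwa [add_sub_cancel] at this
      · rw [toIcoMod]; exact hf.sub_zsmul_eq _
      · rw [toIcoMod]; exact hg.sub_zsmul_eq _
    have heq := hinj (key u).1 (key v).1 (Prod.ext ((key u).2.1.trans (hfe.trans (key v).2.1.symm))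
      ((key u).2.2.trans (hge.trans (key v).2.2.symm)))
    rw [toIcoMod, toIcoMod] at heq
    have h2 : u - v = ((toIcoDiv hP c u - toIcoDiv hP c v : ℤ) : ℝ) * (d - c) := by
      simp only [zsmul_eq_mul] at heq
      push_cast
      linarith
    rw [h2, abs_mul, abs_of_pos hP] at huv
    have h3 : |((toIcoDiv hP c u - toIcoDiv hP c v : ℤ) : ℝ)| < 1 := by
      by_contra h
      push Not at h
      nlinarith
    have h4 : toIcoDiv hP c u - toIcoDiv hP c v = 0 := by
      rw [← Int.cast_abs] at h3
      exact Int.abs_lt_one_iff.1 (by exact_mod_cast h3)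
    rw [h4] at h2
    simp at h2
    linarith
  · exact ⟨1, one_pos, fun u hu v hv _ hf hg => eq_of_profile_eq hk hu hv hf hg⟩

theorem point_ext_iff {u v φ ψ : ℝ} : S.point u φ = S.point v ψ ↔
    S.f u * Real.cos φ = S.f v * Real.cos ψ ∧ S.f u * Real.sin φ = S.f v * Real.sin ψ ∧
      S.g u = S.g v := by
  constructor
  · intro h
    refine ⟨?_, ?_, ?_⟩
    · simpa [point] using congrArg (fun x : EuclideanSpace ℝ (Fin 3) => x 0) h
    · simpa [point] using congrArg (fun x : EuclideanSpace ℝ (Fin 3) => x 1) h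
    · simpa [point] using congrArg (fun x : EuclideanSpace ℝ (Fin 3) => x 2) h
  · rintro ⟨h0, h1, h2⟩
    simp [point, h0, h1, h2]

theorem profile_eq_of_point_eq {u v φ ψ : ℝ} (hu : u ∈ S.chart) (hv : v ∈ S.chart)
    (h : S.point u φ = S.point v ψ) :
    S.f u = S.f v ∧ S.g u = S.g v ∧ Real.cos φ = Real.cos ψ := by
  obtain ⟨h0, h1, h2⟩ := S.point_ext_iff.1 h
  have hfu := S.f_pos_of_mem_chart hu
  have hfv := S.f_pos_of_mem_chart hv
  have h3 : S.f u ^ 2 = S.f v ^ 2 := by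
    have e1 : S.f u ^ 2 = (S.f u * Real.cos φ) ^ 2 + (S.f u * Real.sin φ) ^ 2 := by
      linear_combination (-S.f u ^ 2) * Real.sin_sq_add_cos_sq φ
    have e2 : S.f v ^ 2 = (S.f v * Real.cos ψ) ^ 2 + (S.f v * Real.sin ψ) ^ 2 := by
      linear_combination (-S.f v ^ 2) * Real.sin_sq_add_cos_sq ψ
    rw [e1, e2, h0, h1]
  have h4 : S.f u = S.f v := by
    rcases sq_eq_sq_iff_eq_or_eq_neg.1 h3 with h | h <;> linarith
  refine ⟨h4, h2, ?_⟩
  rw [h4] at h0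
  exact mul_left_cancel₀ hfv.ne' h0

theorem norm_point_sq (u φ : ℝ) : ‖S.point u φ‖ ^ 2 = S.f u ^ 2 + S.g u ^ 2 := by
  rw [EuclideanSpace.norm_sq_eq]
  simp only [point, Fin.sum_univ_three, Real.norm_eq_abs, sq_abs]
  simp
  linear_combination (S.f u ^ 2) * Real.sin_sq_add_cos_sq φ

theorem isBoundedOrbit_of_compact {K : Set ℝ} (hK : IsCompact K) (hKJ : K ⊆ S.chart)
    (hfc : ContinuousOn S.f S.chart) {u φ : ℝ → ℝ} (hu : ∀ t, 0 ≤ t → u t ∈ K) :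
    S.IsBoundedOrbit u φ := by
  have hc : ContinuousOn (fun v => S.f v ^ 2 + S.g v ^ 2) K :=
    ((hfc.pow 2).add (S.continuousOn_g.pow 2)).mono hKJ
  obtain ⟨C, hC⟩ := hK.exists_bound_of_continuousOn hc
  refine isBounded_iff_forall_norm_le.2 ⟨C + 1, ?_⟩
  rintro _ ⟨t, ht, rfl⟩
  have h1 := hC (u t) (hu t ht)
  have h2 := S.norm_point_sq (u t) (φ t)
  have h3 := (le_abs_self _).trans h1
  nlinarith [norm_nonneg (S.point (u t) (φ t)), sq_nonneg (‖S.point (u t) (φ t)‖ - 1)]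

/-- Boundedness in space enters the proof through this bound: it keeps `1 / f²`, hence angular
speeds and radial forces, away from zero along the orbit. -/
theorem exists_f_le_of_isBoundedOrbit {u φ : ℝ → ℝ} (h : S.IsBoundedOrbit u φ) :
    ∃ R > 0, ∀ t, 0 ≤ t → S.f (u t) ≤ R := by
  obtain ⟨C, hC⟩ := isBounded_iff_forall_norm_le.1 h
  refine ⟨|C| + 1, by positivity, fun t ht => ?_⟩
  have h1 := hC _ ⟨t, ht, rfl⟩
  have h2 := S.norm_point_sq (u t) (φ t)
  have h3 : S.f (u t) ^ 2 ≤ ‖S.point (u t) (φ t)‖ ^ 2 := by nlinarith [sq_nonneg (S.g (u t))]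
  have h4 := abs_le_of_sq_le_sq h3 (norm_nonneg _)
  dsimp only at h1
  linarith [le_abs_self (S.f (u t)), le_abs_self C]

theorem exists_isTheta (hfc : ContinuousOn S.f S.chart) : ∃ Θ, S.IsTheta Θ := by
  obtain ⟨a, ha⟩ := S.chart_nonempty
  have hc : ContinuousOn (fun v => 1 / S.f v ^ 2) S.chart :=
    continuousOn_const.div (hfc.pow 2) fun v hv => (pow_pos (S.f_pos_of_mem_chart hv) 2).ne'
  refine ⟨fun u => ∫ v in a..u, 1 / S.f v ^ 2, fun u hu => ?_⟩
  refine intervalIntegral.integral_hasDerivAt_right ?_ ?_ (hc.continuousAt (S.chart_mem_nhds hu))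
  · exact (hc.mono (S.ordConnected_chart.uIcc_subset ha hu)).intervalIntegrable
  · exact hc.stronglyMeasurableAtFilter S.isOpen_chart u hu

end SurfaceOfRevolution
end

/-! ### Change of time, effective potentials and Hamilton's equations -/

open Set
open scoped ContDiff
noncomputable section

open Filter Topology

/-- A positive continuous function bounded away from zero can be used to change time. -/
theorem exists_time_change {κ : ℝ → ℝ} (hκ : Continuous κ) {δ : ℝ} (hδ : 0 < δ)
    (hle : ∀ s, δ ≤ κ s) :
    ∃ θ : ℝ → ℝ, θ 0 = 0 ∧ StrictMono θ ∧ Function.Surjective θ ∧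
      ∀ t, HasDerivAt θ (κ (θ t))⁻¹ t := by
  set τ : ℝ → ℝ := fun s => ∫ x in (0 : ℝ)..s, κ x with hτ
  have hd : ∀ s, HasDerivAt τ (κ s) s := fun s =>
    intervalIntegral.integral_hasDerivAt_right (hκ.intervalIntegrable _ _)
      (hκ.stronglyMeasurableAtFilter _ _) hκ.continuousAt
  have hpos : ∀ s, 0 < κ s := fun s => hδ.trans_le (hle s)
  have hmono : StrictMono τ := strictMono_of_hasDerivAt_pos hd hpos
  have hcont : Continuous τ := continuous_iff_continuousAt.2 fun s => (hd s).continuousAt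
  -- The lower bound for `κ` makes the elapsed time `τ` grow at least linearly in both directions,
  -- hence onto; `θ` is its inverse.
  have hmono2 : Monotone fun s => τ s - δ * s := by
    refine monotone_of_hasDerivAt_nonneg (f' := fun s => κ s - δ) (fun s => ?_) fun s => ?_
    · simpa using (hd s).fun_sub ((hasDerivAt_id s).const_mul δ)
    · simpa using hle s
  have h0 : τ 0 = 0 := by simp [hτ]
  have htop : Tendsto τ atTop atTop := by
    refine tendsto_atTop_mono' _ ?_ (tendsto_id.const_mul_atTop hδ)
    filter_upwards [eventually_ge_atTop 0] with s hs
    have := hmono2 hs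
    simp only [h0] at this
    simp only [id]
    linarith
  have hbot : Tendsto τ atBot atBot := by
    refine tendsto_atBot_mono' _ ?_ (tendsto_id.const_mul_atBot hδ)
    filter_upwards [eventually_le_atBot 0] with s hs
    have := hmono2 hs
    simp only [h0] at this
    simp only [id]
    linarith
  have hsurj : Function.Surjective τ := hcont.surjective htop hbot
  let e : ℝ ≃o ℝ := hmono.orderIsoOfSurjective τ hsurj
  have he : ∀ s, e s = τ s := fun s => rfl
  refine ⟨e.symm, ?_, e.symm.strictMono, e.symm.surjective, fun t => ?_⟩
  · rw [OrderIso.symm_apply_eq, he, h0]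
  · refine HasDerivAt.of_local_left_inverse e.symm.continuous.continuousAt (hd _) (hpos _).ne' ?_
    exact Eventually.of_forall fun y => e.apply_symm_apply y

namespace SurfaceOfRevolution

variable (S : SurfaceOfRevolution)

/-- The centrifugal potential of unit strength. -/
def F (u : ℝ) : ℝ := 1 / (2 * S.f u ^ 2)

/-- The effective potential of the motion of `u`. -/
def effPot (V : ℝ → ℝ) (μ u : ℝ) : ℝ := V u + μ * S.F u

variable {S}

theorem hasDerivAt_f (hf : AnalyticOnNhd ℝ S.f S.chart) {u : ℝ} (hu : u ∈ S.chart) :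
    HasDerivAt S.f (deriv S.f u) u := (hf u hu).differentiableAt.hasDerivAt

theorem hasDerivAt_F (hf : AnalyticOnNhd ℝ S.f S.chart) {u : ℝ} (hu : u ∈ S.chart) :
    HasDerivAt S.F (-(deriv S.f u / S.f u ^ 3)) u := by
  have hp := S.f_pos_of_mem_chart hu
  have h := (((hasDerivAt_f hf hu).fun_pow 2).const_mul 2).fun_inv
    (mul_pos two_pos (pow_pos hp 2)).ne'
  have e : S.F = fun x => (2 * S.f x ^ 2)⁻¹ := by
    funext x; simp [F, one_div]
  rw [e]
  refine h.congr_deriv ?_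
  field_simp
  ring

theorem analyticOnNhd_F (hf : AnalyticOnNhd ℝ S.f S.chart) : AnalyticOnNhd ℝ S.F S.chart := by
  intro u hu
  have hp := S.f_pos_of_mem_chart hu
  exact analyticAt_const.div (analyticAt_const.mul ((hf u hu).pow 2)) (by positivity)

theorem analyticOnNhd_effPot (hf : AnalyticOnNhd ℝ S.f S.chart) {V : ℝ → ℝ}
    (hV : AnalyticOnNhd ℝ V S.chart) (μ : ℝ) : AnalyticOnNhd ℝ (S.effPot V μ) S.chart :=
  fun u hu => (hV u hu).add (analyticAt_const.mul (analyticOnNhd_F hf u hu))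

theorem deriv_effPot (hf : AnalyticOnNhd ℝ S.f S.chart) {V : ℝ → ℝ}
    (hV : AnalyticOnNhd ℝ V S.chart) (μ : ℝ) {u : ℝ} (hu : u ∈ S.chart) :
    deriv (S.effPot V μ) u = deriv V u + μ * deriv S.F u :=
  ((hV u hu).differentiableAt.hasDerivAt.add
    ((analyticOnNhd_F hf u hu).differentiableAt.hasDerivAt.const_mul μ)).deriv

theorem hasDerivAt_effPot (hf : AnalyticOnNhd ℝ S.f S.chart) {V : ℝ → ℝ}
    (hV : AnalyticOnNhd ℝ V S.chart) (μ : ℝ) {u : ℝ} (hu : u ∈ S.chart) :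
    HasDerivAt (S.effPot V μ) (deriv (S.effPot V μ) u) u :=
  (analyticOnNhd_effPot hf hV μ u hu).differentiableAt.hasDerivAt

theorem force_eq (hf : AnalyticOnNhd ℝ S.f S.chart) {V : ℝ → ℝ}
    (hV : AnalyticOnNhd ℝ V S.chart) {m : ℝ} (hm : 0 < m) (L : ℝ) {u : ℝ} (hu : u ∈ S.chart) :
    L ^ 2 * deriv S.f u / (m * S.f u ^ 3) - deriv V u = -deriv (S.effPot V (L ^ 2 / m)) u := by
  have hp := S.f_pos_of_mem_chart hu
  rw [deriv_effPot hf hV _ hu, (hasDerivAt_F hf hu).deriv]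
  field_simp
  ring

/-- A motion of `u` in the effective potential, together with the angle, is an orbit. -/
theorem isNonsingularOrbit_of_effPot (hf : AnalyticOnNhd ℝ S.f S.chart) {V : ℝ → ℝ}
    (hV : AnalyticOnNhd ℝ V S.chart) {m : ℝ} (hm : 0 < m) (L : ℝ) {u φ p : ℝ → ℝ}
    (hmem : ∀ t, 0 ≤ t → u t ∈ S.chart) (hu : ∀ t, 0 ≤ t → HasDerivAt u (p t / m) t)
    (hp : ∀ t, 0 ≤ t → HasDerivAt p (-deriv (S.effPot V (L ^ 2 / m)) (u t)) t)
    (hφ : ∀ t, 0 ≤ t → HasDerivAt φ (L / (m * S.f (u t) ^ 2)) t) :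
    S.IsNonsingularOrbit m V u φ p fun _ => L where
  mem := hmem
  u_dot t ht := (hu t ht).hasDerivWithinAt
  φ_dot t ht := (hφ t ht).hasDerivWithinAt
  pu_dot t ht := by
    rw [force_eq hf hV hm L (hmem t ht)]
    exact (hp t ht).hasDerivWithinAt
  pφ_dot t _ := hasDerivWithinAt_const _ _ _

/-- Along an orbit `p_φ` is constant. -/
theorem IsNonsingularOrbit.pφ_eq {m : ℝ} {V u φ pu pφ : ℝ → ℝ}
    (h : S.IsNonsingularOrbit m V u φ pu pφ) {t : ℝ} (ht : 0 ≤ t) : pφ t = pφ 0 := by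
  refine constant_of_has_deriv_right_zero (a := 0) (b := t) ?_ ?_ t ⟨ht, le_rfl⟩
  · exact fun s hs => ((h.pφ_dot s hs.1).continuousWithinAt).mono Icc_subset_Ici_self
  · exact fun s hs => (h.pφ_dot s hs.1).mono (Ici_subset_Ici.2 hs.1)

end SurfaceOfRevolution
end

/-! ### Orbits asymptotic to a critical point -/

open Set
open scoped ContDiff
noncomputable section

open Filter Topology

/-- A one-dimensional motion that approaches a critical point `a` of the potential `W` from
below in energy takes infinite time to arrive. -/
theorem exists_asymptotic_motion {W : ℝ → ℝ} {m a σ ε C : ℝ} (hm : 0 < m) (hσ : σ ^ 2 = 1)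
    (hε : 0 < ε) (hC : 0 < C) (hd : ∀ s ∈ Ioo 0 ε, DifferentiableAt ℝ W (a - σ * s))
    (hlt : ∀ s ∈ Ioo 0 ε, W (a - σ * s) < W a)
    (hle : ∀ s ∈ Ioo 0 ε, W a - W (a - σ * s) ≤ C * s ^ 2) :
    ∃ u p : ℝ → ℝ, (∀ t, 0 ≤ t → HasDerivAt u (p t / m) t) ∧
      (∀ t, 0 ≤ t → HasDerivAt p (-deriv W (u t)) t) ∧
      (∀ t, 0 ≤ t → |u t - a| ≤ ε / 2) ∧ Function.Injective u := by
  set ρ := ε / 2 with hρ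
  have hρ0 : 0 < ρ := by positivity
  -- The distance to `a` is written as `ρ e^{-x}`. Since `ds = -s dx` and the momentum is at most
  -- `√(2 m C) s`, the factor `s` cancels and `K = dt / dx` is bounded below; so `x` can be turned
  -- into a time that runs through all of `[0, ∞)`.
  set s : ℝ → ℝ := fun x => ρ * Real.exp (-x) with hs
  have hs0 : ∀ x, 0 < s x := fun x => by positivity
  have hsle : ∀ x, 0 ≤ x → s x ≤ ρ := fun x hx => by
    have : Real.exp (-x) ≤ 1 := Real.exp_le_one_iff.2 (by linarith)
    simp only [hs]; nlinarith
  have hsm : ∀ x, 0 ≤ x → s x ∈ Ioo 0 ε := fun x hx =>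
    ⟨hs0 x, (hsle x hx).trans_lt (by rw [hρ]; linarith)⟩
  have hsc : Continuous s := by fun_prop
  set Δ : ℝ → ℝ := fun x => W a - W (a - σ * x) with hΔ
  set K : ℝ → ℝ := fun x => m * s x / √(2 * m * Δ (s x)) with hK
  have hΔ0 : ∀ x, 0 ≤ x → 0 < 2 * m * Δ (s x) := fun x hx =>
    mul_pos (by positivity) (sub_pos.2 (hlt _ (hsm x hx)))
  have hKc : ∀ x, 0 ≤ x → ContinuousAt K x := fun x hx => by
    have h1 : ContinuousAt (fun y => W (a - σ * s y)) x :=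
      ContinuousAt.comp (f := fun y => a - σ * s y) (hd _ (hsm x hx)).continuousAt (by fun_prop)
    have h2 : ContinuousAt (fun y => √(2 * m * Δ (s y))) x :=
      (continuousAt_const.mul (continuousAt_const.sub h1)).sqrt
    exact (continuousAt_const.mul hsc.continuousAt).div h2 (Real.sqrt_pos.2 (hΔ0 x hx)).ne'
  have hKcont : Continuous fun x => K (max x 0) := continuous_iff_continuousAt.2 fun x =>
    ContinuousAt.comp (f := fun y => max y 0) (hKc _ (le_max_right _ _)) (by fun_prop)
  have hδ : 0 < m / √(2 * m * C) := div_pos hm (Real.sqrt_pos.2 (by positivity))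
  have hKle : ∀ x, m / √(2 * m * C) ≤ K (max x 0) := fun x => by
    set y := max x 0
    have hy : 0 ≤ y := le_max_right _ _
    have h1 : √(2 * m * Δ (s y)) ≤ √(2 * m * C) * s y := by
      rw [← Real.sqrt_sq (hs0 y).le, ← Real.sqrt_mul (by positivity)]
      apply Real.sqrt_le_sqrt
      have := hle _ (hsm y hy)
      rw [Real.sqrt_sq (hs0 y).le]
      nlinarith
    rw [hK]
    dsimp only
    rw [div_le_div_iff₀ (Real.sqrt_pos.2 (by positivity)) (Real.sqrt_pos.2 (hΔ0 y hy))]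
    nlinarith
  obtain ⟨θ, hθ0, hθm, -, hθd⟩ := exists_time_change hKcont hδ hKle
  have hθpos : ∀ t, 0 ≤ t → 0 ≤ θ t := fun t ht => hθ0 ▸ hθm.monotone ht
  have hσ0 : σ ≠ 0 := by rintro rfl; norm_num at hσ
  have hu : ∀ t, 0 ≤ t → HasDerivAt (fun t => a - σ * s (θ t))
      (σ * √(2 * m * Δ (s (θ t))) / m) t := fun t ht => by
    have h1 := hθd t
    rw [max_eq_left (hθpos t ht)] at h1
    have h2 := (((h1.neg).exp.const_mul ρ).const_mul σ).const_sub a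
    refine h2.congr_deriv ?_
    have h3 := (Real.sqrt_pos.2 (hΔ0 _ (hθpos t ht))).ne'
    have h4 := (hs0 (θ t)).ne'
    simp only [hK, Pi.neg_apply]
    have h5 : ρ * Real.exp (-θ t) = s (θ t) := rfl
    rw [inv_div]
    calc -(σ * (ρ * (Real.exp (-θ t) * -(√(2 * m * Δ (s (θ t))) / (m * s (θ t))))))
        = σ * (ρ * Real.exp (-θ t)) * √(2 * m * Δ (s (θ t))) / (m * s (θ t)) := by ring
      _ = _ := by rw [h5]; field_simp
  refine ⟨fun t => a - σ * s (θ t), fun t => σ * √(2 * m * Δ (s (θ t))), hu, ?_, ?_, ?_⟩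
  · intro t ht
    have hpos := hΔ0 _ (hθpos t ht)
    have h1 : HasDerivAt (fun t => W (a - σ * s (θ t))) _ t :=
      HasDerivAt.comp t (hd _ (hsm _ (hθpos t ht))).hasDerivAt (hu t ht)
    have h2 := (((h1.const_sub (W a)).const_mul (2 * m)).sqrt hpos.ne').const_mul σ
    refine h2.congr_deriv ?_
    have h3 := (Real.sqrt_pos.2 hpos).ne'
    simp only [hΔ] at h3 ⊢
    field_simp
    linear_combination (-deriv W (a - σ * s (θ t))) * hσ
  · intro t ht
    have h1 : |σ| = 1 := by
      rw [← sq_eq_sq₀ (abs_nonneg _) one_pos.le, sq_abs, hσ, one_pow]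
    have : a - σ * s (θ t) - a = -(σ * s (θ t)) := by ring
    rw [this, abs_neg, abs_mul, h1, one_mul, abs_of_pos (hs0 _)]
    exact hsle _ (hθpos t ht)
  · intro t₁ t₂ h
    have h1 : s (θ t₁) = s (θ t₂) := mul_left_cancel₀ hσ0 (by simpa using h)
    have h2 := Real.exp_injective (mul_left_cancel₀ hρ0.ne' h1)
    exact hθm.injective (neg_injective h2)

namespace SurfaceOfRevolution

variable {S : SurfaceOfRevolution}

theorem exists_angle (hf : AnalyticOnNhd ℝ S.f S.chart) {m : ℝ} (hm : 0 < m) (L : ℝ)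
    {u : ℝ → ℝ} (hmem : ∀ t, 0 ≤ t → u t ∈ S.chart) (hu : ∀ t, 0 ≤ t → ContinuousAt u t) :
    ∃ φ : ℝ → ℝ, ∀ t, 0 ≤ t → HasDerivAt φ (L / (m * S.f (u t) ^ 2)) t := by
  -- Nothing is known about `u` at negative times, so it is frozen there at `u 0`.
  have hc : Continuous fun t => L / (m * S.f (u (max t 0)) ^ 2) := by
    refine continuous_iff_continuousAt.2 fun t => ?_
    have h0 : (0 : ℝ) ≤ max t 0 := le_max_right _ _
    have h1 : ContinuousAt (fun t => u (max t 0)) t :=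
      ContinuousAt.comp (f := fun y => max y 0) (hu _ h0) (by fun_prop)
    have h2 : ContinuousAt (fun t => S.f (u (max t 0))) t :=
      ContinuousAt.comp (f := fun t => u (max t 0)) (hf _ (hmem _ h0)).continuousAt h1
    have h3 := S.f_pos_of_mem_chart (hmem _ h0)
    exact continuousAt_const.div (continuousAt_const.mul (h2.pow 2)) (by positivity)
  refine ⟨fun t => ∫ s in (0 : ℝ)..t, L / (m * S.f (u (max s 0)) ^ 2), fun t ht => ?_⟩
  have := intervalIntegral.integral_hasDerivAt_right (hc.intervalIntegrable 0 t)
    (hc.stronglyMeasurableAtFilter _ _) hc.continuousAt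
  rwa [max_eq_left ht] at this

/-- All bounded orbits being closed excludes orbits that approach a critical point of the effective
potential asymptotically. -/
theorem IsClosedOrbitPotential.not_lt_near_critical (hf : AnalyticOnNhd ℝ S.f S.chart) {m : ℝ}
    (hm : 0 < m) {V : ℝ → ℝ} (hV : S.IsClosedOrbitPotential m V) {μ : ℝ} (hμ : 0 ≤ μ) {a : ℝ}
    (ha : a ∈ S.chart) (hcrit : deriv (S.effPot V μ) a = 0) {σ : ℝ} (hσ : σ ^ 2 = 1) :
    ¬ ∀ᶠ s in 𝓝[>] (0 : ℝ), S.effPot V μ (a - σ * s) < S.effPot V μ a := by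
  intro hlt
  set W := S.effPot V μ with hW
  have hWa := analyticOnNhd_effPot hf hV.central.analytic μ
  obtain ⟨ε₀, hε₀, hinj⟩ := S.exists_local_profile_injective
  have habs : |σ| = 1 := by
    rw [← sq_eq_sq₀ (abs_nonneg _) one_pos.le, sq_abs, hσ, one_pow]
  -- a quadratic bound for `W` near `a`
  obtain ⟨C, hC, hbound⟩ : ∃ C > 0, ∀ᶠ u in 𝓝 a, |deriv W u| ≤ C * |u - a| := by
    have h1 : (fun u => deriv W u - deriv W a) =O[𝓝 a] fun u => u - a :=
      ((hWa a ha).deriv.differentiableAt.hasDerivAt).isBigO_sub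
    obtain ⟨C, hC, h⟩ := h1.exists_pos
    refine ⟨C, hC, ?_⟩
    filter_upwards [h.bound] with u hu
    simpa [hcrit] using hu
  obtain ⟨ε₁, hε₁, hb⟩ := Metric.eventually_nhds_iff_ball.1
    (hbound.and (S.isOpen_chart.eventually_mem ha))
  obtain ⟨ε₂, hε₂, hlt'⟩ := mem_nhdsGT_iff_exists_Ioo_subset.1 hlt
  have hε₂ : 0 < ε₂ := hε₂
  -- With this radius any two positions of the orbit are closer than `ε₀`, so a return to the same
  -- point of the profile forces the same `u`, on tori too.
  set ε := min (ε₀ / 2) (min ε₁ ε₂) with hε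
  have hε0 : 0 < ε := lt_min (half_pos hε₀) (lt_min hε₁ hε₂)
  have hεε₁ : ε ≤ ε₁ := (min_le_right _ _).trans (min_le_left _ _)
  have hεε₂ : ε ≤ ε₂ := (min_le_right _ _).trans (min_le_right _ _)
  have hεε₀ : ε ≤ ε₀ / 2 := min_le_left _ _
  have hdist : ∀ s, 0 < s → |a - σ * s - a| = s := fun s hs => by
    rw [sub_sub_cancel_left, abs_neg, abs_mul, habs, one_mul, abs_of_pos hs]
  have hmem : ∀ s ∈ Ioo 0 ε, a - σ * s ∈ Metric.ball a ε₁ := fun s hs => by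
    rw [Metric.mem_ball, Real.dist_eq, hdist s hs.1]; exact hs.2.trans_le hεε₁
  obtain ⟨u, p, hu, hp, hua, huinj⟩ := exists_asymptotic_motion (W := W) (a := a) hm hσ hε0 hC
    (fun s hs => (hWa _ (hb _ (hmem s hs)).2).differentiableAt)
    (fun s hs => hlt' ⟨hs.1, hs.2.trans_le hεε₂⟩) (fun s hs => by
      have h1 : ‖W a - W (a - σ * s)‖ ≤ C * s * ‖a - (a - σ * s)‖ := by
        refine (convex_closedBall a s).norm_image_sub_le_of_norm_deriv_le (𝕜 := ℝ) (f := W)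
          (fun x hx => (hWa x (hb x ?_).2).differentiableAt) (fun x hx => ?_) ?_ ?_
        · rw [Metric.mem_closedBall] at hx
          exact Metric.mem_ball.2 (hx.trans_lt (hs.2.trans_le hεε₁))
        · rw [Metric.mem_closedBall] at hx
          have h2 := (hb x (Metric.mem_ball.2 (hx.trans_lt (hs.2.trans_le hεε₁)))).1
          rw [Real.dist_eq] at hx
          exact h2.trans (mul_le_mul_of_nonneg_left hx hC.le)
        · rw [Metric.mem_closedBall, Real.dist_eq, hdist s hs.1]
        · exact Metric.mem_closedBall_self hs.1.le
      have h2 : ‖a - (a - σ * s)‖ = s := by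
        rw [norm_sub_rev, Real.norm_eq_abs, hdist s hs.1]
      rw [h2] at h1
      calc W a - W (a - σ * s) ≤ _ := le_abs_self _
        _ ≤ _ := h1
        _ = _ := by ring)
  have hK : Metric.closedBall a (ε / 2) ⊆ S.chart := fun x hx =>
    (hb x (Metric.closedBall_subset_ball (by linarith) hx)).2
  have huK : ∀ t, 0 ≤ t → u t ∈ Metric.closedBall a (ε / 2) := fun t ht => by
    rw [Metric.mem_closedBall, Real.dist_eq]; exact hua t ht
  -- The angular momentum `√(m μ)` has centrifugal strength `μ`; this is where `μ ≥ 0` is needed.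
  have hLμ : √(m * μ) ^ 2 / m = μ := by
    rw [Real.sq_sqrt (by positivity)]; field_simp
  obtain ⟨φ, hφ⟩ := exists_angle hf hm (√(m * μ)) (fun t ht => hK (huK t ht))
    fun t ht => (hu t ht).continuousAt
  have horb := isNonsingularOrbit_of_effPot hf hV.central.analytic hm (√(m * μ))
    (fun t ht => hK (huK t ht)) hu (by rw [hLμ]; exact hp) hφ
  obtain ⟨T, hT, hper⟩ := hV.closed _ _ _ _ horb
    (S.isBoundedOrbit_of_compact (isCompact_closedBall _ _) hK hf.continuousOn huK)
  have h0 := hper 0 le_rfl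
  rw [zero_add] at h0
  have hT1 := huK T hT.le
  have hT0 := huK 0 le_rfl
  obtain ⟨h1, h2, -⟩ := S.profile_eq_of_point_eq (hK hT1) (hK hT0) h0
  have h3 : |u T - u 0| < ε₀ := by
    have e1 := hua T hT.le
    have e2 := hua 0 le_rfl
    have e3 := abs_sub_le (u T) a (u 0)
    rw [abs_sub_comm a] at e3
    linarith
  -- A closed orbit would return to its starting position, but this one never takes the same `u`
  -- twice.
  exact hT.ne' (huinj (hinj _ (hK hT1) _ (hK hT0) h3 h1 h2))

end SurfaceOfRevolution
end

/-! ### Critical points of the effective potential -/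

open Set
open scoped ContDiff
noncomputable section

open Filter Topology

theorem IsPreconnected.pos_or_neg_of_ne_zero {s : Set ℝ} (hs : IsPreconnected s) {g : ℝ → ℝ}
    (hg : ContinuousOn g s) (hne : ∀ x ∈ s, g x ≠ 0) :
    (∀ x ∈ s, 0 < g x) ∨ ∀ x ∈ s, g x < 0 := by
  by_contra h
  push Not at h
  obtain ⟨⟨x, hx, hx0⟩, y, hy, hy0⟩ := h
  obtain ⟨z, hz, hz0⟩ := hs.intermediate_value hx hy hg ⟨hx0, hy0⟩
  exact hne z hz hz0

namespace SurfaceOfRevolution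

variable {S : SurfaceOfRevolution}

/-- The effective potential is not constant. -/
def NonconstPot (S : SurfaceOfRevolution) (V : ℝ → ℝ) (μ : ℝ) : Prop :=
  ∃ u ∈ S.chart, ∃ v ∈ S.chart, S.effPot V μ u ≠ S.effPot V μ v

theorem NonconstPot.not_eventually_eq (hf : AnalyticOnNhd ℝ S.f S.chart) {V : ℝ → ℝ}
    (hV : AnalyticOnNhd ℝ V S.chart) {μ : ℝ} (hn : S.NonconstPot V μ) {a : ℝ}
    (ha : a ∈ S.chart) (c : ℝ) : ¬ ∀ᶠ u in 𝓝 a, S.effPot V μ u = c := by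
  intro h
  obtain ⟨u, hu, v, hv, huv⟩ := hn
  have := (analyticOnNhd_effPot hf hV μ).eqOn_of_preconnected_of_eventuallyEq
    (g := fun _ => c) (fun _ _ => analyticAt_const) S.isPreconnected_chart ha h
  exact huv ((this hu).trans (this hv).symm)

variable {m : ℝ} {V : ℝ → ℝ} {μ : ℝ} {a : ℝ}

/-- A nonconstant analytic function differs from its value at `a` in a punctured neighbourhood, so
the difference has a fixed sign on each side. The negative sign would produce an asymptotic orbit.
-/
theorem IsClosedOrbitPotential.eventually_gt_side (hf : AnalyticOnNhd ℝ S.f S.chart)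
    (hm : 0 < m) (hV : S.IsClosedOrbitPotential m V) (hμ : 0 ≤ μ) (hn : S.NonconstPot V μ)
    (ha : a ∈ S.chart) (hcrit : deriv (S.effPot V μ) a = 0) {σ : ℝ} (hσ : σ ^ 2 = 1) :
    ∀ᶠ s in 𝓝[>] (0 : ℝ), S.effPot V μ a < S.effPot V μ (a - σ * s) := by
  have hWa := analyticOnNhd_effPot hf hV.central.analytic μ
  have hσ0 : σ ≠ 0 := by rintro rfl; norm_num at hσ
  have hne : ∀ᶠ u in 𝓝[≠] a, S.effPot V μ u - S.effPot V μ a ≠ 0 := by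
    refine (((hWa a ha).sub analyticAt_const).eventually_eq_zero_or_eventually_ne_zero).resolve_left
      fun h => ?_
    exact hn.not_eventually_eq hf hV.central.analytic ha (S.effPot V μ a)
      (h.mono fun u hu => sub_eq_zero.1 hu)
  have ht : Tendsto (fun s : ℝ => a - σ * s) (𝓝[>] 0) (𝓝[≠] a) := by
    refine tendsto_nhdsWithin_iff.2 ⟨?_, ?_⟩
    · have : Tendsto (fun s : ℝ => a - σ * s) (𝓝 0) (𝓝 (a - σ * 0)) :=
        Continuous.tendsto (by fun_prop) 0
      rw [mul_zero, sub_zero] at this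
      exact this.mono_left nhdsWithin_le_nhds
    · filter_upwards [self_mem_nhdsWithin] with s hs
      have : (0 : ℝ) < s := hs
      simpa using ⟨hσ0, this.ne'⟩
  have hmem : ∀ᶠ u in 𝓝[≠] a, u ∈ S.chart := nhdsWithin_le_nhds (S.chart_mem_nhds ha)
  obtain ⟨ε, hε, hsub⟩ := mem_nhdsGT_iff_exists_Ioo_subset.1 (ht.eventually (hne.and hmem))
  have hc : ContinuousOn (fun s : ℝ => S.effPot V μ (a - σ * s) - S.effPot V μ a) (Ioo 0 ε) :=
    (hWa.continuousOn.comp (by fun_prop) fun s hs => (hsub hs).2).sub continuousOn_const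
  have hIoo : Ioo (0 : ℝ) ε ∈ 𝓝[>] (0 : ℝ) := Ioo_mem_nhdsGT hε
  rcases isPreconnected_Ioo.pos_or_neg_of_ne_zero hc fun s hs => (hsub hs).1 with h | h
  · filter_upwards [hIoo] with s hs
    linarith [h s hs]
  · refine absurd ?_ (hV.not_lt_near_critical hf hm hμ ha hcrit hσ)
    filter_upwards [hIoo] with s hs
    linarith [h s hs]

theorem IsClosedOrbitPotential.eventually_gt_right (hf : AnalyticOnNhd ℝ S.f S.chart)
    (hm : 0 < m) (hV : S.IsClosedOrbitPotential m V) (hμ : 0 ≤ μ) (hn : S.NonconstPot V μ)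
    (ha : a ∈ S.chart) (hcrit : deriv (S.effPot V μ) a = 0) :
    ∀ᶠ u in 𝓝[>] a, S.effPot V μ a < S.effPot V μ u := by
  have h := hV.eventually_gt_side hf hm hμ hn ha hcrit (σ := -1) (by norm_num)
  have ht : Tendsto (fun u => u - a) (𝓝[>] a) (𝓝[>] 0) := by
    refine tendsto_nhdsWithin_iff.2 ⟨?_, ?_⟩
    · have : Tendsto (fun u : ℝ => u - a) (𝓝 a) (𝓝 (a - a)) := Continuous.tendsto (by fun_prop) a
      rw [sub_self] at this
      exact this.mono_left nhdsWithin_le_nhds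
    · filter_upwards [self_mem_nhdsWithin] with u hu using sub_pos.2 (by simpa using hu)
  filter_upwards [ht.eventually h] with u hu
  simpa using hu

theorem IsClosedOrbitPotential.eventually_gt_left (hf : AnalyticOnNhd ℝ S.f S.chart)
    (hm : 0 < m) (hV : S.IsClosedOrbitPotential m V) (hμ : 0 ≤ μ) (hn : S.NonconstPot V μ)
    (ha : a ∈ S.chart) (hcrit : deriv (S.effPot V μ) a = 0) :
    ∀ᶠ u in 𝓝[<] a, S.effPot V μ a < S.effPot V μ u := by
  have h := hV.eventually_gt_side hf hm hμ hn ha hcrit (σ := 1) (by norm_num)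
  have ht : Tendsto (fun u => a - u) (𝓝[<] a) (𝓝[>] 0) := by
    refine tendsto_nhdsWithin_iff.2 ⟨?_, ?_⟩
    · have : Tendsto (fun u : ℝ => a - u) (𝓝 a) (𝓝 (a - a)) := Continuous.tendsto (by fun_prop) a
      rw [sub_self] at this
      exact this.mono_left nhdsWithin_le_nhds
    · filter_upwards [self_mem_nhdsWithin] with u hu using sub_pos.2 (by simpa using hu)
  filter_upwards [ht.eventually h] with u hu
  simpa using hu

theorem IsClosedOrbitPotential.not_isLocalMax (hf : AnalyticOnNhd ℝ S.f S.chart)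
    (hm : 0 < m) (hV : S.IsClosedOrbitPotential m V) (hμ : 0 ≤ μ) (hn : S.NonconstPot V μ)
    (ha : a ∈ S.chart) : ¬ IsLocalMax (S.effPot V μ) a := by
  intro h
  obtain ⟨u, hu, hu'⟩ := ((hV.eventually_gt_right hf hm hμ hn ha h.deriv_eq_zero).and
    (nhdsWithin_le_nhds h)).exists
  exact absurd hu (not_lt.2 hu')

/-- The effective potential has at most one critical point. -/
theorem IsClosedOrbitPotential.critical_unique (hf : AnalyticOnNhd ℝ S.f S.chart)
    (hm : 0 < m) (hV : S.IsClosedOrbitPotential m V) (hμ : 0 ≤ μ) (hn : S.NonconstPot V μ)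
    (ha : a ∈ S.chart) (hcrit : deriv (S.effPot V μ) a = 0) {b : ℝ} (hb : b ∈ S.chart)
    (hcrit' : deriv (S.effPot V μ) b = 0) : a = b := by
  wlog hab : a < b generalizing a b
  · rcases lt_trichotomy a b with h | h | h
    · exact absurd h hab
    · exact h
    · exact (this hb hcrit' ha hcrit h).symm
  exfalso
  have hsub : Icc a b ⊆ S.chart := S.ordConnected_chart.out ha hb
  have hWa := analyticOnNhd_effPot hf hV.central.analytic μ
  -- The maximum over `[a, b]` cannot sit at either end, as both are strict minima seen from inside;
  -- an interior local maximum is excluded as well.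
  obtain ⟨c, hc, hmax⟩ := isCompact_Icc.exists_isMaxOn (nonempty_Icc.2 hab.le)
    (hWa.continuousOn.mono hsub)
  have hca : c ≠ a := by
    rintro rfl
    obtain ⟨u, hu, hu'⟩ := ((hV.eventually_gt_right hf hm hμ hn ha hcrit).and
      (Ioo_mem_nhdsGT hab)).exists
    exact absurd hu (not_lt.2 (hmax (Ioo_subset_Icc_self hu')))
  have hcb : c ≠ b := by
    rintro rfl
    obtain ⟨u, hu, hu'⟩ := ((hV.eventually_gt_left hf hm hμ hn hb hcrit').and
      (Ioo_mem_nhdsLT hab)).exists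
    exact absurd hu (not_lt.2 (hmax (Ioo_subset_Icc_self hu')))
  exact hV.not_isLocalMax hf hm hμ hn (hsub hc) (hmax.isLocalMax
    (Icc_mem_nhds (lt_of_le_of_ne hc.1 hca.symm) (lt_of_le_of_ne hc.2 hcb)))

/-- By uniqueness of the critical point the derivative keeps its sign on `(a, u]`, and a negative
sign would contradict the strict minimum at `a`. -/
theorem IsClosedOrbitPotential.deriv_pos_right (hf : AnalyticOnNhd ℝ S.f S.chart)
    (hm : 0 < m) (hV : S.IsClosedOrbitPotential m V) (hμ : 0 ≤ μ) (hn : S.NonconstPot V μ)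
    (ha : a ∈ S.chart) (hcrit : deriv (S.effPot V μ) a = 0) {u : ℝ} (hu : u ∈ S.chart)
    (hau : a < u) : 0 < deriv (S.effPot V μ) u := by
  have hWa := analyticOnNhd_effPot hf hV.central.analytic μ
  have hsub : Icc a u ⊆ S.chart := S.ordConnected_chart.out ha hu
  rcases (isPreconnected_Ioc (a := a) (b := u)).pos_or_neg_of_ne_zero
    (hWa.deriv.continuousOn.mono (Ioc_subset_Icc_self.trans hsub)) (fun x hx h => hx.1.ne
      (hV.critical_unique hf hm hμ hn ha hcrit (hsub (Ioc_subset_Icc_self hx)) h)) with h | h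
  · exact h u ⟨hau, le_rfl⟩
  · have hanti : StrictAntiOn (S.effPot V μ) (Icc a u) := by
      refine strictAntiOn_of_deriv_neg (convex_Icc a u) (hWa.continuousOn.mono hsub) fun x hx => ?_
      rw [interior_Icc] at hx
      exact h x (Ioo_subset_Ioc_self hx)
    obtain ⟨v, hv, hv'⟩ := ((hV.eventually_gt_right hf hm hμ hn ha hcrit).and
      (Ioo_mem_nhdsGT hau)).exists
    exact absurd (hanti (left_mem_Icc.2 hau.le) (Ioo_subset_Icc_self hv') hv'.1) (not_lt.2 hv.le)

theorem IsClosedOrbitPotential.deriv_neg_left (hf : AnalyticOnNhd ℝ S.f S.chart)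
    (hm : 0 < m) (hV : S.IsClosedOrbitPotential m V) (hμ : 0 ≤ μ) (hn : S.NonconstPot V μ)
    (ha : a ∈ S.chart) (hcrit : deriv (S.effPot V μ) a = 0) {u : ℝ} (hu : u ∈ S.chart)
    (hua : u < a) : deriv (S.effPot V μ) u < 0 := by
  have hWa := analyticOnNhd_effPot hf hV.central.analytic μ
  have hsub : Icc u a ⊆ S.chart := S.ordConnected_chart.out hu ha
  rcases (isPreconnected_Ico (a := u) (b := a)).pos_or_neg_of_ne_zero
    (hWa.deriv.continuousOn.mono (Ico_subset_Icc_self.trans hsub)) (fun x hx h => hx.2.ne'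
      (hV.critical_unique hf hm hμ hn ha hcrit (hsub (Ico_subset_Icc_self hx)) h)) with h | h
  · have hmono : StrictMonoOn (S.effPot V μ) (Icc u a) := by
      refine strictMonoOn_of_deriv_pos (convex_Icc u a) (hWa.continuousOn.mono hsub) fun x hx => ?_
      rw [interior_Icc] at hx
      exact h x (Ioo_subset_Ico_self hx)
    obtain ⟨v, hv, hv'⟩ := ((hV.eventually_gt_left hf hm hμ hn ha hcrit).and
      (Ioo_mem_nhdsLT hua)).exists
    exact absurd (hmono (Ioo_subset_Icc_self hv') (right_mem_Icc.2 hua.le) hv'.2) (not_lt.2 hv.le)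
  · exact h u ⟨le_rfl, hua⟩

theorem effPot_zero : S.effPot V 0 = V := by
  funext u; simp [effPot]

/-- There are no closed orbit potentials on tori. -/
theorem IsClosedOrbitPotential.kind_ne_toroidal (hf : AnalyticOnNhd ℝ S.f S.chart)
    (hm : 0 < m) (hV : S.IsClosedOrbitPotential m V) : S.kind ≠ .toroidal := by
  intro hk
  have huniv := chart_eq_univ hk
  have hp := S.profile
  rw [hk] at hp
  obtain ⟨c, d, hcd, -, -, hfp, hgp, -⟩ := hp
  have hper : Function.Periodic V (d - c) := fun u =>
    hV.central.descends _ (huniv ▸ mem_univ _) _ (huniv ▸ mem_univ _) (hfp u) (hgp u)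
  have hVc : Continuous V := by
    have := hV.central.analytic.continuousOn
    rwa [huniv, continuousOn_univ] at this
  obtain ⟨a, -, ha⟩ := (isCompact_Icc (a := c) (b := c + (d - c))).exists_isMaxOn
    (nonempty_Icc.2 (by linarith)) hVc.continuousOn
  have hmax : ∀ u, V u ≤ V a := fun u => by
    obtain ⟨v, hv, huv⟩ := hper.exists_mem_Ico (sub_pos.2 hcd) u c
    rw [huv]
    exact ha (Ico_subset_Icc_self hv)
  -- Radial motion suffices: a periodic `V` attains its maximum.
  refine hV.not_isLocalMax (μ := 0) (a := a) hf hm le_rfl ?_ (huniv ▸ mem_univ _) ?_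
  · simpa only [NonconstPot, effPot_zero] using hV.nonconstant
  · rw [effPot_zero]
    exact Eventually.of_forall hmax

/-- A non-circular bounded orbit oscillates, so that some effective potential has a critical
point. -/
theorem IsClosedOrbitPotential.exists_critical (hf : AnalyticOnNhd ℝ S.f S.chart)
    (hm : 0 < m) (hV : S.IsClosedOrbitPotential m V) :
    ∃ μ, 0 ≤ μ ∧ S.NonconstPot V μ ∧ ∃ a ∈ S.chart, deriv (S.effPot V μ) a = 0 := by
  have hk := hV.kind_ne_toroidal hf hm
  obtain ⟨u, φ, pu, pφ, horb, hb, hnc⟩ := hV.exists_noncircular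
  obtain ⟨T, hT, hper⟩ := hV.closed _ _ _ _ horb hb
  have huT : ∀ t, 0 ≤ t → u (t + T) = u t := fun t ht => by
    obtain ⟨h1, h2, -⟩ := S.profile_eq_of_point_eq (horb.mem _ (by linarith)) (horb.mem t ht)
      (hper t ht)
    exact eq_of_profile_eq hk (horb.mem _ (by linarith)) (horb.mem t ht) h1 h2
  set μ := pφ 0 ^ 2 / m with hμ
  set W := S.effPot V μ with hW
  have hμ0 : 0 ≤ μ := by positivity
  have hpu : ∀ t, 0 ≤ t → HasDerivWithinAt pu (-deriv W (u t)) (Ici 0) t := fun t ht => by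
    have := horb.pu_dot t ht
    rwa [horb.pφ_eq ht, force_eq hf hV.central.analytic hm _ (horb.mem t ht)] at this
  have hdu : ∀ t, 0 < t → HasDerivAt u (pu t / m) t := fun t ht =>
    (horb.u_dot t ht.le).hasDerivAt (Ici_mem_nhds ht)
  have huc : ContinuousOn u (Ici 0) := fun t ht => (horb.u_dot t ht).continuousWithinAt
  -- The second period is used instead of the first so that the extremal times lie in the open
  -- half-line, where the one-sided derivatives are two-sided.
  have huc1 : ContinuousOn u (Icc T (2 * T)) := huc.mono fun t ht => hT.le.trans ht.1
  -- extremal positions on one period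
  have hred : ∀ t, 0 ≤ t → ∃ s ∈ Icc T (2 * T), u t = u s := fun t ht => by
    have hn : ∀ n : ℕ, ∀ s, 0 ≤ s → u (s + n * T) = u s := by
      intro n
      induction n with
      | zero => intro s _; simp
      | succ n ih =>
        intro s hs
        have : s + ((n + 1 : ℕ) : ℝ) * T = (s + n * T) + T := by push_cast; ring
        rw [this, huT _ (by positivity), ih s hs]
    have h1 := Nat.floor_le (div_nonneg ht hT.le)
    have h2 := Nat.lt_floor_add_one (t / T)
    rw [le_div_iff₀ hT] at h1
    rw [div_lt_iff₀ hT] at h2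
    refine ⟨t - ⌊t / T⌋₊ * T + T, ⟨by linarith, by linarith⟩, ?_⟩
    rw [huT _ (by linarith)]
    have := hn ⌊t / T⌋₊ (t - ⌊t / T⌋₊ * T) (by linarith)
    rw [← this]; congr 1; ring
  have hne : (Icc T (2 * T)).Nonempty := nonempty_Icc.2 (by linarith)
  obtain ⟨t₁, ht₁, hmin⟩ := isCompact_Icc.exists_isMinOn hne huc1
  obtain ⟨t₂, ht₂, hmax⟩ := isCompact_Icc.exists_isMaxOn hne huc1
  have hmin' : ∀ t, 0 ≤ t → u t₁ ≤ u t := fun t ht => by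
    obtain ⟨s, hs, hts⟩ := hred t ht
    rw [hts]; exact hmin hs
  have hmax' : ∀ t, 0 ≤ t → u t ≤ u t₂ := fun t ht => by
    obtain ⟨s, hs, hts⟩ := hred t ht
    rw [hts]; exact hmax hs
  have h1pos : 0 < t₁ := hT.trans_le ht₁.1
  have h2pos : 0 < t₂ := hT.trans_le ht₂.1
  have hp1 : pu t₁ = 0 := by
    have : IsLocalMin u t₁ := by
      filter_upwards [lt_mem_nhds h1pos] with t ht using hmin' t ht.le
    have := this.hasDerivAt_eq_zero (hdu t₁ h1pos)
    simpa [hm.ne'] using this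
  have hp2 : pu t₂ = 0 := by
    have : IsLocalMax u t₂ := by
      filter_upwards [lt_mem_nhds h2pos] with t ht using hmax' t ht.le
    have := this.hasDerivAt_eq_zero (hdu t₂ h2pos)
    simpa [hm.ne'] using this
  have hlt : u t₁ < u t₂ := by
    refine lt_of_le_of_ne (hmin' t₂ h2pos.le) fun h => hnc ⟨u t₁, fun t ht => ?_⟩
    exact le_antisymm (h ▸ hmax' t ht) (hmin' t ht)
  have hWd : ∀ t, 0 ≤ t → HasDerivAt W (deriv W (u t)) (u t) := fun t ht =>
    hasDerivAt_effPot hf hV.central.analytic μ (horb.mem t ht)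
  -- energy conservation
  have hen : ∀ t, 0 ≤ t → pu t ^ 2 / (2 * m) + W (u t) = pu 0 ^ 2 / (2 * m) + W (u 0) := by
    intro t ht
    have hd : ∀ s, 0 ≤ s → HasDerivWithinAt (fun s => pu s ^ 2 / (2 * m) + W (u s)) 0 (Ici 0) s := by
      intro s hs
      have h1 := (((hpu s hs).fun_pow 2).div_const (2 * m)).fun_add
        ((hWd s hs).comp_hasDerivWithinAt s (horb.u_dot s hs))
      refine h1.congr_deriv ?_
      field_simp
      push_cast
      ring
    exact constant_of_has_deriv_right_zero (a := 0) (b := t)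
      (fun s hs => ((hd s hs.1).continuousWithinAt).mono Icc_subset_Ici_self)
      (fun s hs => (hd s hs.1).mono (Ici_subset_Ici.2 hs.1)) t ⟨ht, le_rfl⟩
  have hWeq : W (u t₁) = W (u t₂) := by
    have e1 := hen t₁ h1pos.le
    have e2 := hen t₂ h2pos.le
    rw [hp1] at e1; rw [hp2] at e2
    linarith
  have hsub : Icc (u t₁) (u t₂) ⊆ S.chart :=
    S.ordConnected_chart.out (horb.mem _ h1pos.le) (horb.mem _ h2pos.le)
  -- Both extremes of `u` have zero momentum, hence equal potential energy, and Rolle's theorem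
  -- applies between them.
  obtain ⟨a, ha, hcrit⟩ := exists_deriv_eq_zero hlt
    ((analyticOnNhd_effPot hf hV.central.analytic μ).continuousOn.mono hsub) hWeq
  refine ⟨μ, hμ0, ?_, a, hsub (Ioo_subset_Icc_self ha), hcrit⟩
  -- a constant effective potential does not allow oscillations
  by_contra hconst
  simp only [NonconstPot] at hconst
  push Not at hconst
  have hd0 : ∀ v ∈ S.chart, deriv W v = 0 := fun v hv => by
    have : W =ᶠ[𝓝 v] fun _ => W v := by
      filter_upwards [S.chart_mem_nhds hv] with w hw using hconst w hw v hv
    rw [this.deriv_eq, deriv_const]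
  have hpu0 : ∀ t, 0 ≤ t → pu t = pu 0 := fun t ht => by
    refine constant_of_has_deriv_right_zero (a := 0) (b := t)
      (fun s hs => ((hpu s hs.1).continuousWithinAt).mono Icc_subset_Ici_self)
      (fun s hs => ?_) t ⟨ht, le_rfl⟩
    have := (hpu s hs.1).mono (Ici_subset_Ici.2 hs.1)
    rwa [hd0 _ (horb.mem s hs.1), neg_zero] at this
  refine hnc ⟨u 0, fun t ht => ?_⟩
  refine constant_of_has_deriv_right_zero (a := 0) (b := t)
    (fun s hs => huc.mono Icc_subset_Ici_self s hs) (fun s hs => ?_) t ⟨ht, le_rfl⟩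
  have := (horb.u_dot s hs.1).mono (Ici_subset_Ici.2 hs.1)
  rwa [hpu0 s hs.1, ← hpu0 t₁ h1pos.le, hp1, zero_div] at this

end SurfaceOfRevolution
end

/-! ### Wells and oscillations in them -/

open Set
open scoped ContDiff
noncomputable section

open Filter Topology

/-- The divided difference of an analytic function is jointly continuous. -/
theorem AnalyticAt.continuousAt_dslope_prod {g : ℝ → ℝ} {a b : ℝ} (ha : AnalyticAt ℝ g a)
    (hb : AnalyticAt ℝ g b) : ContinuousAt (fun x : ℝ × ℝ => dslope g x.1 x.2) (a, b) := by
  rcases eq_or_ne a b with rfl | hab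
  · have hs : HasStrictDerivAt g (deriv g a) a := ha.hasStrictDerivAt
    have hd : ContinuousAt (fun x : ℝ × ℝ => deriv g x.1) (a, a) :=
      ContinuousAt.comp (f := Prod.fst) (g := deriv g) ha.deriv.continuousAt continuousAt_fst
    -- Strict differentiability controls quotients for pairs near the diagonal neither of whose
    -- entries is `a`.
    have hl := hs.isLittleO
    rw [Metric.continuousAt_iff'] at hd ⊢
    intro ε hε
    filter_upwards [hd ε hε, hl.def (half_pos hε)] with x hx1 hx2
    simp only [dslope_same]
    rcases eq_or_ne x.2 x.1 with h | h
    · rw [h, dslope_same]; exact hx1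
    · rw [dslope_of_ne _ h, slope_def_field, Real.dist_eq]
      have h0 : 0 < |x.2 - x.1| := abs_pos.2 (sub_ne_zero.2 h)
      have e : (g x.2 - g x.1) / (x.2 - x.1) - deriv g a =
          (g x.1 - g x.2 - deriv g a * (x.1 - x.2)) / (x.1 - x.2) := by
        have := sub_ne_zero.2 h
        have h' : x.1 - x.2 ≠ 0 := sub_ne_zero.2 h.symm
        field_simp
        ring
      have hx3 : |g x.1 - g x.2 - deriv g a * (x.1 - x.2)| ≤ ε / 2 * |x.1 - x.2| := by
        simpa [Real.norm_eq_abs, mul_comm] using hx2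
      rw [e, abs_div, div_lt_iff₀ (by rwa [abs_sub_comm])]
      rw [abs_sub_comm] at h0
      nlinarith
  · have hne : ∀ᶠ x : ℝ × ℝ in 𝓝 (a, b), x.2 ≠ x.1 :=
      (isOpen_ne_fun continuous_snd continuous_fst).mem_nhds hab.symm
    have hc : ContinuousAt (fun x : ℝ × ℝ => (g x.2 - g x.1) / (x.2 - x.1)) (a, b) := by
      have h1 : ContinuousAt (fun x : ℝ × ℝ => g x.1) (a, b) :=
        ContinuousAt.comp (f := Prod.fst) (g := g) ha.continuousAt continuousAt_fst
      have h2 : ContinuousAt (fun x : ℝ × ℝ => g x.2) (a, b) :=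
        ContinuousAt.comp (f := Prod.snd) (g := g) hb.continuousAt continuousAt_snd
      exact (h2.sub h1).div (by fun_prop) (sub_ne_zero.2 hab.symm)
    refine hc.congr ?_
    filter_upwards [hne] with x hx
    rw [dslope_of_ne _ hx, slope_def_field]

/-- A well of the potential `W` between the turning points `p` and `q`. -/
structure IsWell (W : ℝ → ℝ) (p q : ℝ) : Prop where
  lt : p < q
  eq : W p = W q
  below : ∀ u ∈ Ioo p q, W u < W q
  deriv_left : deriv W p < 0
  deriv_right : 0 < deriv W q

/-- The divided difference `(W q - W u) / ((u - p) (q - u))` when `W p = W q`. -/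
def wellD (W : ℝ → ℝ) (p q u : ℝ) : ℝ := (dslope W u q - dslope W p u) / (q - p)

/-- A parametrization of `[p, q]` that is quadratic at the ends. -/
def wellPoint (p q x : ℝ) : ℝ := (p + q) / 2 - (q - p) / 2 * Real.cos x

theorem continuous_wellPoint (p q : ℝ) : Continuous (wellPoint p q) := by
  unfold wellPoint; fun_prop

theorem hasDerivAt_wellPoint (p q x : ℝ) :
    HasDerivAt (wellPoint p q) ((q - p) / 2 * Real.sin x) x := by
  refine (((Real.hasDerivAt_cos x).const_mul ((q - p) / 2)).const_sub ((p + q) / 2)).congr_deriv ?_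
  ring

theorem wellPoint_mem_Icc {p q : ℝ} (h : p ≤ q) (x : ℝ) : wellPoint p q x ∈ Icc p q := by
  have h1 := Real.neg_one_le_cos x
  have h2 := Real.cos_le_one x
  unfold wellPoint
  constructor <;> nlinarith

theorem wellPoint_mem_Ioo {p q : ℝ} (h : p < q) {x : ℝ} (hx : Real.sin x ≠ 0) :
    wellPoint p q x ∈ Ioo p q := by
  have h0 : 0 < Real.sin x ^ 2 := by positivity
  have h3 := Real.sin_sq_add_cos_sq x
  have h1 : -1 < Real.cos x := by nlinarith [Real.neg_one_le_cos x]
  have h2 : Real.cos x < 1 := by nlinarith [Real.cos_le_one x]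
  unfold wellPoint
  constructor <;> nlinarith

theorem wellPoint_zero (p q : ℝ) : wellPoint p q 0 = p := by
  simp [wellPoint]; ring

theorem wellPoint_pi (p q : ℝ) : wellPoint p q Real.pi = q := by
  simp [wellPoint]; ring

theorem wellPoint_mul (p q x : ℝ) :
    (wellPoint p q x - p) * (q - wellPoint p q x) = ((q - p) / 2 * Real.sin x) ^ 2 := by
  unfold wellPoint
  linear_combination (-(q - p) ^ 2 / 4) * Real.sin_sq_add_cos_sq x

theorem wellPoint_eq_left {p q x : ℝ} (h : p < q) : wellPoint p q x = p ↔ Real.cos x = 1 := by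
  unfold wellPoint
  constructor
  · intro hx
    have : (q - p) * (1 - Real.cos x) = 0 := by linarith
    rcases mul_eq_zero.1 this with h' | h' <;> linarith
  · intro hx; rw [hx]; ring

namespace IsWell

variable {W : ℝ → ℝ} {p q : ℝ}

/-- Partial fractions: `(q - p) / ((u - p) (q - u)) = 1 / (u - p) + 1 / (q - u)`. Writing the
quotient with divided differences makes it continuous up to the turning points, where energy minus
potential vanishes to first order. -/
theorem mul_wellD (h : IsWell W p q) {u : ℝ} (hu : u ∈ Icc p q) :
    (u - p) * (q - u) * wellD W p q u = W q - W u := by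
  have hpq := sub_pos.2 h.lt
  rcases hu.1.eq_or_lt with rfl | h1
  · simp [h.eq]
  rcases hu.2.eq_or_lt with rfl | h2
  · simp
  rw [wellD, dslope_of_ne _ h2.ne', dslope_of_ne _ h1.ne', slope_def_field, slope_def_field, h.eq]
  have e1 := (sub_pos.2 h1).ne'
  have e2 := (sub_pos.2 h2).ne'
  field_simp
  ring

/-- In the interior this is the depth of the well. At a turning point `W p = W q` kills one divided
difference, and the other is the nonzero slope there. -/
theorem wellD_pos (h : IsWell W p q) {u : ℝ} (hu : u ∈ Icc p q) : 0 < wellD W p q u := by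
  have hpq := sub_pos.2 h.lt
  rcases hu.1.eq_or_lt with rfl | h1
  · rw [wellD, dslope_same, dslope_of_ne _ h.lt.ne', slope_def_field, h.eq, sub_self, zero_div,
      zero_sub]
    exact div_pos (neg_pos.2 h.deriv_left) hpq
  rcases hu.2.eq_or_lt with rfl | h2
  · rw [wellD, dslope_same, dslope_of_ne _ h.lt.ne', slope_def_field, h.eq, sub_self, zero_div,
      sub_zero]
    exact div_pos h.deriv_right hpq
  · have h3 := h.mul_wellD hu
    have h4 := h.below u ⟨h1, h2⟩
    have h5 := mul_pos (sub_pos.2 h1) (sub_pos.2 h2)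
    by_contra hneg
    push Not at hneg
    nlinarith

theorem continuousOn_wellD (h : IsWell W p q) (hW : ∀ u ∈ Icc p q, AnalyticAt ℝ W u) :
    ContinuousOn (wellD W p q) (Icc p q) := by
  intro u hu
  have hp : p ∈ Icc p q := left_mem_Icc.2 h.lt.le
  have hq : q ∈ Icc p q := right_mem_Icc.2 h.lt.le
  have h1 : ContinuousAt (fun v => dslope W v q) u :=
    ContinuousAt.comp (f := fun v => (v, q)) ((hW u hu).continuousAt_dslope_prod (hW q hq))
      (by fun_prop)
  have h2 : ContinuousAt (fun v => dslope W p v) u :=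
    ContinuousAt.comp (f := fun v => (p, v)) ((hW p hp).continuousAt_dslope_prod (hW u hu))
      (by fun_prop)
  exact ((h1.sub h2).div_const _).continuousWithinAt

theorem continuous_wellD_wellPoint (h : IsWell W p q) (hW : ∀ u ∈ Icc p q, AnalyticAt ℝ W u) :
    Continuous fun x => wellD W p q (wellPoint p q x) :=
  (h.continuousOn_wellD hW).comp_continuous (continuous_wellPoint p q)
    (wellPoint_mem_Icc h.lt.le)

theorem wellD_wellPoint (h : IsWell W p q) (x : ℝ) :
    ((q - p) / 2 * Real.sin x) ^ 2 * wellD W p q (wellPoint p q x)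
      = W q - W (wellPoint p q x) := by
  rw [← wellPoint_mul, h.mul_wellD (wellPoint_mem_Icc h.lt.le x)]

end IsWell

/-- Where one factor vanishes, the difference quotient of a product factors, so the other factor
need only be continuous. This gives the derivative of the momentum at a turning point, where `wellD`
is only known to be continuous. -/
theorem HasDerivAt.mul_of_eq_zero {s k : ℝ → ℝ} {s' t : ℝ} (hs : HasDerivAt s s' t) (h0 : s t = 0)
    (hk : ContinuousAt k t) : HasDerivAt (fun x => s x * k x) (s' * k t) t := by
  rw [hasDerivAt_iff_tendsto_slope] at hs ⊢
  refine (hs.mul (hk.tendsto.mono_left nhdsWithin_le_nhds)).congr fun x => ?_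
  simp only [slope_def_field, h0, sub_zero, zero_mul]
  ring

/-- Oscillations in a well. -/
theorem IsWell.exists_oscillation {W : ℝ → ℝ} {p q m : ℝ} (hm : 0 < m) (h : IsWell W p q)
    (hW : ∀ u ∈ Icc p q, AnalyticAt ℝ W u) :
    ∃ θ P : ℝ → ℝ, θ 0 = 0 ∧ StrictMono θ ∧ Function.Surjective θ ∧
      (∀ t, HasDerivAt θ (√(2 / m) * √(wellD W p q (wellPoint p q (θ t)))) t) ∧
      (∀ t, HasDerivAt (fun t => wellPoint p q (θ t)) (P t / m) t) ∧
      (∀ t, HasDerivAt P (-deriv W (wellPoint p q (θ t))) t) := by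
  set D : ℝ → ℝ := fun x => wellD W p q (wellPoint p q x) with hD
  have hDc : Continuous D := h.continuous_wellD_wellPoint hW
  have hD0 : ∀ x, 0 < D x := fun x => h.wellD_pos (wellPoint_mem_Icc h.lt.le x)
  obtain ⟨M, hM⟩ := isCompact_Icc.exists_bound_of_continuousOn (h.continuousOn_wellD hW)
  have hDM : ∀ x, D x ≤ M := fun x =>
    (le_abs_self _).trans (hM _ (wellPoint_mem_Icc h.lt.le x))
  have hM0 : 0 < M := (hD0 0).trans_le (hDM 0)
  have h2m : 0 < √(2 / m) := Real.sqrt_pos.2 (by positivity)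
  have hsD : ∀ x, 0 < √(D x) := fun x => Real.sqrt_pos.2 (hD0 x)
  have hκc : Continuous fun x => (√(2 / m) * √(D x))⁻¹ :=
    (continuous_const.mul hDc.sqrt).inv₀ fun x => (mul_pos h2m (hsD x)).ne'
  obtain ⟨θ, hθ0, hθm, hθs, hθd⟩ := exists_time_change hκc
    (δ := (√(2 / m) * √M)⁻¹) (inv_pos.2 (mul_pos h2m (Real.sqrt_pos.2 hM0))) fun x =>
      inv_anti₀ (mul_pos h2m (hsD x))
        (mul_le_mul_of_nonneg_left (Real.sqrt_le_sqrt (hDM x)) h2m.le)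
  simp only [inv_inv] at hθd
  have hmm : √(2 * m) = m * √(2 / m) := by
    rw [← Real.sqrt_sq hm.le, ← Real.sqrt_mul (by positivity), Real.sqrt_sq hm.le]
    congr 1; field_simp
  have hsq : √(2 / m) ^ 2 = 2 / m := Real.sq_sqrt (by positivity)
  set r := (q - p) / 2 with hr
  have hr0 : 0 < r := by have := h.lt; rw [hr]; linarith
  -- The momentum `m u'`. The sine carries its sign, which avoids choosing a branch of the root of
  -- `2 m (W q - W)` at each turning point.
  set P : ℝ → ℝ := fun t => (r * Real.sin (θ t)) * (√(2 * m) * √(D (θ t))) with hP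
  have hu : ∀ t, HasDerivAt (fun t => wellPoint p q (θ t)) (P t / m) t := fun t => by
    refine ((hasDerivAt_wellPoint p q (θ t)).comp t (hθd t)).congr_deriv ?_
    rw [hP]
    dsimp only
    rw [hmm, hr]
    field_simp
  have hWu : ∀ t, HasDerivAt (fun t => W (wellPoint p q (θ t)))
      (deriv W (wellPoint p q (θ t)) * (P t / m)) t := fun t =>
    HasDerivAt.comp (h := fun t => wellPoint p q (θ t)) t
      (hW _ (wellPoint_mem_Icc h.lt.le _)).differentiableAt.hasDerivAt (hu t)
  refine ⟨θ, P, hθ0, hθm, hθs, hθd, hu, fun t => ?_⟩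
  have hθc : ContinuousAt θ t := (hθd t).continuousAt
  by_cases hsin : Real.sin (θ t) = 0
  · -- at a turning point
    have h1 : HasDerivAt (fun t => r * Real.sin (θ t)) _ t := ((hθd t).sin).const_mul r
    have h2 : ContinuousAt (fun t => √(2 * m) * √(D (θ t))) t :=
      continuousAt_const.mul (ContinuousAt.comp (f := θ) (g := fun x => √(D x))
        hDc.sqrt.continuousAt hθc)
    refine (h1.mul_of_eq_zero (by simp [hsin]) h2).congr_deriv ?_
    have e1 : √(D (θ t)) ^ 2 = D (θ t) := Real.sq_sqrt (hD0 _).le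
    have e2 : r * (Real.cos (θ t) * (√(2 / m) * √(D (θ t)))) * (√(2 * m) * √(D (θ t)))
        = 2 * r * Real.cos (θ t) * D (θ t) := by
      rw [hmm]
      calc _ = r * Real.cos (θ t) * m * √(2 / m) ^ 2 * √(D (θ t)) ^ 2 := by ring
        _ = _ := by rw [hsq, e1]; field_simp
    rw [e2]
    have hc2 : Real.cos (θ t) ^ 2 = 1 := by
      have := Real.sin_sq_add_cos_sq (θ t); rw [hsin] at this; linarith
    have hpq := h.lt
    have hpq' := (sub_pos.2 h.lt).ne'
    rcases (sq_eq_sq_iff_eq_or_eq_neg.1 (hc2.trans (one_pow 2).symm)) with hc | hc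
    · have hw : wellPoint p q (θ t) = p := by rw [wellPoint, hc]; ring
      simp only [hD, hw, hc]
      rw [wellD, dslope_same, dslope_of_ne _ h.lt.ne', slope_def_field, h.eq, sub_self, zero_div]
      rw [hr]; field_simp; ring
    · have hw : wellPoint p q (θ t) = q := by rw [wellPoint, hc]; ring
      simp only [hD, hw, hc]
      rw [wellD, dslope_same, dslope_of_ne _ h.lt.ne', slope_def_field, h.eq, sub_self, zero_div]
      rw [hr]; field_simp; ring
  · -- away from the turning points
    have hmem : ∀ᶠ s in 𝓝 t, Real.sin (θ s) ≠ 0 :=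
      (Real.continuous_sin.continuousAt.comp hθc).eventually_ne hsin
    have hPsq : ∀ s, P s ^ 2 = 2 * m * (W q - W (wellPoint p q (θ s))) := fun s => by
      rw [← h.wellD_wellPoint]
      calc P s ^ 2 = (r * Real.sin (θ s)) ^ 2 * (√(2 * m) ^ 2 * √(D (θ s)) ^ 2) := by
            rw [hP]; ring
        _ = _ := by rw [Real.sq_sqrt (by positivity), Real.sq_sqrt (hD0 _).le]; ring
    have hPt : P t ≠ 0 := mul_ne_zero (mul_ne_zero hr0.ne' hsin)
      (mul_pos (Real.sqrt_pos.2 (by positivity)) (hsD _)).ne'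
    have hPd : DifferentiableAt ℝ P t := by
      -- Near `t` the momentum is a fixed sign times the root of its square, and by energy
      -- conservation that square is a differentiable function of time.
      have hsg : ∀ᶠ s in 𝓝 t, P s = (P t / |P t|) * √(P s ^ 2) := by
        have hPc : ContinuousAt P t :=
          (continuousAt_const.mul (Real.continuous_sin.continuousAt.comp hθc)).mul
            (continuousAt_const.mul (ContinuousAt.comp (f := θ) (g := fun x => √(D x))
              hDc.sqrt.continuousAt hθc))
        rcases lt_or_gt_of_ne hPt with hneg | hpos
        · filter_upwards [hPc.eventually_lt_const hneg] with s hs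
          rw [Real.sqrt_sq_eq_abs, abs_of_neg hneg, abs_of_neg hs, div_neg, div_self hPt]; ring
        · filter_upwards [hPc.eventually_const_lt hpos] with s hs
          rw [Real.sqrt_sq_eq_abs, abs_of_pos hpos, abs_of_pos hs, div_self hPt]; ring
      have h1 : DifferentiableAt ℝ (fun s => P s ^ 2) t := by
        have : (fun s => P s ^ 2) = fun s => 2 * m * (W q - W (wellPoint p q (θ s))) :=
          funext hPsq
        rw [this]
        exact ((hWu t).differentiableAt.const_sub _).const_mul _
      exact ((h1.sqrt (pow_ne_zero 2 hPt)).const_mul _).congr_of_eventuallyEq hsg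
    have h1 := hPd.hasDerivAt.fun_pow 2
    have h2 : HasDerivAt (fun s => P s ^ 2) (2 * m * (-(deriv W (wellPoint p q (θ t)) * (P t / m)))) t := by
      have : (fun s => P s ^ 2) = fun s => 2 * m * (W q - W (wellPoint p q (θ s))) :=
        funext hPsq
      rw [this]
      exact ((hWu t).const_sub _).const_mul _
    have h3 := h1.unique h2
    have h4 : deriv P t = -deriv W (wellPoint p q (θ t)) := by
      have : 2 * P t * (deriv P t + deriv W (wellPoint p q (θ t))) = 0 := by
        field_simp at h3
        push_cast at h3
        simp at h3
        linarith
      rcases mul_eq_zero.1 this with h' | h'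
      · exact absurd h' (mul_ne_zero two_ne_zero hPt)
      · linarith
    rw [← h4]
    exact hPd.hasDerivAt
end

/-! ### The angle of an oscillation is rational -/

open Set
open scoped ContDiff
noncomputable section

open Filter Topology

namespace SurfaceOfRevolution

variable {S : SurfaceOfRevolution} {m : ℝ} {V : ℝ → ℝ} {μ : ℝ} {p q : ℝ}

/-- The increase of `φ` during one oscillation in a well, up to a constant factor. -/
def wellAngle (S : SurfaceOfRevolution) (W : ℝ → ℝ) (p q : ℝ) : ℝ :=
  ∫ x in (0 : ℝ)..2 * Real.pi,
    1 / (S.f (wellPoint p q x) ^ 2 * √(wellD W p q (wellPoint p q x)))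

theorem continuous_wellAngle_integrand (hf : AnalyticOnNhd ℝ S.f S.chart) {W : ℝ → ℝ}
    (hW : AnalyticOnNhd ℝ W S.chart) (hp : p ∈ S.chart) (hq : q ∈ S.chart) (h : IsWell W p q) :
    Continuous fun x =>
      1 / (S.f (wellPoint p q x) ^ 2 * √(wellD W p q (wellPoint p q x))) := by
  have hsub : Icc p q ⊆ S.chart := S.ordConnected_chart.out hp hq
  have h1 : Continuous fun x => S.f (wellPoint p q x) :=
    (hf.continuousOn.mono hsub).comp_continuous (continuous_wellPoint p q)
      (wellPoint_mem_Icc h.lt.le)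
  have h2 := h.continuous_wellD_wellPoint fun u hu => hW u (hsub hu)
  exact continuous_const.div ((h1.pow 2).mul h2.sqrt) fun x =>
    (mul_pos (pow_pos (S.f_pos_of_mem_chart (hsub (wellPoint_mem_Icc h.lt.le x))) 2)
      (Real.sqrt_pos.2 (h.wellD_pos (wellPoint_mem_Icc h.lt.le x)))).ne'

theorem wellAngle_pos (hf : AnalyticOnNhd ℝ S.f S.chart) {W : ℝ → ℝ}
    (hW : AnalyticOnNhd ℝ W S.chart) (hp : p ∈ S.chart) (hq : q ∈ S.chart) (h : IsWell W p q) :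
    0 < S.wellAngle W p q := by
  have hsub : Icc p q ⊆ S.chart := S.ordConnected_chart.out hp hq
  refine intervalIntegral.intervalIntegral_pos_of_pos
    ((continuous_wellAngle_integrand hf hW hp hq h).intervalIntegrable _ _) (fun x => ?_)
    (by positivity)
  have h1 := S.f_pos_of_mem_chart (hsub (wellPoint_mem_Icc h.lt.le x))
  have h2 := Real.sqrt_pos.2 (h.wellD_pos (wellPoint_mem_Icc h.lt.le x))
  positivity

/-- The orbit in a well, and its angle after a time in which `u` returns to the start. -/
theorem exists_orbit_of_isWell (hf : AnalyticOnNhd ℝ S.f S.chart)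
    (hV : AnalyticOnNhd ℝ V S.chart) (hm : 0 < m) (L : ℝ) (hp : p ∈ S.chart) (hq : q ∈ S.chart)
    (h : IsWell (S.effPot V (L ^ 2 / m)) p q) :
    ∃ u φ pu : ℝ → ℝ, S.IsNonsingularOrbit m V u φ pu (fun _ => L) ∧ S.IsBoundedOrbit u φ ∧
      ¬ IsCircularOrbit u ∧ ∀ T, 0 < T → u T = u 0 → ∃ n : ℕ, 0 < n ∧
        φ T = φ 0 + n * (L / √(2 * m) * S.wellAngle (S.effPot V (L ^ 2 / m)) p q) := by
  set W := S.effPot V (L ^ 2 / m) with hW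
  have hWa : AnalyticOnNhd ℝ W S.chart := analyticOnNhd_effPot hf hV _
  have hsub : Icc p q ⊆ S.chart := S.ordConnected_chart.out hp hq
  obtain ⟨θ, P, hθ0, hθm, hθs, hθd, hu, hP⟩ :=
    h.exists_oscillation hm fun u hu => hWa u (hsub hu)
  set I : ℝ → ℝ := fun x =>
    1 / (S.f (wellPoint p q x) ^ 2 * √(wellD W p q (wellPoint p q x))) with hI
  have hIc : Continuous I := continuous_wellAngle_integrand hf hWa hp hq h
  have hIper : Function.Periodic I (2 * Real.pi) := fun x => by
    simp only [hI, wellPoint, Real.cos_add_two_pi]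
  have hmem : ∀ t, 0 ≤ t → wellPoint p q (θ t) ∈ S.chart := fun t _ =>
    hsub (wellPoint_mem_Icc h.lt.le _)
  have hmm : √(2 * m) = m * √(2 / m) := by
    rw [← Real.sqrt_sq hm.le, ← Real.sqrt_mul (by positivity), Real.sqrt_sq hm.le]
    congr 1; field_simp
  set φ : ℝ → ℝ := fun t => L / √(2 * m) * ∫ x in (0 : ℝ)..θ t, I x with hφ
  have hφd : ∀ t, 0 ≤ t → HasDerivAt φ (L / (m * S.f (wellPoint p q (θ t)) ^ 2)) t := by
    intro t ht
    have h1 : HasDerivAt (fun s => ∫ x in (0 : ℝ)..s, I x) (I (θ t)) (θ t) :=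
      intervalIntegral.integral_hasDerivAt_right (hIc.intervalIntegrable _ _)
        (hIc.stronglyMeasurableAtFilter _ _) hIc.continuousAt
    refine ((HasDerivAt.comp (h := θ) t h1 (hθd t)).const_mul _).congr_deriv ?_
    have e1 := S.f_pos_of_mem_chart (hmem t ht)
    have e2 := Real.sqrt_pos.2 (h.wellD_pos (wellPoint_mem_Icc h.lt.le (θ t)))
    have e3 : 0 < √(2 / m) := Real.sqrt_pos.2 (by positivity)
    rw [hI, hmm]
    field_simp
  refine ⟨fun t => wellPoint p q (θ t), φ, P, isNonsingularOrbit_of_effPot hf hV hm L hmem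
    (fun t _ => hu t) (fun t _ => hP t) hφd, S.isBoundedOrbit_of_compact isCompact_Icc hsub
    hf.continuousOn fun t _ => wellPoint_mem_Icc h.lt.le _, ?_, ?_⟩
  · rintro ⟨u₀, hu₀⟩
    obtain ⟨t, ht⟩ := hθs Real.pi
    have ht0 : 0 ≤ t := by
      by_contra hneg
      have := hθm (not_le.1 hneg)
      rw [ht, hθ0] at this
      exact absurd this (not_lt.2 Real.pi_pos.le)
    have e1 := hu₀ t ht0
    have e2 := hu₀ 0 le_rfl
    simp only [ht, hθ0, wellPoint_zero, wellPoint_pi] at e1 e2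
    exact h.lt.ne (e2.trans e1.symm)
  · intro T hT hTu
    simp only [hθ0, wellPoint_zero] at hTu
    -- The orbit starts at the turning point `p`, which is reached exactly at the multiples of `2 π`
    -- of the phase `θ`; a turning point is passed only once per oscillation.
    rw [wellPoint_eq_left h.lt, Real.cos_eq_one_iff] at hTu
    obtain ⟨n, hn⟩ := hTu
    have hpos : 0 < θ T := hθ0 ▸ hθm hT
    have hn0 : 0 < n := by
      rw [← hn] at hpos
      exact_mod_cast (pos_iff_pos_of_mul_pos hpos).2 (by positivity)
    lift n to ℕ using hn0.le
    refine ⟨n, by exact_mod_cast hn0, ?_⟩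
    have h1 := hIper.intervalIntegral_add_zsmul_eq (n : ℤ) 0
      fun a b => hIc.intervalIntegrable a b
    simp only [zero_add, zsmul_eq_mul] at h1
    simp only [hφ, hθ0, intervalIntegral.integral_same, mul_zero, zero_add]
    rw [← hn, h1]
    simp only [wellAngle, ← hI, Int.cast_natCast]
    ring

/-- During a period of the closed orbit `u` completes some number `n > 0` of oscillations while `φ`
grows by `2 π k`, so a single oscillation contributes `2 π k / n`. The factor `√(μ / 2)` is `L / √(2
m)` for `L = √(m μ)`. -/
theorem IsClosedOrbitPotential.angle_rational (hf : AnalyticOnNhd ℝ S.f S.chart) (hm : 0 < m)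
    (hV : S.IsClosedOrbitPotential m V) (hμ : 0 ≤ μ) (hp : p ∈ S.chart) (hq : q ∈ S.chart)
    (h : IsWell (S.effPot V μ) p q) :
    ∃ r : ℚ, √(μ / 2) * S.wellAngle (S.effPot V μ) p q = 2 * Real.pi * r := by
  have hk := hV.kind_ne_toroidal hf hm
  have hLμ : √(m * μ) ^ 2 / m = μ := by
    rw [Real.sq_sqrt (by positivity)]; field_simp
  have hLm : √(m * μ) / √(2 * m) = √(μ / 2) := by
    rw [← Real.sqrt_div (by positivity)]
    congr 1; field_simp
  obtain ⟨u, φ, pu, horb, hb, -, hn⟩ := exists_orbit_of_isWell hf hV.central.analytic hm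
    (√(m * μ)) hp hq (by rwa [hLμ])
  rw [hLμ, hLm] at hn
  obtain ⟨T, hT, hper⟩ := hV.closed _ _ _ _ horb hb
  have h0 := hper 0 le_rfl
  rw [zero_add] at h0
  obtain ⟨h1, h2, -⟩ := S.profile_eq_of_point_eq (horb.mem T hT.le) (horb.mem 0 le_rfl) h0
  have huT := eq_of_profile_eq hk (horb.mem T hT.le) (horb.mem 0 le_rfl) h1 h2
  obtain ⟨n, hn0, hφ⟩ := hn T hT huT
  obtain ⟨e1, e2, -⟩ := S.point_ext_iff.1 h0
  rw [huT] at e1 e2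
  have hf0 := (S.f_pos_of_mem_chart (horb.mem 0 le_rfl)).ne'
  have e1 := mul_left_cancel₀ hf0 e1
  have e2 := mul_left_cancel₀ hf0 e2
  have e3 : Real.cos (φ T - φ 0) = 1 := by
    rw [Real.cos_sub, e1, e2]
    linarith [Real.sin_sq_add_cos_sq (φ 0)]
  obtain ⟨k, hk⟩ := (Real.cos_eq_one_iff _).1 e3
  refine ⟨k / n, ?_⟩
  have hn1 : (n : ℝ) ≠ 0 := by exact_mod_cast hn0.ne'
  push_cast
  field_simp
  rw [hφ] at hk
  linarith

end SurfaceOfRevolution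
end

/-! ### Continuity of the angle; no common critical points of V and F -/

open Set
open scoped ContDiff
noncomputable section

open Filter Topology

/-- A continuous function on a connected space whose values are rational multiples of `2 π` is
constant. -/
theorem eq_of_forall_rational_mul_two_pi {X : Type*} [TopologicalSpace X] [PreconnectedSpace X]
    {A : X → ℝ} (hA : Continuous A) (h : ∀ x, ∃ r : ℚ, A x = 2 * Real.pi * r) (x y : X) :
    A x = A y := by
  wlog hlt : A x < A y generalizing x y
  · rcases lt_trichotomy (A x) (A y) with h1 | h1 | h1
    · exact absurd h1 hlt
    · exact h1
    · exact (this y x h1).symm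
  exfalso
  have h2π : 0 < 2 * Real.pi := by positivity
  obtain ⟨z, hz, hz1, hz2⟩ := exists_irrational_btwn (div_lt_div_of_pos_right hlt h2π)
  rw [div_lt_iff₀ h2π] at hz1
  rw [lt_div_iff₀ h2π] at hz2
  obtain ⟨w, -, hw⟩ := isPreconnected_univ.intermediate_value (mem_univ x) (mem_univ y)
    hA.continuousOn ⟨hz1.le, hz2.le⟩
  obtain ⟨r, hr⟩ := h w
  refine hz ⟨r, ?_⟩
  have : 2 * Real.pi * (r : ℝ) = 2 * Real.pi * z := by rw [← hr, hw]; ring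
  exact mul_left_cancel₀ h2π.ne' this

namespace SurfaceOfRevolution

variable {S : SurfaceOfRevolution} {m : ℝ} {V : ℝ → ℝ} {μ : ℝ} {p q : ℝ}

theorem dslope_effPot (hf : AnalyticOnNhd ℝ S.f S.chart) (hV : AnalyticOnNhd ℝ V S.chart)
    {a : ℝ} (ha : a ∈ S.chart) (b : ℝ) :
    dslope (S.effPot V μ) a b = dslope V a b + μ * dslope S.F a b := by
  rcases eq_or_ne b a with rfl | h
  · simp only [dslope_same]
    exact deriv_effPot hf hV μ ha
  · simp only [dslope_of_ne _ h, slope_def_field, effPot]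
    ring

/-- The angle of an oscillation depends continuously on the well. -/
theorem continuous_wellAngle (hf : AnalyticOnNhd ℝ S.f S.chart)
    (hV : AnalyticOnNhd ℝ V S.chart) {X : Type*} [TopologicalSpace X] {M P Q : X → ℝ}
    (hM : Continuous M) (hP : Continuous P) (hQ : Continuous Q) (hPJ : ∀ x, P x ∈ S.chart)
    (hQJ : ∀ x, Q x ∈ S.chart) (hw : ∀ x, IsWell (S.effPot V (M x)) (P x) (Q x)) :
    Continuous fun x => S.wellAngle (S.effPot V (M x)) (P x) (Q x) := by
  unfold wellAngle
  refine intervalIntegral.continuous_parametric_intervalIntegral_of_continuous' ?_ _ _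
  set U : X × ℝ → ℝ := fun y => wellPoint (P y.1) (Q y.1) y.2 with hU
  have hUc : Continuous U := by
    have h1 : Continuous fun y : X × ℝ => P y.1 := hP.comp continuous_fst
    have h2 : Continuous fun y : X × ℝ => Q y.1 := hQ.comp continuous_fst
    have h3 : Continuous fun y : X × ℝ => Real.cos y.2 := Real.continuous_cos.comp continuous_snd
    unfold wellPoint at hU
    rw [hU]
    exact ((h1.add h2).div_const _).sub (((h2.sub h1).div_const _).mul h3)
  have hUI : ∀ y, U y ∈ Icc (P y.1) (Q y.1) := fun y => wellPoint_mem_Icc (hw y.1).lt.le _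
  have hUJ : ∀ y, U y ∈ S.chart := fun y => S.ordConnected_chart.out (hPJ _) (hQJ _) (hUI y)
  have hcomp : ∀ {g : ℝ → ℝ} (_ : AnalyticOnNhd ℝ g S.chart) {A B : X × ℝ → ℝ}
      (_ : Continuous A) (_ : Continuous B) (_ : ∀ y, A y ∈ S.chart) (_ : ∀ y, B y ∈ S.chart),
      Continuous fun y => dslope g (A y) (B y) := by
    intro g hg A B hA hB hAJ hBJ
    refine continuous_iff_continuousAt.2 fun y => ?_
    exact ContinuousAt.comp (f := fun y => (A y, B y))
      ((hg _ (hAJ y)).continuousAt_dslope_prod (hg _ (hBJ y)))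
      (hA.prodMk hB).continuousAt
  have hP' : Continuous fun y : X × ℝ => P y.1 := hP.comp continuous_fst
  have hQ' : Continuous fun y : X × ℝ => Q y.1 := hQ.comp continuous_fst
  have hM' : Continuous fun y : X × ℝ => M y.1 := hM.comp continuous_fst
  have hF := analyticOnNhd_F hf
  -- The potential itself varies with `x`, but it is affine in `M`; splitting the divided
  -- differences leaves only those of the fixed functions `V` and `F`.
  have hD : Continuous fun y => wellD (S.effPot V (M y.1)) (P y.1) (Q y.1) (U y) := by
    have e : (fun y => wellD (S.effPot V (M y.1)) (P y.1) (Q y.1) (U y)) = fun y =>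
        (dslope V (U y) (Q y.1) + M y.1 * dslope S.F (U y) (Q y.1)
          - (dslope V (P y.1) (U y) + M y.1 * dslope S.F (P y.1) (U y))) / (Q y.1 - P y.1) := by
      funext y
      rw [wellD, dslope_effPot hf hV (hUJ y), dslope_effPot hf hV (hPJ _)]
    rw [e]
    refine Continuous.div (((hcomp hV hUc hQ' hUJ fun y => hQJ _).add
      (hM'.mul (hcomp hF hUc hQ' hUJ fun y => hQJ _))).sub
      ((hcomp hV hP' hUc (fun y => hPJ _) hUJ).add
      (hM'.mul (hcomp hF hP' hUc (fun y => hPJ _) hUJ)))) (hQ'.sub hP') fun y =>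
        (sub_pos.2 (hw y.1).lt).ne'
  have hfU : Continuous fun y => S.f (U y) := hf.continuousOn.comp_continuous hUc hUJ
  exact continuous_const.div ((hfU.pow 2).mul hD.sqrt) fun y =>
    (mul_pos (pow_pos (S.f_pos_of_mem_chart (hUJ y)) 2)
      (Real.sqrt_pos.2 ((hw y.1).wellD_pos (hUI y)))).ne'

section Critical

variable {a : ℝ} (hf : AnalyticOnNhd ℝ S.f S.chart) (hm : 0 < m)
  (hV : S.IsClosedOrbitPotential m V) (hμ : 0 ≤ μ) (hn : S.NonconstPot V μ)
  (ha : a ∈ S.chart) (hcrit : deriv (S.effPot V μ) a = 0)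

include hf hm hV hμ hn ha hcrit

theorem IsClosedOrbitPotential.strictMonoOn_right {q : ℝ} (hq : q ∈ S.chart) :
    StrictMonoOn (S.effPot V μ) (Icc a q) := by
  have hsub : Icc a q ⊆ S.chart := S.ordConnected_chart.out ha hq
  refine strictMonoOn_of_deriv_pos (convex_Icc a q)
    ((analyticOnNhd_effPot hf hV.central.analytic μ).continuousOn.mono hsub) fun x hx => ?_
  rw [interior_Icc] at hx
  exact hV.deriv_pos_right hf hm hμ hn ha hcrit (hsub (Ioo_subset_Icc_self hx)) hx.1

theorem IsClosedOrbitPotential.strictAntiOn_left {p : ℝ} (hp : p ∈ S.chart) :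
    StrictAntiOn (S.effPot V μ) (Icc p a) := by
  have hsub : Icc p a ⊆ S.chart := S.ordConnected_chart.out hp ha
  refine strictAntiOn_of_deriv_neg (convex_Icc p a)
    ((analyticOnNhd_effPot hf hV.central.analytic μ).continuousOn.mono hsub) fun x hx => ?_
  rw [interior_Icc] at hx
  exact hV.deriv_neg_left hf hm hμ hn ha hcrit (hsub (Ioo_subset_Icc_self hx)) hx.2

theorem IsClosedOrbitPotential.isWell_of_critical (hp : p ∈ S.chart) (hq : q ∈ S.chart)
    (hpa : p < a) (haq : a < q) (heq : S.effPot V μ p = S.effPot V μ q) :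
    IsWell (S.effPot V μ) p q where
  lt := hpa.trans haq
  eq := heq
  below u hu := by
    rcases le_total u a with h | h
    · rw [← heq]
      exact hV.strictAntiOn_left hf hm hμ hn ha hcrit hp (left_mem_Icc.2 hpa.le) ⟨hu.1.le, h⟩ hu.1
    · exact hV.strictMonoOn_right hf hm hμ hn ha hcrit hq ⟨h, hu.2.le⟩ (right_mem_Icc.2 haq.le) hu.2
  deriv_left := hV.deriv_neg_left hf hm hμ hn ha hcrit hp hpa
  deriv_right := hV.deriv_pos_right hf hm hμ hn ha hcrit hq haq

end Critical

/-- If `V` has the closed orbit property then turning points determine a well. -/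
theorem IsClosedOrbitPotential.isWell_of_eq (hf : AnalyticOnNhd ℝ S.f S.chart) (hm : 0 < m)
    (hV : S.IsClosedOrbitPotential m V) (hμ : 0 ≤ μ) (hn : S.NonconstPot V μ)
    (hp : p ∈ S.chart) (hq : q ∈ S.chart) (hpq : p < q)
    (heq : S.effPot V μ p = S.effPot V μ q) : IsWell (S.effPot V μ) p q := by
  have hsub : Icc p q ⊆ S.chart := S.ordConnected_chart.out hp hq
  obtain ⟨a, ha, hcrit⟩ := exists_deriv_eq_zero hpq
    ((analyticOnNhd_effPot hf hV.central.analytic μ).continuousOn.mono hsub) heq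
  exact hV.isWell_of_critical hf hm hμ hn (hsub (Ioo_subset_Icc_self ha)) hcrit hp hq ha.1 ha.2 heq

theorem effPot_convex_comb (u : ℝ) :
    S.effPot V μ u = (1 - μ) * S.effPot V 0 u + μ * S.effPot V 1 u := by
  simp only [effPot]; ring

/-- The effective potentials have no common critical point if one of them is constant. -/
theorem IsClosedOrbitPotential.nonconstPot_of_common_critical
    (hf : AnalyticOnNhd ℝ S.f S.chart) (hm : 0 < m) (hV : S.IsClosedOrbitPotential m V)
    {a : ℝ} (ha : a ∈ S.chart) (hVa : deriv V a = 0) (hFa : deriv S.F a = 0) (hμ : 0 ≤ μ) :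
    S.NonconstPot V μ := by
  by_contra hconst
  have hconst' := hconst
  simp only [NonconstPot] at hconst
  push Not at hconst
  have hVa' := hV.central.analytic
  have hn0 : S.NonconstPot V 0 := by
    simpa only [NonconstPot, effPot_zero] using hV.nonconstant
  -- If `V + μ F` is constant, then `V + 2 μ F` equals `-V` up to a constant. Both `V` and `-V`
  -- would have to increase to the right of `a`.
  have hn2 : S.NonconstPot V (2 * μ) := by
    obtain ⟨u, hu, v, hv, huv⟩ := hV.nonconstant
    refine ⟨u, hu, v, hv, fun h => huv ?_⟩
    have := hconst u hu v hv
    simp only [effPot] at this h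
    linarith
  obtain ⟨u, hu, hua⟩ : ∃ u ∈ S.chart, a < u := by
    obtain ⟨u, hu, hu'⟩ := ((eventually_nhdsWithin_of_eventually_nhds
      (S.chart_mem_nhds ha)).and self_mem_nhdsWithin : ∀ᶠ u in 𝓝[>] a, u ∈ S.chart ∧ _).exists
    exact ⟨u, hu, hu'⟩
  have hcrit : ∀ ν, deriv (S.effPot V ν) a = 0 := fun ν => by
    rw [deriv_effPot hf hVa' ν ha, hVa, hFa]; ring
  have h1 := hV.deriv_pos_right hf hm le_rfl hn0 ha (hcrit _) hu hua
  have h2 := hV.deriv_pos_right hf hm (mul_nonneg two_pos.le hμ) hn2 ha (hcrit _) hu hua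
  have h3 : deriv (S.effPot V μ) u = 0 := by
    have : S.effPot V μ =ᶠ[𝓝 u] fun _ => S.effPot V μ u := by
      filter_upwards [S.chart_mem_nhds hu] with w hw using hconst w hw u hu
    rw [this.deriv_eq, deriv_const]
  rw [deriv_effPot hf hVa' _ hu] at h1 h2 h3
  linarith

/-- The potential and the centrifugal potential have no common critical point. -/
theorem IsClosedOrbitPotential.not_common_critical
    (hf : AnalyticOnNhd ℝ S.f S.chart) (hm : 0 < m) (hV : S.IsClosedOrbitPotential m V)
    {a : ℝ} (ha : a ∈ S.chart) (hVa : deriv V a = 0) : deriv S.F a ≠ 0 := by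
  intro hFa
  have hVa' := hV.central.analytic
  have hn : ∀ ν, 0 ≤ ν → S.NonconstPot V ν := fun ν hν =>
    hV.nonconstPot_of_common_critical hf hm ha hVa hFa hν
  have hcrit : ∀ ν, deriv (S.effPot V ν) a = 0 := fun ν => by
    rw [deriv_effPot hf hVa' ν ha, hVa, hFa]; ring
  obtain ⟨p₁, hp₁, hp₁a⟩ : ∃ u ∈ S.chart, u < a := by
    obtain ⟨u, hu, hu'⟩ := ((eventually_nhdsWithin_of_eventually_nhds
      (S.chart_mem_nhds ha)).and self_mem_nhdsWithin : ∀ᶠ u in 𝓝[<] a, u ∈ S.chart ∧ _).exists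
    exact ⟨u, hu, hu'⟩
  have hanti : ∀ ν, 0 ≤ ν → StrictAntiOn (S.effPot V ν) (Icc p₁ a) := fun ν hν =>
    hV.strictAntiOn_left hf hm hν (hn ν hν) ha (hcrit ν) hp₁
  have hlt : ∀ ν, 0 ≤ ν → S.effPot V ν a < S.effPot V ν p₁ := fun ν hν =>
    hanti ν hν (left_mem_Icc.2 hp₁a.le) (right_mem_Icc.2 hp₁a.le) hp₁a
  have hev : ∀ ν, 0 ≤ ν → ∀ᶠ u in 𝓝[>] a, S.effPot V ν u < S.effPot V ν p₁ := fun ν hν =>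
    nhdsWithin_le_nhds ((analyticOnNhd_effPot hf hVa' ν a ha).continuousAt.eventually_lt_const
      (hlt ν hν))
  -- The right turning point is kept fixed. It only has to lie low enough for `ν = 0` and `ν = 1`,
  -- since the effective potential is affine in `ν`.
  obtain ⟨q, ⟨⟨hq0, hq1⟩, hqJ⟩, haq⟩ := (((hev 0 le_rfl).and (hev 1 one_pos.le)).and
    (eventually_nhdsWithin_of_eventually_nhds (S.chart_mem_nhds ha)) |>.and
    self_mem_nhdsWithin).exists
  have haq : a < q := haq
  have hsub : Icc p₁ a ⊆ S.chart := S.ordConnected_chart.out hp₁ ha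
  have hq : ∀ ν ∈ Icc (0 : ℝ) 1, S.effPot V ν q < S.effPot V ν p₁ := fun ν hν => by
    rw [effPot_convex_comb q, effPot_convex_comb p₁]
    rcases hν.2.lt_or_eq with h | h
    · have h1 := mul_lt_mul_of_pos_left hq0 (sub_pos.2 h)
      have h2 := mul_le_mul_of_nonneg_left hq1.le hν.1
      linarith
    · rw [h]; linarith
  have hqa : ∀ ν, 0 ≤ ν → S.effPot V ν a < S.effPot V ν q := fun ν hν =>
    hV.strictMonoOn_right hf hm hν (hn ν hν) ha (hcrit ν) hqJ (left_mem_Icc.2 haq.le)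
      (right_mem_Icc.2 haq.le) haq
  have hex : ∀ ν : Icc (0 : ℝ) 1, ∃ p ∈ Ioo p₁ a, S.effPot V ν p = S.effPot V ν q := fun ν => by
    have hc : ContinuousOn (S.effPot V ν) (Icc p₁ a) :=
      (analyticOnNhd_effPot hf hVa' ν).continuousOn.mono hsub
    exact intermediate_value_Ioo' hp₁a.le hc ⟨hqa ν ν.2.1, hq ν ν.2⟩
  choose P hP hPeq using hex
  have hcont : ∀ u, Continuous fun ν : Icc (0 : ℝ) 1 => S.effPot V ν u := fun u => by
    unfold effPot; fun_prop
  -- The left turning point is found on a strictly decreasing branch, so comparing values at a fixed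
  -- `b` traps it; those values depend continuously on `ν`.
  have hPc : Continuous P := by
    refine continuous_iff_continuousAt.2 fun ν₀ => tendsto_order.2 ⟨fun b hb => ?_, fun b hb => ?_⟩
    · rcases lt_or_ge b p₁ with h | h
      · exact Eventually.of_forall fun ν => h.trans (hP ν).1
      · have hbI : b ∈ Icc p₁ a := ⟨h, hb.le.trans (hP ν₀).2.le⟩
        have h0 := hanti ν₀ ν₀.2.1 hbI (Ioo_subset_Icc_self (hP ν₀)) hb
        rw [hPeq] at h0
        filter_upwards [(hcont q).continuousAt.eventually_lt (hcont b).continuousAt h0] with ν hν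
        by_contra hneg
        push Not at hneg
        have := (hanti ν ν.2.1).antitoneOn (Ioo_subset_Icc_self (hP ν)) hbI hneg
        rw [hPeq] at this
        linarith
    · rcases lt_or_ge a b with h | h
      · exact Eventually.of_forall fun ν => (hP ν).2.trans h
      · have hbI : b ∈ Icc p₁ a := ⟨(hP ν₀).1.le.trans hb.le, h⟩
        have h0 := hanti ν₀ ν₀.2.1 (Ioo_subset_Icc_self (hP ν₀)) hbI hb
        rw [hPeq] at h0
        filter_upwards [(hcont b).continuousAt.eventually_lt (hcont q).continuousAt h0] with ν hν
        by_contra hneg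
        push Not at hneg
        have := (hanti ν ν.2.1).antitoneOn hbI (Ioo_subset_Icc_self (hP ν)) hneg
        rw [hPeq] at this
        linarith
  have hPJ : ∀ ν, P ν ∈ S.chart := fun ν => hsub (Ioo_subset_Icc_self (hP ν))
  have hw : ∀ ν : Icc (0 : ℝ) 1, IsWell (S.effPot V ν) (P ν) q := fun ν =>
    hV.isWell_of_critical hf hm ν.2.1 (hn _ ν.2.1) ha (hcrit _) (hPJ ν) hqJ (hP ν).2 haq (hPeq ν)
  have hA : Continuous fun ν : Icc (0 : ℝ) 1 =>
      √((ν : ℝ) / 2) * S.wellAngle (S.effPot V ν) (P ν) q :=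
    (continuous_subtype_val.div_const 2).sqrt.mul
      (continuous_wellAngle hf hVa' continuous_subtype_val hPc continuous_const hPJ
        (fun _ => hqJ) hw)
  have heq := eq_of_forall_rational_mul_two_pi hA
    (fun ν => hV.angle_rational hf hm ν.2.1 (hPJ ν) hqJ (hw ν))
    ⟨0, left_mem_Icc.2 one_pos.le⟩ ⟨1, right_mem_Icc.2 one_pos.le⟩
  have hpos := wellAngle_pos hf (analyticOnNhd_effPot hf hVa' 1) (hPJ ⟨1, right_mem_Icc.2 one_pos.le⟩)
    hqJ (hw ⟨1, right_mem_Icc.2 one_pos.le⟩)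
  have h1 : 0 < √((1 : ℝ) / 2) := Real.sqrt_pos.2 (by norm_num)
  -- At `ν = 0` the motion is radial and the angle is zero, while at `ν = 1` it is positive; a
  -- constant angle cannot be both.
  simp only [zero_div, Real.sqrt_zero, zero_mul] at heq
  exact (mul_pos h1 hpos).ne heq

end SurfaceOfRevolution
end

/-! ### An interval of circular orbits and the constant angle -/

open Set
open scoped ContDiff
noncomputable section

open Filter Topology

namespace SurfaceOfRevolution

variable {S : SurfaceOfRevolution} {m : ℝ} {V : ℝ → ℝ} {μ : ℝ} {p q : ℝ}

/-- If `V + μ F` were constant, a critical point of `V + ν F` would satisfy `(ν - μ) F' = 0`. The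
case `ν = μ` contradicts nonconstancy at `ν`, and `F' = 0` would be a common critical point. -/
theorem IsClosedOrbitPotential.nonconstPot (hf : AnalyticOnNhd ℝ S.f S.chart) (hm : 0 < m)
    (hV : S.IsClosedOrbitPotential m V) (μ : ℝ) : S.NonconstPot V μ := by
  by_contra hconst
  simp only [NonconstPot] at hconst
  push Not at hconst
  have hVa' := hV.central.analytic
  obtain ⟨ν, hν, hn, a, ha, hcrit⟩ := hV.exists_critical hf hm
  have h3 : deriv (S.effPot V μ) a = 0 := by
    have : S.effPot V μ =ᶠ[𝓝 a] fun _ => S.effPot V μ a := by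
      filter_upwards [S.chart_mem_nhds ha] with w hw using hconst w hw a ha
    rw [this.deriv_eq, deriv_const]
  rw [deriv_effPot hf hVa' _ ha] at h3 hcrit
  have h4 : (ν - μ) * deriv S.F a = 0 := by linarith
  rcases mul_eq_zero.1 h4 with h | h
  · obtain ⟨u, hu, v, hv, huv⟩ := hn
    rw [sub_eq_zero.1 h] at huv
    exact huv (hconst u hu v hv)
  · rw [h] at hcrit
    exact hV.not_common_critical hf hm ha (by linarith) h

/-- There is an interval of positions with circular orbits. -/
theorem IsClosedOrbitPotential.exists_interval (hf : AnalyticOnNhd ℝ S.f S.chart) (hm : 0 < m)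
    (hV : S.IsClosedOrbitPotential m V) :
    ∃ c d, c < d ∧ Ioo c d ⊆ S.chart ∧ ∀ u ∈ Ioo c d,
      deriv S.F u ≠ 0 ∧ 0 < -(deriv V u / deriv S.F u) := by
  have hVa' := hV.central.analytic
  obtain ⟨ν, hν, hn, a, ha, hcrit⟩ := hV.exists_critical hf hm
  have hcrit' := hcrit
  rw [deriv_effPot hf hVa' _ ha] at hcrit
  have hFa : deriv S.F a ≠ 0 := by
    intro h
    rw [h] at hcrit
    exact hV.not_common_critical hf hm ha (by linarith) h
  have hFc : ContinuousAt (deriv S.F) a := ((analyticOnNhd_F hf).deriv a ha).continuousAt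
  have hVc : ContinuousAt (deriv V) a := (hVa'.deriv a ha).continuousAt
  have hJ := S.chart_mem_nhds ha
  have finish : ∀ u, (∀ᶠ v in 𝓝 u, v ∈ S.chart ∧ deriv S.F v ≠ 0 ∧
      0 < -(deriv V v / deriv S.F v)) → ∃ c d, c < d ∧ Ioo c d ⊆ S.chart ∧ ∀ u ∈ Ioo c d,
      deriv S.F u ≠ 0 ∧ 0 < -(deriv V u / deriv S.F u) := fun u hu => by
    obtain ⟨c, d, ⟨hc, hd⟩, hsub⟩ := mem_nhds_iff_exists_Ioo_subset.1 hu
    exact ⟨c, d, hc.trans hd, fun v hv => (hsub hv).1, fun v hv => (hsub hv).2⟩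
  have finish' : ∀ u ∈ S.chart, deriv S.F u ≠ 0 → 0 < -(deriv V u / deriv S.F u) →
      ∃ c d, c < d ∧ Ioo c d ⊆ S.chart ∧ ∀ u ∈ Ioo c d,
      deriv S.F u ≠ 0 ∧ 0 < -(deriv V u / deriv S.F u) := fun u hu hF hpos => by
    have hFu : ContinuousAt (deriv S.F) u := ((analyticOnNhd_F hf).deriv u hu).continuousAt
    have hVu : ContinuousAt (deriv V) u := (hVa'.deriv u hu).continuousAt
    exact finish u ((S.isOpen_chart.eventually_mem hu).and
      ((hFu.eventually_ne hF).and ((hVu.div hFu hF).neg.eventually_const_lt hpos)))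
  -- For `ν = 0` the ratio vanishes at `a` itself. But `V'` changes sign there and `F'` does not, so
  -- the ratio has the right sign on one side of `a`.
  rcases hν.eq_or_lt with rfl | hpos
  · rcases lt_or_gt_of_ne hFa with hneg | hpos
    · obtain ⟨u, ⟨hu1, hu2⟩, hau⟩ := ((eventually_nhdsWithin_of_eventually_nhds
        ((S.isOpen_chart.eventually_mem ha).and (hFc.eventually_lt_const hneg))).and
        self_mem_nhdsWithin : ∀ᶠ u in 𝓝[>] a, _ ∧ _).exists
      have h1 := hV.deriv_pos_right hf hm le_rfl hn ha hcrit' hu1 hau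
      rw [effPot_zero] at h1
      exact finish' u hu1 hu2.ne (neg_pos.2 (div_neg_of_pos_of_neg h1 hu2))
    · obtain ⟨u, ⟨hu1, hu2⟩, hau⟩ := ((eventually_nhdsWithin_of_eventually_nhds
        ((S.isOpen_chart.eventually_mem ha).and (hFc.eventually_const_lt hpos))).and
        self_mem_nhdsWithin : ∀ᶠ u in 𝓝[<] a, _ ∧ _).exists
      have h1 := hV.deriv_neg_left hf hm le_rfl hn ha hcrit' hu1 hau
      rw [effPot_zero] at h1
      exact finish' u hu1 hu2.ne' (neg_pos.2 (div_neg_of_neg_of_pos h1 hu2))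
  · refine finish' a ha hFa ?_
    have : -(deriv V a / deriv S.F a) = ν := by
      field_simp
      linarith
    rwa [this]

/-- The angle between consecutive pericentres is the same rational multiple of `2 π` for all
oscillations in some interval. -/
theorem IsClosedOrbitPotential.exists_angle_eq (hf : AnalyticOnNhd ℝ S.f S.chart) (hm : 0 < m)
    (hV : S.IsClosedOrbitPotential m V) {c d : ℝ} (hcd : c < d) (hJ : Ioo c d ⊆ S.chart)
    (hF : ∀ u ∈ Ioo c d, deriv S.F u ≠ 0 ∧ 0 < -(deriv V u / deriv S.F u)) :
    ∃ r : ℚ, 0 < r ∧ ∀ μ p q, p ∈ Ioo c d → q ∈ Ioo c d → p < q →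
      S.effPot V μ p = S.effPot V μ q → 0 < μ ∧ IsWell (S.effPot V μ) p q ∧
        √(μ / 2) * S.wellAngle (S.effPot V μ) p q = 2 * Real.pi * r := by
  have hVa := hV.central.analytic
  have hFa := analyticOnNhd_F hf
  have hsub : ∀ {p q : ℝ}, p ∈ Ioo c d → q ∈ Ioo c d → Icc p q ⊆ Ioo c d := fun hp hq =>
    ordConnected_Ioo.out hp hq
  have hFne : ∀ {p q : ℝ}, p ∈ Ioo c d → q ∈ Ioo c d → p < q → S.F q - S.F p ≠ 0 := by
    intro p q hp hq hpq h
    obtain ⟨a, ha, h0⟩ := exists_deriv_eq_zero hpq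
      (hFa.continuousOn.mono ((hsub hp hq).trans hJ)) (by linarith : S.F p = S.F q)
    exact (hF a (hsub hp hq (Ioo_subset_Icc_self ha))).1 h0
  -- The only strength of the centrifugal term for which `p` and `q` have the same effective
  -- potential. It is positive by Cauchy's mean value theorem.
  set M : ℝ × ℝ → ℝ := fun x => -((V x.2 - V x.1) / (S.F x.2 - S.F x.1)) with hM
  have hMpos : ∀ {p q : ℝ}, p ∈ Ioo c d → q ∈ Ioo c d → p < q → 0 < M (p, q) := by
    intro p q hp hq hpq
    obtain ⟨a, ha, h0⟩ := exists_ratio_deriv_eq_ratio_slope V hpq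
      (hVa.continuousOn.mono ((hsub hp hq).trans hJ))
      (fun x hx => (hVa x (hJ (hsub hp hq (Ioo_subset_Icc_self hx)))).differentiableWithinAt) S.F
      (hFa.continuousOn.mono ((hsub hp hq).trans hJ))
      (fun x hx => (hFa x (hJ (hsub hp hq (Ioo_subset_Icc_self hx)))).differentiableWithinAt)
    obtain ⟨h1, h2⟩ := hF a (hsub hp hq (Ioo_subset_Icc_self ha))
    have h3 := hFne hp hq hpq
    have : M (p, q) = -(deriv V a / deriv S.F a) := by
      simp only [hM]
      congr 1
      rw [div_eq_div_iff h3 h1]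
      linarith
    rwa [this]
  have hMeq : ∀ {p q : ℝ}, p ∈ Ioo c d → q ∈ Ioo c d → p < q → ∀ μ,
      S.effPot V μ p = S.effPot V μ q ↔ μ = M (p, q) := by
    intro p q hp hq hpq μ
    have h3 := hFne hp hq hpq
    simp only [hM, effPot]
    rw [← neg_div, eq_div_iff h3]
    constructor <;> intro h <;> linarith
  have hwell : ∀ {p q : ℝ}, p ∈ Ioo c d → q ∈ Ioo c d → p < q →
      IsWell (S.effPot V (M (p, q))) p q := fun {p q} hp hq hpq =>
    hV.isWell_of_eq hf hm (hMpos hp hq hpq).le (hV.nonconstPot hf hm _) (hJ hp) (hJ hq) hpq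
      ((hMeq hp hq hpq _).2 rfl)
  -- The wells over the interval are parametrized by their pairs of turning points, which form a
  -- convex, hence connected, set.
  set X : Set (ℝ × ℝ) := {x | (c < x.1 ∧ x.2 < d) ∧ x.1 < x.2} with hX
  have hXc : Convex ℝ X := by
    intro x hx y hy s t hs ht hst
    simp only [hX, mem_ofPred_eq, Prod.fst_add, Prod.snd_add, Prod.smul_fst, Prod.smul_snd,
      smul_eq_mul] at hx hy ⊢
    have ht' : t = 1 - s := by linarith
    subst ht'
    rcases hs.eq_or_lt with rfl | hs'
    · simpa using hy
    · refine ⟨⟨?_, ?_⟩, ?_⟩ <;> nlinarith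
  have : PreconnectedSpace X := Subtype.preconnectedSpace hXc.isPreconnected
  have h1 : ∀ x : X, x.1.1 ∈ Ioo c d := fun x => ⟨x.2.1.1, x.2.2.trans x.2.1.2⟩
  have h2 : ∀ x : X, x.1.2 ∈ Ioo c d := fun x => ⟨x.2.1.1.trans x.2.2, x.2.1.2⟩
  have hMc : Continuous fun x : X => M x.1 := by
    have hc1 : ∀ {g : ℝ → ℝ}, ContinuousOn g S.chart → Continuous fun x : X => g x.1.1 :=
      fun hg => hg.comp_continuous (by fun_prop) fun x => hJ (h1 x)
    have hc2 : ∀ {g : ℝ → ℝ}, ContinuousOn g S.chart → Continuous fun x : X => g x.1.2 :=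
      fun hg => hg.comp_continuous (by fun_prop) fun x => hJ (h2 x)
    exact (((hc2 hVa.continuousOn).sub (hc1 hVa.continuousOn)).div
      ((hc2 hFa.continuousOn).sub (hc1 hFa.continuousOn))
      fun x => hFne (h1 x) (h2 x) x.2.2).neg
  have hA : Continuous fun x : X =>
      √(M x.1 / 2) * S.wellAngle (S.effPot V (M x.1)) x.1.1 x.1.2 :=
    (hMc.div_const 2).sqrt.mul (continuous_wellAngle hf hVa hMc (by fun_prop) (by fun_prop)
      (fun x => hJ (h1 x)) (fun x => hJ (h2 x)) fun x => hwell (h1 x) (h2 x) x.2.2)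
  have hrat := fun x : X => hV.angle_rational hf hm (hMpos (h1 x) (h2 x) x.2.2).le (hJ (h1 x))
    (hJ (h2 x)) (hwell (h1 x) (h2 x) x.2.2)
  obtain ⟨p₀, hcp, hpd⟩ := exists_between hcd
  obtain ⟨q₀, hpq, hqd⟩ := exists_between hpd
  let x₀ : X := ⟨(p₀, q₀), ⟨hcp, hqd⟩, hpq⟩
  obtain ⟨r, hr⟩ := hrat x₀
  have hr0 : 0 < r := by
    have e1 := wellAngle_pos hf (analyticOnNhd_effPot hf hVa (M x₀.1)) (hJ (h1 x₀)) (hJ (h2 x₀))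
      (hwell (h1 x₀) (h2 x₀) hpq)
    have e2 : 0 < √(M x₀.1 / 2) := Real.sqrt_pos.2 (half_pos (hMpos (h1 x₀) (h2 x₀) hpq))
    have e3 := mul_pos e2 e1
    have e4 : √(M x₀.1 / 2) * S.wellAngle (S.effPot V (M x₀.1)) x₀.1.1 x₀.1.2
      = 2 * Real.pi * r := hr
    rw [e4] at e3
    have := (pos_iff_pos_of_mul_pos e3).1 (by positivity)
    exact_mod_cast this
  refine ⟨r, hr0, fun μ p q hp hq hpq heq => ?_⟩
  obtain rfl := (hMeq hp hq hpq μ).1 heq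
  refine ⟨hMpos hp hq hpq, hwell hp hq hpq, ?_⟩
  rw [← hr]
  exact eq_of_forall_rational_mul_two_pi hA hrat ⟨(p, q), ⟨hp.1, hq.2⟩, hpq⟩ x₀

end SurfaceOfRevolution
end

/-! ### Abel inversion -/

open Set
open scoped ContDiff
noncomputable section

open Filter Topology MeasureTheory
open scoped ENNReal

theorem image_wellPoint {p q : ℝ} (h : p < q) : wellPoint p q '' Ioo 0 Real.pi = Ioo p q := by
  apply Subset.antisymm
  · rintro _ ⟨x, hx, rfl⟩
    exact wellPoint_mem_Ioo h (Real.sin_pos_of_mem_Ioo hx).ne'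
  · have := intermediate_value_Ioo Real.pi_pos.le (continuous_wellPoint p q).continuousOn
    rwa [wellPoint_zero, wellPoint_pi] at this

/-- In the parametrization `wellPoint` the arcsine density `du / √((u - p) (q - u))` is `dx`. Lower
integrals make the improper integral harmless. -/
theorem lintegral_wellPoint {p q : ℝ} (h : p < q) (g : ℝ → ℝ≥0∞) :
    ∫⁻ u in Ioo p q, ENNReal.ofReal (√((u - p) * (q - u)))⁻¹ * g u =
      ∫⁻ x in Ioo 0 Real.pi, g (wellPoint p q x) := by
  have hr : 0 < (q - p) / 2 := by linarith
  have hinj : InjOn (wellPoint p q) (Ioo 0 Real.pi) := fun x hx y hy hxy => by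
    have : Real.cos x = Real.cos y := by
      unfold wellPoint at hxy
      have : (q - p) / 2 * (Real.cos x - Real.cos y) = 0 := by linarith
      rcases mul_eq_zero.1 this with h' | h' <;> linarith
    exact Real.injOn_cos (Ioo_subset_Icc_self hx) (Ioo_subset_Icc_self hy) this
  rw [← image_wellPoint h, lintegral_image_eq_lintegral_abs_deriv_mul measurableSet_Ioo
    (fun x _ => (hasDerivAt_wellPoint p q x).hasDerivWithinAt) hinj]
  refine setLIntegral_congr_fun measurableSet_Ioo fun x hx => ?_
  have hs : 0 < (q - p) / 2 * Real.sin x := mul_pos hr (Real.sin_pos_of_mem_Ioo hx)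
  rw [wellPoint_mul, Real.sqrt_sq hs.le, abs_of_pos hs, ← mul_assoc,
    ← ENNReal.ofReal_mul hs.le, mul_inv_cancel₀ hs.ne', ENNReal.ofReal_one, one_mul]

/-- The independence of `w` is what makes Abel inversion work. -/
theorem lintegral_beta {w E : ℝ} (h : w < E) :
    ∫⁻ e in Ioo w E, ENNReal.ofReal (√((e - w) * (E - e)))⁻¹ = ENNReal.ofReal Real.pi := by
  have := lintegral_wellPoint h fun _ => 1
  simpa using this

theorem lintegral_inv_sqrt {w E : ℝ} (h : w < E) :
    ∫⁻ e in Ioo w E, ENNReal.ofReal (√(E - e))⁻¹ = ENNReal.ofReal (2 * √(E - w)) := by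
  set R := √(E - w) with hR
  have hR0 : 0 < R := Real.sqrt_pos.2 (sub_pos.2 h)
  have hR2 : R ^ 2 = E - w := Real.sq_sqrt (sub_pos.2 h).le
  have him : (fun s => E - s ^ 2) '' Ioo 0 R = Ioo w E := by
    ext e
    constructor
    · rintro ⟨s, hs, rfl⟩
      constructor <;> dsimp only <;> nlinarith [hs.1, hs.2]
    · intro he
      refine ⟨√(E - e), ⟨Real.sqrt_pos.2 (sub_pos.2 he.2), ?_⟩, ?_⟩
      · exact Real.sqrt_lt_sqrt (sub_pos.2 he.2).le (by linarith [he.1])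
      · dsimp only
        rw [Real.sq_sqrt (sub_pos.2 he.2).le]; ring
  have hinj : InjOn (fun s : ℝ => E - s ^ 2) (Ioo 0 R) := fun x hx y hy hxy => by
    have h2 : x ^ 2 = y ^ 2 := by simpa using hxy
    exact (sq_eq_sq₀ hx.1.le hy.1.le).1 h2
  have hd : ∀ s ∈ Ioo 0 R, HasDerivWithinAt (fun s : ℝ => E - s ^ 2) (-(2 * s)) (Ioo 0 R) s :=
    fun s _ => by
      have := ((hasDerivAt_pow 2 s).const_sub E).hasDerivWithinAt (s := Ioo 0 R)
      simpa using this
  rw [← him, lintegral_image_eq_lintegral_abs_deriv_mul measurableSet_Ioo hd hinj]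
  have : ∀ s ∈ Ioo 0 R, ENNReal.ofReal |-(2 * s)| * ENNReal.ofReal (√(E - (E - s ^ 2)))⁻¹ =
      ENNReal.ofReal 2 := fun s hs => by
    have h0 := hs.1
    rw [sub_sub_cancel, Real.sqrt_sq h0.le, abs_neg, abs_of_pos (by linarith),
      ← ENNReal.ofReal_mul (by linarith), mul_assoc, mul_inv_cancel₀ h0.ne', mul_one]
  rw [setLIntegral_congr_fun measurableSet_Ioo this, setLIntegral_const, Real.volume_Ioo, sub_zero,
    ← ENNReal.ofReal_mul two_pos.le]

namespace SurfaceOfRevolution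

variable {S : SurfaceOfRevolution} {p q : ℝ}

/-- Returns from the regularized integral to the singular one in `u`. The half appears because
`wellAngle` runs through the well forth and back, symmetrically under `x ↦ 2 π - x`. -/
theorem lintegral_wellAngle (hf : AnalyticOnNhd ℝ S.f S.chart) {W : ℝ → ℝ}
    (hW : AnalyticOnNhd ℝ W S.chart) (hp : p ∈ S.chart) (hq : q ∈ S.chart) (h : IsWell W p q) :
    ∫⁻ u in Ioo p q, ENNReal.ofReal (1 / S.f u ^ 2) * ENNReal.ofReal (√(W q - W u))⁻¹ =
      ENNReal.ofReal (S.wellAngle W p q / 2) := by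
  set I : ℝ → ℝ := fun x =>
    1 / (S.f (wellPoint p q x) ^ 2 * √(wellD W p q (wellPoint p q x))) with hI
  have hIc : Continuous I := continuous_wellAngle_integrand hf hW hp hq h
  have hsub : Icc p q ⊆ S.chart := S.ordConnected_chart.out hp hq
  have hI0 : ∀ x, 0 ≤ I x := fun x => by
    have h1 := S.f_pos_of_mem_chart (hsub (wellPoint_mem_Icc h.lt.le x))
    positivity
  have hhalf : S.wellAngle W p q / 2 = ∫ x in (0 : ℝ)..Real.pi, I x := by
    have h1 : ∫ x in (0 : ℝ)..Real.pi, I (2 * Real.pi - x) = ∫ x in Real.pi..2 * Real.pi, I x := by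
      rw [intervalIntegral.integral_comp_sub_left]
      congr 1 <;> ring
    have h2 : ∀ x, I (2 * Real.pi - x) = I x := fun x => by
      simp only [hI, wellPoint, Real.cos_two_pi_sub]
    simp only [h2] at h1
    have h3 := intervalIntegral.integral_add_adjacent_intervals (hIc.intervalIntegrable 0 Real.pi)
      (hIc.intervalIntegrable Real.pi (2 * Real.pi)) (μ := volume)
    have h4 : S.wellAngle W p q = ∫ x in (0 : ℝ)..2 * Real.pi, I x := rfl
    rw [h4, ← h3, ← h1]
    ring
  rw [hhalf, intervalIntegral.integral_of_le Real.pi_pos.le, integral_Ioc_eq_integral_Ioo,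
    ofReal_integral_eq_lintegral_ofReal
      ((hIc.integrableOn_Icc (a := 0) (b := Real.pi)).mono_set Ioo_subset_Icc_self)
      (Eventually.of_forall hI0), hI,
    ← lintegral_wellPoint h.lt fun u => ENNReal.ofReal (1 / (S.f u ^ 2 * √(wellD W p q u)))]
  refine setLIntegral_congr_fun measurableSet_Ioo fun u hu => ?_
  have hu' := Ioo_subset_Icc_self hu
  have h1 := S.f_pos_of_mem_chart (hsub hu')
  have h2 := Real.sqrt_pos.2 (h.wellD_pos hu')
  have h3 : 0 < √((u - p) * (q - u)) :=
    Real.sqrt_pos.2 (mul_pos (sub_pos.2 hu.1) (sub_pos.2 hu.2))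
  rw [← ENNReal.ofReal_mul (by positivity), ← ENNReal.ofReal_mul (by positivity),
    ← h.mul_wellD hu', Real.sqrt_mul (mul_pos (sub_pos.2 hu.1) (sub_pos.2 hu.2)).le]
  congr 1
  field_simp

/-- If the angle is the same for all energies in a well, then the width of the well is
proportional to the square root of the energy. -/
theorem width_of_wellAngle_eq (hf : AnalyticOnNhd ℝ S.f S.chart) {W : ℝ → ℝ}
    (hW : AnalyticOnNhd ℝ W S.chart) {a G : ℝ} (hp : p ∈ S.chart) (hq : q ∈ S.chart)
    (hpa : p < a) (haq : a < q) (heq : W p = W q)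
    (hanti : StrictAntiOn W (Icc p a)) (hmono : StrictMonoOn W (Icc a q)) (hG : 0 ≤ G)
    (hwell : ∀ p' ∈ Ioo p a, ∀ q' ∈ Ioo a q, W p' = W q' →
      IsWell W p' q' ∧ S.wellAngle W p' q' = G)
    {Θ : ℝ → ℝ} (hΘ : S.IsTheta Θ) :
    Real.pi * (Θ q - Θ p) = G * √(W q - W a) := by
  have hsub : Icc p q ⊆ S.chart := S.ordConnected_chart.out hp hq
  have hpq := hpa.trans haq
  have hWc : ContinuousOn W (Icc p q) := hW.continuousOn.mono hsub
  have hmE : W a < W q := hmono (left_mem_Icc.2 haq.le) (right_mem_Icc.2 haq.le) haq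
  have hρ0 : ∀ u ∈ Icc p q, 0 < 1 / S.f u ^ 2 := fun u hu => by
    have := S.f_pos_of_mem_chart (hsub hu); positivity
  have hρc : ContinuousOn (fun u => 1 / S.f u ^ 2) (Icc p q) :=
    continuousOn_const.div ((hf.continuousOn.mono hsub).pow 2) fun u hu =>
      (pow_pos (S.f_pos_of_mem_chart (hsub hu)) 2).ne'
  -- The Abel kernel `1 / √s`. Its value `0` for `s ≤ 0`, by the conventions for root and inverse,
  -- cuts off the forbidden region, so all energies can be integrated over the same interval `(p,
  -- q)`.
  set k : ℝ → ℝ≥0∞ := fun s => ENNReal.ofReal (√s)⁻¹ with hk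
  have hkm : Measurable k := (Real.continuous_sqrt.measurable.inv).ennreal_ofReal
  have hk0 : ∀ s, s ≤ 0 → k s = 0 := fun s hs => by simp [hk, Real.sqrt_eq_zero_of_nonpos hs]
  have hkey : ∀ e ∈ Ioo (W a) (W q),
      ∫⁻ u in Ioo p q, ENNReal.ofReal (1 / S.f u ^ 2) * k (e - W u) = ENNReal.ofReal (G / 2) := by
    intro e he
    obtain ⟨p', hp', hpe⟩ := intermediate_value_Ioo' hpa.le
      (hWc.mono (Icc_subset_Icc_right haq.le)) ⟨he.1, heq ▸ he.2⟩
    obtain ⟨q', hq', hqe⟩ := intermediate_value_Ioo haq.le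
      (hWc.mono (Icc_subset_Icc_left hpa.le)) he
    obtain ⟨hw, hwG⟩ := hwell p' hp' q' hq' (hpe.trans hqe.symm)
    have hp'J := hsub ⟨hp'.1.le, (hp'.2.trans haq).le⟩
    have hq'J := hsub ⟨(hpa.trans hq'.1).le, hq'.2.le⟩
    have h1 := lintegral_wellAngle hf hW hp'J hq'J hw
    rw [hwG] at h1
    rw [← h1, ← lintegral_indicator measurableSet_Ioo, ← lintegral_indicator measurableSet_Ioo]
    congr 1
    funext u
    by_cases hu : u ∈ Ioo p' q'
    · rw [indicator_of_mem hu, indicator_of_mem (Ioo_subset_Ioo hp'.1.le hq'.2.le hu), hk, hqe]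
    · rw [indicator_of_notMem hu]
      by_cases hu' : u ∈ Ioo p q
      · rw [indicator_of_mem hu']
        have : e ≤ W u := by
          rw [mem_Ioo, not_and_or, not_lt, not_lt] at hu
          rcases hu with h | h
          · rw [← hpe]
            exact hanti.antitoneOn ⟨hu'.1.le, h.trans hp'.2.le⟩ (Ioo_subset_Icc_self hp') h
          · rw [← hqe]
            exact hmono.monotoneOn (Ioo_subset_Icc_self hq') ⟨hq'.1.le.trans h, hu'.2.le⟩ h
        rw [hk0 _ (sub_nonpos.2 this), mul_zero]
      · rw [indicator_of_notMem hu']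
  have hWge : ∀ u ∈ Ioo p q, W a ≤ W u ∧ W u < W q := fun u hu => by
    rcases le_total u a with h | h
    · refine ⟨hanti.antitoneOn ⟨hu.1.le, h⟩ (right_mem_Icc.2 hpa.le) h, ?_⟩
      rw [← heq]
      exact hanti (left_mem_Icc.2 hpa.le) ⟨hu.1.le, h⟩ hu.1
    · exact ⟨hmono.monotoneOn (left_mem_Icc.2 haq.le) ⟨h, hu.2.le⟩ h,
        hmono ⟨h, hu.2.le⟩ (right_mem_Icc.2 haq.le) hu.2⟩
  have hbeta : ∀ u ∈ Ioo p q,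
      ∫⁻ e in Ioo (W a) (W q), k (W q - e) * k (e - W u) = ENNReal.ofReal Real.pi := by
    intro u hu
    obtain ⟨h1, h2⟩ := hWge u hu
    rw [← lintegral_beta h2, ← lintegral_indicator measurableSet_Ioo,
      ← lintegral_indicator measurableSet_Ioo]
    congr 1
    funext e
    by_cases he : e ∈ Ioo (W u) (W q)
    · rw [indicator_of_mem he, indicator_of_mem (Ioo_subset_Ioo_left h1 he), hk]
      simp only
      rw [← ENNReal.ofReal_mul (by positivity), Real.sqrt_mul (sub_pos.2 he.1).le, mul_inv, mul_comm]
    · rw [indicator_of_notMem he]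
      by_cases he' : e ∈ Ioo (W a) (W q)
      · rw [indicator_of_mem he']
        have : e ≤ W u := by
          by_contra hne
          exact he ⟨not_le.1 hne, he'.2⟩
        rw [hk0 _ (sub_nonpos.2 this), mul_zero]
      · rw [indicator_of_notMem he']
  have hmeas : AEMeasurable (Function.uncurry fun e u =>
      k (W q - e) * (ENNReal.ofReal (1 / S.f u ^ 2) * k (e - W u)))
      ((volume.restrict (Ioo (W a) (W q))).prod (volume.restrict (Ioo p q))) := by
    have hWm : AEMeasurable W (volume.restrict (Ioo p q)) :=
      (hWc.mono Ioo_subset_Icc_self).aemeasurable measurableSet_Ioo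
    have hρm : AEMeasurable (fun u => 1 / S.f u ^ 2) (volume.restrict (Ioo p q)) :=
      (hρc.mono Ioo_subset_Icc_self).aemeasurable measurableSet_Ioo
    have e1 : AEMeasurable (fun x : ℝ × ℝ => W x.2)
      ((volume.restrict (Ioo (W a) (W q))).prod (volume.restrict (Ioo p q))) := hWm.comp_snd
    have e2 : AEMeasurable (fun x : ℝ × ℝ => 1 / S.f x.2 ^ 2)
      ((volume.restrict (Ioo (W a) (W q))).prod (volume.restrict (Ioo p q))) := hρm.comp_snd
    exact (hkm.comp_aemeasurable (measurable_fst.const_sub _).aemeasurable).mul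
      (e2.ennreal_ofReal.mul (hkm.comp_aemeasurable (measurable_fst.aemeasurable.sub e1)))
  -- The angle identity at energy `e` is weighted with `1 / √(W q - e)` and integrated over `e`. In
  -- one order this gives `(G / 2) · 2 √(W q - W a)`; in the other the inner integral is `π` and `∫
  -- 1 / f²` remains.
  have hsw := lintegral_lintegral_swap hmeas
  have hL : ∫⁻ e in Ioo (W a) (W q), ∫⁻ u in Ioo p q,
      k (W q - e) * (ENNReal.ofReal (1 / S.f u ^ 2) * k (e - W u)) =
      ENNReal.ofReal (G * √(W q - W a)) := by
    have : ∀ e ∈ Ioo (W a) (W q), ∫⁻ u in Ioo p q,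
        k (W q - e) * (ENNReal.ofReal (1 / S.f u ^ 2) * k (e - W u)) =
        k (W q - e) * ENNReal.ofReal (G / 2) := fun e he => by
      rw [lintegral_const_mul' _ _ (by simp [hk]), hkey e he]
    rw [setLIntegral_congr_fun measurableSet_Ioo this, lintegral_mul_const' _ _ (by simp),
      lintegral_inv_sqrt hmE, ← ENNReal.ofReal_mul (by positivity)]
    congr 1; ring
  have hR : ∫⁻ u in Ioo p q, ∫⁻ e in Ioo (W a) (W q),
      k (W q - e) * (ENNReal.ofReal (1 / S.f u ^ 2) * k (e - W u)) =
      ENNReal.ofReal (Real.pi * (Θ q - Θ p)) := by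
    have : ∀ u ∈ Ioo p q, ∫⁻ e in Ioo (W a) (W q),
        k (W q - e) * (ENNReal.ofReal (1 / S.f u ^ 2) * k (e - W u)) =
        ENNReal.ofReal (1 / S.f u ^ 2) * ENNReal.ofReal Real.pi := fun u hu => by
      rw [← hbeta u hu, ← lintegral_const_mul' _ _ (by simp)]
      congr 1
      funext e
      ring
    have hint : IntervalIntegrable (fun u => 1 / S.f u ^ 2) volume p q :=
      (hρc.mono (by rw [uIcc_of_le hpq.le])).intervalIntegrable
    have hftc : ∫ u in p..q, 1 / S.f u ^ 2 = Θ q - Θ p :=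
      intervalIntegral.integral_eq_sub_of_hasDerivAt (fun u hu => hΘ u (hsub
        (by rwa [uIcc_of_le hpq.le] at hu))) hint
    rw [setLIntegral_congr_fun measurableSet_Ioo this, lintegral_mul_const' _ _ (by simp), ← hftc,
      intervalIntegral.integral_of_le hpq.le, integral_Ioc_eq_integral_Ioo, mul_comm Real.pi,
      ENNReal.ofReal_mul (setIntegral_nonneg measurableSet_Ioo fun u hu =>
        (hρ0 u (Ioo_subset_Icc_self hu)).le),
      ofReal_integral_eq_lintegral_ofReal]
    · exact (hρc.integrableOn_Icc).mono_set Ioo_subset_Icc_self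
    · refine (ae_restrict_iff' measurableSet_Ioo).2 (Eventually.of_forall fun u hu => ?_)
      exact (hρ0 u (Ioo_subset_Icc_self hu)).le
  rw [hL, hR] at hsw
  have hΘmono : Θ p ≤ Θ q := by
    have : MonotoneOn Θ (Icc p q) := by
      refine monotoneOn_of_deriv_nonneg (convex_Icc p q)
        (fun u hu => (hΘ u (hsub hu)).continuousAt.continuousWithinAt)
        (fun u hu => (hΘ u (hsub (interior_subset hu))).differentiableAt.differentiableWithinAt)
        fun u hu => ?_
      rw [(hΘ u (hsub (interior_subset hu))).deriv]
      exact (hρ0 u (interior_subset hu)).le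
    exact this (left_mem_Icc.2 hpq.le) (right_mem_Icc.2 hpq.le) hpq.le
  exact ((ENNReal.ofReal_eq_ofReal_iff (by positivity)
    (mul_nonneg Real.pi_pos.le (sub_nonneg.2 hΘmono))).1 hsw).symm

end SurfaceOfRevolution
end

/-! ### Fourth-order expansion of an isochronous well -/

open Set
open scoped ContDiff
noncomputable section

open Filter Topology MeasureTheory
open scoped ENNReal

/-- The local content of the law that the width of a well is proportional to the square root of
the energy, up to fourth order. -/
theorem taylor_coeff_of_width_law {ι : Type*} {l : Filter ι} [l.NeBot] {A B C K : ℝ} (hK : 0 < K)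
    {c h r₁ r₂ : ι → ℝ} (hh : ∀ᶠ i in l, 0 < h i) (hh0 : Tendsto h l (𝓝 0))
    (hch : ∀ᶠ i in l, |c i| ≤ h i) (hr₁ : Tendsto (fun i => r₁ i / h i ^ 4) l (𝓝 0))
    (hr₂ : Tendsto (fun i => r₂ i / h i ^ 4) l (𝓝 0))
    (h₁ : ∀ᶠ i in l, A * (c i + h i) ^ 2 + B * (c i + h i) ^ 3 + C * (c i + h i) ^ 4 + r₁ i
      = 4 * K * h i ^ 2)
    (h₂ : ∀ᶠ i in l, A * (c i - h i) ^ 2 + B * (c i - h i) ^ 3 + C * (c i - h i) ^ 4 + r₂ i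
      = 4 * K * h i ^ 2) :
    A = 4 * K ∧ 4 * A * C = 5 * B ^ 2 := by
  -- In the application `c ± h` are the two turning points measured from the bottom. Adding and
  -- subtracting the equations separates the orders in `h`.
  set s : ι → ℝ := fun i => c i / h i with hs
  set ρ₁ : ι → ℝ := fun i => r₁ i / h i ^ 4 with hρ₁
  set ρ₂ : ι → ℝ := fun i => r₂ i / h i ^ 4 with hρ₂
  have hc : ∀ᶠ i in l, c i = s i * h i ∧ r₁ i = ρ₁ i * h i ^ 4 ∧ r₂ i = ρ₂ i * h i ^ 4 := by
    filter_upwards [hh] with i hi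
    simp only [hs, hρ₁, hρ₂]
    refine ⟨?_, ?_, ?_⟩ <;> field_simp
  have hs1 : ∀ᶠ i in l, |s i| ≤ 1 := by
    filter_upwards [hh, hch] with i hi hi'
    simp only [hs]
    rw [abs_div, abs_of_pos hi]
    exact (div_le_one hi).2 hi'
  -- the sum and the difference of the two equations
  have hsum : ∀ᶠ i in l, A * (s i ^ 2 + 1) + h i * (B * (s i ^ 3 + 3 * s i)
      + h i * (C * (s i ^ 4 + 6 * s i ^ 2 + 1)) + h i * ((ρ₁ i + ρ₂ i) / 2)) = 4 * K := by
    filter_upwards [hh, hc, h₁, h₂] with i hi hc h₁ h₂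
    obtain ⟨e1, e2, e3⟩ := hc
    rw [e1, e2] at h₁
    rw [e1, e3] at h₂
    have : h i ^ 2 * (A * (s i ^ 2 + 1) + h i * (B * (s i ^ 3 + 3 * s i)
      + h i * (C * (s i ^ 4 + 6 * s i ^ 2 + 1)) + h i * ((ρ₁ i + ρ₂ i) / 2))) = h i ^ 2 * (4 * K) := by
      linear_combination h₁ / 2 + h₂ / 2
    exact mul_left_cancel₀ (pow_pos hi 2).ne' this
  have hdiff : ∀ᶠ i in l, 2 * A * s i + h i * (B * (3 * s i ^ 2 + 1)
      + h i * (C * (4 * s i ^ 3 + 4 * s i)) + h i * ((ρ₁ i - ρ₂ i) / 2)) = 0 := by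
    filter_upwards [hh, hc, h₁, h₂] with i hi hc h₁ h₂
    obtain ⟨e1, e2, e3⟩ := hc
    rw [e1, e2] at h₁
    rw [e1, e3] at h₂
    have : h i ^ 2 * (2 * A * s i + h i * (B * (3 * s i ^ 2 + 1)
      + h i * (C * (4 * s i ^ 3 + 4 * s i)) + h i * ((ρ₁ i - ρ₂ i) / 2))) = h i ^ 2 * 0 := by
      linear_combination h₁ / 2 - h₂ / 2
    exact mul_left_cancel₀ (pow_pos hi 2).ne' this
  have hbdd : ∀ {g : ℝ → ℝ}, Continuous g → ∃ M, ∀ᶠ i in l, |g (s i)| ≤ M := fun {g} hg => by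
    obtain ⟨M, hM⟩ := (isCompact_Icc (a := (-1 : ℝ)) (b := 1)).exists_bound_of_continuousOn
      hg.continuousOn
    exact ⟨M, hs1.mono fun i hi => hM _ (abs_le.1 hi)⟩
  have hsmall : ∀ {g : ℝ → ℝ}, Continuous g → Tendsto (fun i => h i * g (s i)) l (𝓝 0) :=
    fun {g} hg => by
      obtain ⟨M, hM⟩ := hbdd hg
      exact hh0.zero_mul_isBoundedUnder_le
        ⟨M, eventually_map.2 (hM.mono fun i hi => by simpa [Function.comp] using hi)⟩
  have hρs : Tendsto (fun i => (ρ₁ i + ρ₂ i) / 2) l (𝓝 0) := by simpa using (hr₁.add hr₂).div_const 2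
  have hρd : Tendsto (fun i => (ρ₁ i - ρ₂ i) / 2) l (𝓝 0) := by simpa using (hr₁.sub hr₂).div_const 2
  have hA1 : Tendsto (fun i => A * (s i ^ 2 + 1)) l (𝓝 (4 * K)) := by
    have e : Tendsto (fun i => 4 * K - (h i * (B * (s i ^ 3 + 3 * s i))
      + h i * (h i * (C * (s i ^ 4 + 6 * s i ^ 2 + 1))) + h i * (h i * ((ρ₁ i + ρ₂ i) / 2)))) l
      (𝓝 (4 * K - (0 + 0 * 0 + 0 * (0 * 0)))) :=
      tendsto_const_nhds.sub (((hsmall (g := fun x => B * (x ^ 3 + 3 * x)) (by fun_prop)).add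
        (hh0.mul (hsmall (g := fun x => C * (x ^ 4 + 6 * x ^ 2 + 1)) (by fun_prop)))).add
        (hh0.mul (hh0.mul hρs)))
    norm_num at e
    refine e.congr' ?_
    filter_upwards [hsum] with i hi
    linear_combination -hi
  -- Only `|s| ≤ 1` is known so far; the sum gives `A (s² + 1) → 4 K > 0`, hence `A ≠ 0`, and only
  -- then does the difference force `s → 0`.
  have hA0 : A ≠ 0 := by
    rintro rfl
    simp only [zero_mul] at hA1
    have := tendsto_nhds_unique hA1 tendsto_const_nhds
    linarith
  have hs0 : Tendsto s l (𝓝 0) := by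
    have e : Tendsto (fun i => -(h i * (B * (3 * s i ^ 2 + 1))
      + h i * (h i * (C * (4 * s i ^ 3 + 4 * s i))) + h i * (h i * ((ρ₁ i - ρ₂ i) / 2))) / (2 * A)) l
      (𝓝 (-(0 + 0 * 0 + 0 * (0 * 0)) / (2 * A))) :=
      ((((hsmall (g := fun x => B * (3 * x ^ 2 + 1)) (by fun_prop)).add
        (hh0.mul (hsmall (g := fun x => C * (4 * x ^ 3 + 4 * x)) (by fun_prop)))).add
        (hh0.mul (hh0.mul hρd))).neg).div_const _
    norm_num at e
    refine e.congr' ?_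
    filter_upwards [hdiff] with i hi
    rw [div_eq_iff (by simpa using hA0)]
    linear_combination -hi
  have hAK : A = 4 * K := by
    have e : Tendsto (fun i => A * (s i ^ 2 + 1)) l (𝓝 (A * (0 ^ 2 + 1))) :=
      ((hs0.pow 2).add_const 1).const_mul A
    have := tendsto_nhds_unique e hA1
    linarith
  refine ⟨hAK, ?_⟩
  -- The next order: the midpoint shift `c` is quadratic in `h`, with coefficient tending to `-B /
  -- (2 A)`.
  set σ : ι → ℝ := fun i => s i / h i with hσ
  have hsσ : ∀ᶠ i in l, s i = σ i * h i := by
    filter_upwards [hh] with i hi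
    simp only [hσ]; field_simp
  have hσ0 : Tendsto σ l (𝓝 (-B / (2 * A))) := by
    have e : Tendsto (fun i => -(B * (3 * s i ^ 2 + 1)
      + h i * (C * (4 * s i ^ 3 + 4 * s i)) + h i * ((ρ₁ i - ρ₂ i) / 2)) / (2 * A)) l
      (𝓝 (-(B * (3 * 0 ^ 2 + 1) + 0 + 0 * 0) / (2 * A))) :=
      ((((((hs0.pow 2).const_mul 3).add_const 1).const_mul B).add
        (hsmall (g := fun x => C * (4 * x ^ 3 + 4 * x)) (by fun_prop))).add
        (hh0.mul hρd)).neg.div_const _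
    have e0 : -(B * (3 * 0 ^ 2 + 1) + 0 + 0 * 0) / (2 * A) = -B / (2 * A) := by ring
    rw [e0] at e
    refine e.congr' ?_
    filter_upwards [hdiff, hh] with i hi hpos
    simp only [hσ]
    rw [div_eq_div_iff (by simpa using hA0) hpos.ne']
    linear_combination -hi
  -- After cancelling `A = 4 K`, the sum divided by `h²` tends to `A σ² + 3 B σ + C` at `σ = -B / (2
  -- A)`, that is, to `C - 5 B² / (4 A)`.
  have hfin : Tendsto (fun i => A * σ i ^ 2 + B * (σ i * s i ^ 2 + 3 * σ i)
      + C * (s i ^ 4 + 6 * s i ^ 2 + 1) + (ρ₁ i + ρ₂ i) / 2) l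
      (𝓝 (A * (-B / (2 * A)) ^ 2 + B * ((-B / (2 * A)) * 0 ^ 2 + 3 * (-B / (2 * A)))
      + C * (0 ^ 4 + 6 * 0 ^ 2 + 1) + 0)) :=
    ((((hσ0.pow 2).const_mul A).add (((hσ0.mul (hs0.pow 2)).add (hσ0.const_mul 3)).const_mul B)).add
      ((((hs0.pow 4).add ((hs0.pow 2).const_mul 6)).add_const 1).const_mul C)).add hρs
  have hzero : ∀ᶠ i in l, A * σ i ^ 2 + B * (σ i * s i ^ 2 + 3 * σ i)
      + C * (s i ^ 4 + 6 * s i ^ 2 + 1) + (ρ₁ i + ρ₂ i) / 2 = 0 := by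
    filter_upwards [hsum, hh, hsσ] with i hi hpos hsi
    rw [← hAK] at hi
    have : h i ^ 2 * (A * σ i ^ 2 + B * (σ i * s i ^ 2 + 3 * σ i)
      + C * (s i ^ 4 + 6 * s i ^ 2 + 1) + (ρ₁ i + ρ₂ i) / 2) = h i ^ 2 * 0 := by
      linear_combination hi - (A * (s i + σ i * h i) + h i * B * (s i ^ 2 + 3)) * hsi
    exact mul_left_cancel₀ (pow_pos hpos 2).ne' this
  have := tendsto_nhds_unique (hfin.congr' hzero) tendsto_const_nhds
  field_simp at this
  nlinarith [this]

namespace SurfaceOfRevolution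

variable {S : SurfaceOfRevolution}

/-- Differentiation with respect to an antiderivative of `1 / f²`. -/
def D (S : SurfaceOfRevolution) (g : ℝ → ℝ) (u : ℝ) : ℝ := S.f u ^ 2 * deriv g u

theorem analyticOnNhd_D (hf : AnalyticOnNhd ℝ S.f S.chart) {g : ℝ → ℝ}
    (hg : AnalyticOnNhd ℝ g S.chart) : AnalyticOnNhd ℝ (S.D g) S.chart :=
  fun u hu => ((hf u hu).pow 2).mul (hg.deriv u hu)

theorem hasDerivAt_of_D {g : ℝ → ℝ} (hg : AnalyticOnNhd ℝ g S.chart) {u : ℝ} (hu : u ∈ S.chart) :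
    HasDerivAt g (S.D g u / S.f u ^ 2) u := by
  refine (hg u hu).differentiableAt.hasDerivAt.congr_deriv ?_
  have := S.f_pos_of_mem_chart hu
  rw [D]; field_simp

theorem D_eq_of_hasDerivAt {g : ℝ → ℝ} {g' u : ℝ} (hu : u ∈ S.chart)
    (h : HasDerivAt g (g' / S.f u ^ 2) u) : S.D g u = g' := by
  have := S.f_pos_of_mem_chart hu
  rw [D, h.deriv]; field_simp

theorem IsTheta.strictMonoOn {Θ : ℝ → ℝ} (hΘ : S.IsTheta Θ) : StrictMonoOn Θ S.chart := by
  refine strictMonoOn_of_deriv_pos S.convex_chart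
    (fun u hu => (hΘ u hu).continuousAt.continuousWithinAt) fun u hu => ?_
  rw [S.isOpen_chart.interior_eq] at hu
  have := S.f_pos_of_mem_chart hu
  rw [(hΘ u hu).deriv]; positivity

/-- Integration of a remainder estimate in the variable `Θ`. Cauchy's mean value theorem against `Θ`
gives `g u = (Θ u - Θ a) g' ξ` with `ξ` no farther from `a` than `u`. -/
theorem IsTheta.isLittleO_integrate {Θ : ℝ → ℝ} (hΘ : S.IsTheta Θ) {a : ℝ} (ha : a ∈ S.chart)
    {g g' : ℝ → ℝ} (hg : ∀ u ∈ S.chart, HasDerivAt g (g' u / S.f u ^ 2) u) (hga : g a = 0) {n : ℕ}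
    (h : g' =o[𝓝 a] fun u => (Θ u - Θ a) ^ n) : g =o[𝓝 a] fun u => (Θ u - Θ a) ^ (n + 1) := by
  refine Asymptotics.isLittleO_iff.2 fun ε hε => ?_
  obtain ⟨δ, hδ, hb⟩ := Metric.eventually_nhds_iff_ball.1
    ((h.def hε).and (S.isOpen_chart.eventually_mem ha))
  have key : ∀ u ∈ Metric.ball a δ, u ≠ a → ∃ ξ ∈ Metric.ball a δ, |Θ ξ - Θ a| ≤ |Θ u - Θ a| ∧
      g u = (Θ u - Θ a) * g' ξ := by
    intro u hu hua
    rw [Metric.mem_ball, Real.dist_eq, abs_lt] at hu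
    have hin : ∀ x ∈ uIcc a u, x ∈ Metric.ball a δ := fun x hx => by
      rw [Metric.mem_ball, Real.dist_eq, abs_lt]
      rcases le_total a u with h' | h'
      · rw [uIcc_of_le h'] at hx; constructor <;> linarith [hx.1, hx.2]
      · rw [uIcc_of_ge h'] at hx; constructor <;> linarith [hx.1, hx.2]
    have hJ : ∀ x ∈ uIcc a u, x ∈ S.chart := fun x hx => (hb x (hin x hx)).2
    rcases lt_or_gt_of_ne hua with hlt | hlt
    · rw [uIcc_of_ge hlt.le] at hin hJ
      obtain ⟨ξ, hξ, he⟩ := exists_ratio_hasDerivAt_eq_ratio_slope g (fun u => g' u / S.f u ^ 2) hlt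
        (fun x hx => (hg x (hJ x hx)).continuousAt.continuousWithinAt)
        (fun x hx => hg x (hJ x (Ioo_subset_Icc_self hx))) Θ (fun u => 1 / S.f u ^ 2)
        (fun x hx => (hΘ x (hJ x hx)).continuousAt.continuousWithinAt)
        (fun x hx => hΘ x (hJ x (Ioo_subset_Icc_self hx)))
      have hξ' := Ioo_subset_Icc_self hξ
      have h1 := hΘ.strictMonoOn.monotoneOn (hJ ξ hξ') ha hξ.2.le
      have h2 := hΘ.strictMonoOn.monotoneOn (hJ u (left_mem_Icc.2 hlt.le)) (hJ ξ hξ') hξ.1.le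
      refine ⟨ξ, hin ξ hξ', ?_, ?_⟩
      · rw [abs_of_nonpos (by linarith), abs_of_nonpos (by linarith)]; linarith
      · have := S.f_pos_of_mem_chart (hJ ξ hξ')
        rw [hga] at he
        field_simp at he
        linarith
    · rw [uIcc_of_le hlt.le] at hin hJ
      obtain ⟨ξ, hξ, he⟩ := exists_ratio_hasDerivAt_eq_ratio_slope g (fun u => g' u / S.f u ^ 2) hlt
        (fun x hx => (hg x (hJ x hx)).continuousAt.continuousWithinAt)
        (fun x hx => hg x (hJ x (Ioo_subset_Icc_self hx))) Θ (fun u => 1 / S.f u ^ 2)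
        (fun x hx => (hΘ x (hJ x hx)).continuousAt.continuousWithinAt)
        (fun x hx => hΘ x (hJ x (Ioo_subset_Icc_self hx)))
      have hξ' := Ioo_subset_Icc_self hξ
      have h1 := hΘ.strictMonoOn.monotoneOn ha (hJ ξ hξ') hξ.1.le
      have h2 := hΘ.strictMonoOn.monotoneOn (hJ ξ hξ') (hJ u (right_mem_Icc.2 hlt.le)) hξ.2.le
      refine ⟨ξ, hin ξ hξ', ?_, ?_⟩
      · rw [abs_of_nonneg (by linarith), abs_of_nonneg (by linarith)]; linarith
      · have := S.f_pos_of_mem_chart (hJ ξ hξ')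
        rw [hga] at he
        field_simp at he
        linarith
  filter_upwards [Metric.ball_mem_nhds a hδ] with u hu
  rcases eq_or_ne u a with rfl | hua
  · simp [hga]
  obtain ⟨ξ, hξ, hle, heq⟩ := key u hu hua
  have h1 := (hb ξ hξ).1
  rw [norm_pow, Real.norm_eq_abs, Real.norm_eq_abs] at h1
  rw [heq, norm_mul, norm_pow, Real.norm_eq_abs, Real.norm_eq_abs, pow_succ]
  have h2 : |Θ ξ - Θ a| ^ n ≤ |Θ u - Θ a| ^ n := pow_le_pow_left₀ (abs_nonneg _) hle n
  calc |Θ u - Θ a| * |g' ξ| ≤ |Θ u - Θ a| * (ε * |Θ u - Θ a| ^ n) :=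
        mul_le_mul_of_nonneg_left (h1.trans (mul_le_mul_of_nonneg_left h2 hε.le)) (abs_nonneg _)
    _ = _ := by ring

/-- Taylor's formula in the variable `Θ`: continuity of the fourth derivative is the starting
remainder estimate, and four integrations follow. -/
theorem IsTheta.taylor (hf : AnalyticOnNhd ℝ S.f S.chart) {Θ : ℝ → ℝ} (hΘ : S.IsTheta Θ) {a : ℝ}
    (ha : a ∈ S.chart) {W : ℝ → ℝ} (hW : AnalyticOnNhd ℝ W S.chart) (hcrit : S.D W a = 0) :
    (fun u => W u - W a - (S.D (S.D W) a / 2 * (Θ u - Θ a) ^ 2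
      + S.D (S.D (S.D W)) a / 6 * (Θ u - Θ a) ^ 3
      + S.D (S.D (S.D (S.D W))) a / 24 * (Θ u - Θ a) ^ 4)) =o[𝓝 a] fun u => (Θ u - Θ a) ^ 4 := by
  have h1 := analyticOnNhd_D hf hW
  have h2 := analyticOnNhd_D hf h1
  have h3 := analyticOnNhd_D hf h2
  have h4 := analyticOnNhd_D hf h3
  have hy : ∀ u ∈ S.chart, HasDerivAt (fun u => Θ u - Θ a) (1 / S.f u ^ 2) u := fun u hu =>
    (hΘ u hu).sub_const _
  have s0 : (fun u => S.D (S.D (S.D (S.D W))) u - S.D (S.D (S.D (S.D W))) a) =o[𝓝 a]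
      fun u => (Θ u - Θ a) ^ 0 := by
    simp only [pow_zero]
    rw [Asymptotics.isLittleO_one_iff]
    have := (h4 a ha).continuousAt.tendsto.sub_const (S.D (S.D (S.D (S.D W))) a)
    rwa [sub_self] at this
  have s1 : (fun u => S.D (S.D (S.D W)) u - S.D (S.D (S.D W)) a
      - S.D (S.D (S.D (S.D W))) a * (Θ u - Θ a)) =o[𝓝 a] fun u => (Θ u - Θ a) ^ 1 := by
    refine hΘ.isLittleO_integrate ha (fun u hu => ?_) (by ring) s0
    refine (((hasDerivAt_of_D h3 hu).sub_const _).fun_sub ((hy u hu).const_mul _)).congr_deriv ?_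
    ring
  have s2 : (fun u => S.D (S.D W) u - S.D (S.D W) a - S.D (S.D (S.D W)) a * (Θ u - Θ a)
      - S.D (S.D (S.D (S.D W))) a / 2 * (Θ u - Θ a) ^ 2) =o[𝓝 a] fun u => (Θ u - Θ a) ^ 2 := by
    refine hΘ.isLittleO_integrate ha (fun u hu => ?_) (by ring) s1
    refine ((((hasDerivAt_of_D h2 hu).sub_const _).fun_sub ((hy u hu).const_mul _)).fun_sub
      (((hy u hu).fun_pow 2).const_mul _)).congr_deriv ?_
    push_cast; ring
  have s3 : (fun u => S.D W u - S.D (S.D W) a * (Θ u - Θ a)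
      - S.D (S.D (S.D W)) a / 2 * (Θ u - Θ a) ^ 2
      - S.D (S.D (S.D (S.D W))) a / 6 * (Θ u - Θ a) ^ 3) =o[𝓝 a] fun u => (Θ u - Θ a) ^ 3 := by
    refine hΘ.isLittleO_integrate ha (fun u hu => ?_) (by rw [hcrit]; ring) s2
    refine ((((hasDerivAt_of_D h1 hu).fun_sub ((hy u hu).const_mul _)).fun_sub
      (((hy u hu).fun_pow 2).const_mul _)).fun_sub
      (((hy u hu).fun_pow 3).const_mul _)).congr_deriv ?_
    push_cast; ring
  refine hΘ.isLittleO_integrate ha (fun u hu => ?_) (by ring) s3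
  refine (((hasDerivAt_of_D hW hu).sub_const _).fun_sub (((((hy u hu).fun_pow 2).const_mul _).fun_add
      (((hy u hu).fun_pow 3).const_mul _)).fun_add
      (((hy u hu).fun_pow 4).const_mul _))).congr_deriv ?_
  push_cast; ring

/-- The conditions on the derivatives of an isochronous well at its bottom. -/
theorem isochronous_conditions (hf : AnalyticOnNhd ℝ S.f S.chart) {W : ℝ → ℝ}
    (hW : AnalyticOnNhd ℝ W S.chart) {p a q G : ℝ} (hp : p ∈ S.chart) (hq : q ∈ S.chart)
    (hpa : p < a) (haq : a < q) (hanti : StrictAntiOn W (Icc p a))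
    (hmono : StrictMonoOn W (Icc a q)) (hcrit : deriv W a = 0) (hG : 0 < G)
    (hwell : ∀ p' ∈ Ioo p a, ∀ q' ∈ Ioo a q, W p' = W q' →
      IsWell W p' q' ∧ S.wellAngle W p' q' = G) :
    S.D (S.D W) a = 8 * (Real.pi / G) ^ 2 ∧
      3 * S.D (S.D W) a * S.D (S.D (S.D (S.D W))) a = 5 * S.D (S.D (S.D W)) a ^ 2 := by
  obtain ⟨Θ, hΘ⟩ := S.exists_isTheta hf.continuousOn
  have hsub : Icc p q ⊆ S.chart := S.ordConnected_chart.out hp hq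
  have ha : a ∈ S.chart := hsub ⟨hpa.le, haq.le⟩
  have hWc : ContinuousOn W (Icc p q) := hW.continuousOn.mono hsub
  have hWp : W a < W p := hanti (left_mem_Icc.2 hpa.le) (right_mem_Icc.2 hpa.le) hpa
  have hev : ∀ᶠ q' in 𝓝[>] a, q' ∈ Ioo a q ∧ W q' < W p := by
    filter_upwards [Ioo_mem_nhdsGT haq,
      nhdsWithin_le_nhds ((hW a ha).continuousAt.eventually_lt_const hWp)] with q' h1 h2
    exact ⟨h1, h2⟩
  -- The left turning point at the height of `q'`. The value `0` for unsuitable `q'` plays no role,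
  -- as only `q'` close to `a` matter.
  have hex : ∀ q', ∃ p', q' ∈ Ioo a q ∧ W q' < W p → p' ∈ Ioo p a ∧ W p' = W q' := by
    intro q'
    by_cases h : q' ∈ Ioo a q ∧ W q' < W p
    · have h1 : W a < W q' := hmono (left_mem_Icc.2 haq.le) (Ioo_subset_Icc_self h.1) h.1.1
      obtain ⟨p', hp', he⟩ := intermediate_value_Ioo' hpa.le
        (hWc.mono (Icc_subset_Icc_right haq.le)) ⟨h1, h.2⟩
      exact ⟨p', fun _ => ⟨hp', he⟩⟩
    · exact ⟨0, fun h' => absurd h' h⟩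
  choose P hP using hex
  have hPa : Tendsto P (𝓝[>] a) (𝓝 a) := by
    refine tendsto_order.2 ⟨fun b hb => ?_, fun b hb => ?_⟩
    · rcases lt_or_ge b p with h | h
      · filter_upwards [hev] with q' hq'
        exact h.trans (hP q' hq').1.1
      · have h1 : W a < W b := hanti ⟨h, hb.le⟩ (right_mem_Icc.2 hpa.le) hb
        filter_upwards [hev,
          nhdsWithin_le_nhds ((hW a ha).continuousAt.eventually_lt_const h1)] with q' hq' h2
        obtain ⟨h3, h4⟩ := hP q' hq'
        by_contra hneg
        have := hanti.antitoneOn (Ioo_subset_Icc_self h3) ⟨h, hb.le⟩ (not_lt.1 hneg)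
        linarith
    · filter_upwards [hev] with q' hq'
      exact (hP q' hq').1.2.trans hb
  have hK : 0 < (Real.pi / G) ^ 2 := by positivity
  set A := S.D (S.D W) a / 2 with hA
  set B := S.D (S.D (S.D W)) a / 6 with hB
  set C := S.D (S.D (S.D (S.D W))) a / 24 with hC
  set R : ℝ → ℝ := fun u => W u - W a - (A * (Θ u - Θ a) ^ 2 + B * (Θ u - Θ a) ^ 3
      + C * (Θ u - Θ a) ^ 4) with hR
  have hRo : R =o[𝓝 a] fun u => (Θ u - Θ a) ^ 4 :=
    hΘ.taylor hf ha hW (by rw [D, hcrit, mul_zero])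
  -- Half the width of the well in `Θ`, and next the displacement of its midpoint from the bottom.
  set h : ℝ → ℝ := fun q' => (Θ q' - Θ (P q')) / 2 with hh
  set c : ℝ → ℝ := fun q' => (Θ q' + Θ (P q')) / 2 - Θ a with hc
  have hΘc : ContinuousAt Θ a := (hΘ a ha).continuousAt
  have hid : Tendsto (fun q' : ℝ => q') (𝓝[>] a) (𝓝 a) := nhdsWithin_le_nhds
  have hord : ∀ᶠ q' in 𝓝[>] a, Θ (P q') < Θ a ∧ Θ a < Θ q' := by
    filter_upwards [hev] with q' hq'
    have h1 := (hP q' hq').1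
    exact ⟨hΘ.strictMonoOn (hsub ⟨h1.1.le, (h1.2.trans haq).le⟩) ha h1.2,
      hΘ.strictMonoOn ha (hsub ⟨(hpa.trans hq'.1.1).le, hq'.1.2.le⟩) hq'.1.1⟩
  have hbig1 : (fun q' => (Θ q' - Θ a) ^ 4) =O[𝓝[>] a] fun q' => h q' ^ 4 := by
    refine Asymptotics.IsBigO.pow (Asymptotics.IsBigO.of_bound 2 ?_) 4
    filter_upwards [hord] with q' hq'
    rw [Real.norm_eq_abs, Real.norm_eq_abs, abs_of_pos (by linarith), abs_of_pos (by
      simp only [hh]; linarith)]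
    simp only [hh]; linarith
  have hbig2 : (fun q' => (Θ (P q') - Θ a) ^ 4) =O[𝓝[>] a] fun q' => h q' ^ 4 := by
    refine Asymptotics.IsBigO.pow (Asymptotics.IsBigO.of_bound 2 ?_) 4
    filter_upwards [hord] with q' hq'
    rw [Real.norm_eq_abs, Real.norm_eq_abs, abs_of_neg (by linarith), abs_of_pos (by
      simp only [hh]; linarith)]
    simp only [hh]; linarith
  have hlaw : ∀ᶠ q' in 𝓝[>] a, W q' - W a = 4 * (Real.pi / G) ^ 2 * h q' ^ 2 ∧
      W (P q') - W a = 4 * (Real.pi / G) ^ 2 * h q' ^ 2 := by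
    filter_upwards [hev] with q' hq'
    obtain ⟨h1, h2⟩ := hP q' hq'
    have hq1 := hq'.1
    have hmE : W a < W q' := hmono (left_mem_Icc.2 haq.le) (Ioo_subset_Icc_self hq1) hq1.1
    have h3 := width_of_wellAngle_eq hf hW (hsub ⟨h1.1.le, (h1.2.trans haq).le⟩)
      (hsub ⟨(hpa.trans hq1.1).le, hq1.2.le⟩) h1.2 hq1.1 h2
      (hanti.mono (Icc_subset_Icc_left h1.1.le)) (hmono.mono (Icc_subset_Icc_right hq1.2.le)) hG.le
      (fun p' hp' q'' hq'' => hwell p' ⟨h1.1.trans hp'.1, hp'.2⟩ q'' ⟨hq''.1, hq''.2.trans hq1.2⟩)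
      hΘ
    have h4 : W q' - W a = 4 * (Real.pi / G) ^ 2 * h q' ^ 2 := by
      have h5 : √(W q' - W a) = Real.pi * (Θ q' - Θ (P q')) / G := by
        rw [h3]; field_simp
      rw [← Real.sq_sqrt (sub_pos.2 hmE).le, h5]
      simp only [hh]; ring
    exact ⟨h4, by rw [h2, h4]⟩
  obtain ⟨e1, e2⟩ := taylor_coeff_of_width_law (l := 𝓝[>] a) (A := A) (B := B) (C := C) hK
    (c := c) (h := h) (r₁ := fun q' => R q') (r₂ := fun q' => R (P q'))
    (by filter_upwards [hord] with q' hq'; simp only [hh]; linarith)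
    (by
      have := ((hΘc.tendsto.comp hid).sub (hΘc.tendsto.comp hPa)).div_const 2
      simpa [hh, Function.comp_def] using this)
    (by
      filter_upwards [hord] with q' hq'
      simp only [hh, hc]
      rw [abs_le]
      constructor <;> linarith)
    ((hRo.comp_tendsto hid).trans_isBigO hbig1).tendsto_div_nhds_zero
    ((hRo.comp_tendsto hPa).trans_isBigO hbig2).tendsto_div_nhds_zero
    (by
      filter_upwards [hlaw] with q' hq'
      have : c q' + h q' = Θ q' - Θ a := by simp only [hh, hc]; ring
      rw [← hq'.1, this]
      simp only [hR]; ring)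
    (by
      filter_upwards [hlaw] with q' hq'
      have : c q' - h q' = Θ (P q') - Θ a := by simp only [hh, hc]; ring
      rw [← hq'.2, this]
      simp only [hR]; ring)
  constructor
  · rw [hA] at e1; linarith
  · rw [hA, hB, hC] at e2; linarith

end SurfaceOfRevolution
end

/-! ### Differential equations for the potential and their solution -/

open Set
open scoped ContDiff
noncomputable section

open Filter Topology

namespace SurfaceOfRevolution

variable {S : SurfaceOfRevolution} {m : ℝ} {V : ℝ → ℝ}

theorem eqOn_D {g k : ℝ → ℝ} (h : EqOn g k S.chart) : EqOn (S.D g) (S.D k) S.chart := fun u hu => by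
  have : g =ᶠ[𝓝 u] k := by
    filter_upwards [S.chart_mem_nhds hu] with w hw using h hw
  rw [D, D, this.deriv_eq]

theorem D_add_const_mul {g k : ℝ → ℝ} (hg : AnalyticOnNhd ℝ g S.chart)
    (hk : AnalyticOnNhd ℝ k S.chart) (μ : ℝ) :
    EqOn (S.D fun u => g u + μ * k u) (fun u => S.D g u + μ * S.D k u) S.chart := fun u hu => by
  refine D_eq_of_hasDerivAt hu (((hasDerivAt_of_D hg hu).fun_add
    ((hasDerivAt_of_D hk hu).const_mul μ)).congr_deriv ?_)
  ring

theorem D_F (hf : AnalyticOnNhd ℝ S.f S.chart) {u : ℝ} (hu : u ∈ S.chart) :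
    S.D S.F u = -(deriv S.f u / S.f u) := by
  have := S.f_pos_of_mem_chart hu
  rw [D, (hasDerivAt_F hf hu).deriv]
  field_simp

/-- The role of `h`: in the variable `Θ` it is minus the derivative of `f' / f`, and therefore the
second derivative of `F`. -/
theorem hasDerivAt_logDeriv (hf : AnalyticOnNhd ℝ S.f S.chart) {u : ℝ} (hu : u ∈ S.chart) :
    HasDerivAt (fun u => deriv S.f u / S.f u) (-(S.h u / S.f u ^ 2)) u := by
  have hp := S.f_pos_of_mem_chart hu
  have h1 := (hf.deriv u hu).differentiableAt.hasDerivAt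
  refine (h1.fun_div (hasDerivAt_f hf hu) hp.ne').congr_deriv ?_
  have e : iteratedDeriv 2 S.f u = deriv (deriv S.f) u := by
    rw [iteratedDeriv_succ, iteratedDeriv_one]
  rw [h, e]
  field_simp
  ring

theorem D_D_F (hf : AnalyticOnNhd ℝ S.f S.chart) {u : ℝ} (hu : u ∈ S.chart) :
    S.D (S.D S.F) u = S.h u := by
  have h1 : EqOn (S.D S.F) (fun u => -(deriv S.f u / S.f u)) S.chart := fun v hv => D_F hf hv
  rw [eqOn_D h1 hu]
  refine D_eq_of_hasDerivAt hu ((hasDerivAt_logDeriv hf hu).fun_neg.congr_deriv ?_)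
  ring

theorem eqOn_chart_of_eqOn_Ioo {c d : ℝ} (hcd : c < d) (hJ : Ioo c d ⊆ S.chart) {g k : ℝ → ℝ}
    (hg : AnalyticOnNhd ℝ g S.chart) (hk : AnalyticOnNhd ℝ k S.chart)
    (h : ∀ u ∈ Ioo c d, g u = k u) : ∀ u ∈ S.chart, g u = k u := by
  obtain ⟨a, ha⟩ := nonempty_Ioo.2 hcd
  refine fun u hu => hg.eqOn_of_preconnected_of_eventuallyEq hk S.isPreconnected_chart (hJ ha) ?_ hu
  filter_upwards [Ioo_mem_nhds ha.1 ha.2] with w hw using h w hw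

theorem eq_of_hasDerivAt_zero {g : ℝ → ℝ} (h : ∀ u ∈ S.chart, HasDerivAt g 0 u) {u v : ℝ}
    (hu : u ∈ S.chart) (hv : v ∈ S.chart) : g u = g v :=
  S.isOpen_chart.is_const_of_deriv_eq_zero S.isPreconnected_chart
    (fun w hw => (h w hw).differentiableAt.differentiableWithinAt) (fun w hw => (h w hw).deriv) hu hv

/-- The first derivative of the potential with respect to `Θ` and the curvature of the isochronous
wells determine a differential equation for the potential. -/
theorem IsClosedOrbitPotential.differential_equations (hf : AnalyticOnNhd ℝ S.f S.chart)
    (hm : 0 < m) (hV : S.IsClosedOrbitPotential m V) :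
    ∃ b : ℚ, 0 < b ∧ (∃ c d, c < d ∧ Ioo c d ⊆ S.chart ∧
      ∀ u ∈ Ioo c d, 0 < S.D V u * deriv S.f u) ∧
      (∀ u ∈ S.chart, S.D (S.D V) u * S.D S.F u - S.D V u * S.D (S.D S.F) u
        = -((b : ℝ) ^ 2 * S.D V u)) ∧
      ∀ u ∈ S.chart, 3 * S.D V u * S.D (S.D (S.D V)) u = 4 * S.D (S.D V) u ^ 2 := by
  obtain ⟨c, d, hcd, hJ, hint⟩ := hV.exists_interval hf hm
  obtain ⟨r, hr, hang⟩ := hV.exists_angle_eq hf hm hcd hJ hint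
  have hVa := hV.central.analytic
  have hFa := analyticOnNhd_F hf
  have v1 := analyticOnNhd_D hf hVa
  have v2 := analyticOnNhd_D hf v1
  have v3 := analyticOnNhd_D hf v2
  have f1 := analyticOnNhd_D hf hFa
  have f2 := analyticOnNhd_D hf f1
  have f3 := analyticOnNhd_D hf f2
  have hr' : (0 : ℝ) < r := by exact_mod_cast hr
  have hb0 : (0 : ℝ) < (r : ℝ)⁻¹ := by positivity
  -- the isochronous conditions at every position in the interval
  have hiso : ∀ a ∈ Ioo c d, ∃ μ, 0 < μ ∧ S.D V a + μ * S.D S.F a = 0 ∧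
      S.D (S.D V) a + μ * S.D (S.D S.F) a = ((r : ℝ)⁻¹) ^ 2 * μ ∧
      3 * (S.D (S.D V) a + μ * S.D (S.D S.F) a) *
        (S.D (S.D (S.D (S.D V))) a + μ * S.D (S.D (S.D (S.D S.F))) a) =
        5 * (S.D (S.D (S.D V)) a + μ * S.D (S.D (S.D S.F)) a) ^ 2 := by
    intro a ha
    obtain ⟨hFn, hμ⟩ := hint a ha
    set μ := -(deriv V a / deriv S.F a) with hμd
    have haJ := hJ ha
    have hWa := analyticOnNhd_effPot hf hVa μ
    have hcrit : deriv (S.effPot V μ) a = 0 := by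
      rw [deriv_effPot hf hVa μ haJ, hμd]; field_simp; ring
    obtain ⟨p, hcp, hpa⟩ := exists_between ha.1
    obtain ⟨q, haq, hqd⟩ := exists_between ha.2
    have hp : p ∈ Ioo c d := ⟨hcp, hpa.trans ha.2⟩
    have hq : q ∈ Ioo c d := ⟨ha.1.trans haq, hqd⟩
    have hn := hV.nonconstPot hf hm μ
    have hs : 0 < √(μ / 2) := Real.sqrt_pos.2 (half_pos hμ)
    -- The value of `G` comes from `√(μ / 2) G = 2 π r`. It makes `8 (π / G)²` equal to `μ / r²`,
    -- whence `b = 1 / r`.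
    obtain ⟨h1, h2⟩ := isochronous_conditions hf hWa (hJ hp) (hJ hq) hpa haq
      (hV.strictAntiOn_left hf hm hμ.le hn haJ hcrit (hJ hp))
      (hV.strictMonoOn_right hf hm hμ.le hn haJ hcrit (hJ hq)) hcrit
      (G := 2 * Real.pi * r / √(μ / 2)) (by positivity) fun p' hp' q' hq' he => by
        obtain ⟨-, e1, e2⟩ := hang μ p' q' ⟨hcp.trans hp'.1, hp'.2.trans ha.2⟩
          ⟨ha.1.trans hq'.1, hq'.2.trans hqd⟩ (hp'.2.trans hq'.1) he
        refine ⟨e1, ?_⟩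
        rw [← e2]; field_simp
    have d1 : EqOn (S.D (S.effPot V μ)) (fun u => S.D V u + μ * S.D S.F u) S.chart :=
      D_add_const_mul hVa hFa μ
    have d2 : EqOn (S.D (S.D (S.effPot V μ)))
        (fun u => S.D (S.D V) u + μ * S.D (S.D S.F) u) S.chart :=
      (eqOn_D d1).trans (D_add_const_mul v1 f1 μ)
    have d3 : EqOn (S.D (S.D (S.D (S.effPot V μ))))
        (fun u => S.D (S.D (S.D V)) u + μ * S.D (S.D (S.D S.F)) u) S.chart :=
      (eqOn_D d2).trans (D_add_const_mul v2 f2 μ)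
    have d4 : EqOn (S.D (S.D (S.D (S.D (S.effPot V μ)))))
        (fun u => S.D (S.D (S.D (S.D V))) u + μ * S.D (S.D (S.D (S.D S.F))) u) S.chart :=
      (eqOn_D d3).trans (D_add_const_mul v3 f3 μ)
    replace d1 := d1 haJ
    replace d2 := d2 haJ
    replace d3 := d3 haJ
    replace d4 := d4 haJ
    dsimp only at d1 d2 d3 d4
    refine ⟨μ, hμ, ?_, ?_, ?_⟩
    · rw [← d1, D, hcrit, mul_zero]
    · rw [← d2, h1]
      have e : (Real.pi / (2 * Real.pi * r / √(μ / 2))) ^ 2 = √(μ / 2) ^ 2 / (4 * r ^ 2) := by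
        have := Real.pi_pos
        field_simp
        ring
      rw [e, Real.sq_sqrt (by positivity)]
      field_simp
      ring
    · rw [← d2, ← d3, ← d4]; exact h2
  have R1 : ∀ u ∈ S.chart, S.D (S.D V) u * S.D S.F u - S.D V u * S.D (S.D S.F) u
      = -(((r : ℝ)⁻¹) ^ 2 * S.D V u) := by
    refine eqOn_chart_of_eqOn_Ioo hcd hJ ((v2.mul f1).sub (v1.mul f2))
      ((analyticOnNhd_const.mul v1).neg) fun u hu => ?_
    obtain ⟨μ, hμ, e1, e2, -⟩ := hiso u hu
    linear_combination S.D S.F u * e2 + (-S.D (S.D S.F) u + ((r : ℝ)⁻¹) ^ 2) * e1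
  -- The strength `μ` varies with the position, so higher relations come from differentiating the
  -- relation from which `μ` has been eliminated.
  have R1' : ∀ u ∈ S.chart, S.D (S.D (S.D V)) u * S.D S.F u - S.D V u * S.D (S.D (S.D S.F)) u
      = -(((r : ℝ)⁻¹) ^ 2 * S.D (S.D V) u) := by
    intro u hu
    have hd1 := ((hasDerivAt_of_D v2 hu).fun_mul (hasDerivAt_of_D f1 hu)).fun_sub
      ((hasDerivAt_of_D v1 hu).fun_mul (hasDerivAt_of_D f2 hu))
    have hd2 := ((hasDerivAt_of_D v1 hu).const_mul (((r : ℝ)⁻¹) ^ 2)).fun_neg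
    have heq : (fun u => S.D (S.D V) u * S.D S.F u - S.D V u * S.D (S.D S.F) u) =ᶠ[𝓝 u]
        fun u => -(((r : ℝ)⁻¹) ^ 2 * S.D V u) := by
      filter_upwards [S.chart_mem_nhds hu] with w hw using R1 w hw
    have := (hd1.congr_of_eventuallyEq heq.symm).unique hd2
    have hp := S.f_pos_of_mem_chart hu
    field_simp at this ⊢
    linarith
  have R1'' : ∀ u ∈ S.chart, S.D (S.D (S.D (S.D V))) u * S.D S.F u
      + S.D (S.D (S.D V)) u * S.D (S.D S.F) u - S.D (S.D V) u * S.D (S.D (S.D S.F)) u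
      - S.D V u * S.D (S.D (S.D (S.D S.F))) u = -(((r : ℝ)⁻¹) ^ 2 * S.D (S.D (S.D V)) u) := by
    intro u hu
    have hd1 := ((hasDerivAt_of_D v3 hu).fun_mul (hasDerivAt_of_D f1 hu)).fun_sub
      ((hasDerivAt_of_D v1 hu).fun_mul (hasDerivAt_of_D f3 hu))
    have hd2 := ((hasDerivAt_of_D v2 hu).const_mul (((r : ℝ)⁻¹) ^ 2)).fun_neg
    have heq : (fun u => S.D (S.D (S.D V)) u * S.D S.F u - S.D V u * S.D (S.D (S.D S.F)) u) =ᶠ[𝓝 u]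
        fun u => -(((r : ℝ)⁻¹) ^ 2 * S.D (S.D V) u) := by
      filter_upwards [S.chart_mem_nhds hu] with w hw using R1' w hw
    have := (hd1.congr_of_eventuallyEq heq.symm).unique hd2
    have hp := S.f_pos_of_mem_chart hu
    field_simp at this ⊢
    linarith
  have hDF : ∀ u ∈ Ioo c d, S.D S.F u ≠ 0 := fun u hu =>
    mul_ne_zero (pow_pos (S.f_pos_of_mem_chart (hJ hu)) 2).ne' (hint u hu).1
  refine ⟨r⁻¹, inv_pos.2 hr, ⟨c, d, hcd, hJ, fun u hu => ?_⟩, ?_, ?_⟩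
  · obtain ⟨μ, hμ, e1, -⟩ := hiso u hu
    have hp := S.f_pos_of_mem_chart (hJ hu)
    have hF := hDF u hu
    rw [D_F hf (hJ hu)] at e1 hF
    have hf' : deriv S.f u ≠ 0 := fun h => hF (by rw [h]; simp)
    have : S.D V u = μ * (deriv S.f u / S.f u) := by linarith
    rw [this]
    have h2 : μ * (deriv S.f u / S.f u) * deriv S.f u = μ * deriv S.f u ^ 2 / S.f u := by ring
    rw [h2]
    positivity
  · push_cast
    exact R1
  · refine eqOn_chart_of_eqOn_Ioo hcd hJ ((analyticOnNhd_const.mul v1).mul v3)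
      (analyticOnNhd_const.mul (v2.pow 2)) fun u hu => ?_
    obtain ⟨μ, hμ, e1, e2, e3⟩ := hiso u hu
    have huJ := hJ hu
    have r0 := R1 u huJ
    have r1 := R1' u huJ
    have r2 := R1'' u huJ
    have hF := hDF u hu
    set V1 := S.D V u
    set V2 := S.D (S.D V) u
    set V3 := S.D (S.D (S.D V)) u
    set V4 := S.D (S.D (S.D (S.D V))) u
    set F1 := S.D S.F u
    set F2 := S.D (S.D S.F) u
    set F3 := S.D (S.D (S.D S.F)) u
    set F4 := S.D (S.D (S.D (S.D S.F))) u
    set B := ((r : ℝ)⁻¹) ^ 2 with hB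
    have hB0 : 0 < B := by positivity
    have hV1 : V1 = -(μ * F1) := by linarith
    -- eliminate the derivatives of `F`
    have w3 : F1 * (V3 + μ * F3) = -(B * V2) := by
      linear_combination r1 + F3 * e1
    have w4 : F1 * (V4 + μ * F4) = -(B * V3) - V3 * F2 + V2 * F3 := by
      linear_combination r2 + F4 * e1
    have w5 : F1 ^ 2 * (3 * (B * μ) * (V4 + μ * F4)) = F1 ^ 2 * (5 * (V3 + μ * F3) ^ 2) := by
      rw [← e2, e3]
    have w6 : -3 * B * V1 * (-(B * V3) - V3 * F2 + V2 * F3) = 5 * B ^ 2 * V2 ^ 2 := by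
      have a1 : F1 ^ 2 * (3 * (B * μ) * (V4 + μ * F4)) =
          3 * B * (μ * F1) * (F1 * (V4 + μ * F4)) := by ring
      have a2 : F1 ^ 2 * (5 * (V3 + μ * F3) ^ 2) = 5 * (F1 * (V3 + μ * F3)) ^ 2 := by ring
      rw [a1, a2, w3, w4] at w5
      rw [hV1]
      linear_combination w5
    -- Substituting `V1 F2` and `V1 F3` from the first relation and its derivative makes every
    -- derivative of `F` drop out.
    have w7 : B ^ 2 * (3 * V1 * V3) = B ^ 2 * (4 * V2 ^ 2) := by
      linear_combination w6 / 2 - 3 / 2 * B * V2 * r1 + 3 / 2 * B * V3 * r0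
    exact mul_left_cancel₀ (by positivity) w7

/-- The two types of potentials with the closed orbit property. -/
theorem IsClosedOrbitPotential.classification (hf : AnalyticOnNhd ℝ S.f S.chart)
    (hm : 0 < m) (hV : S.IsClosedOrbitPotential m V) :
    ∃ b : ℚ, 0 < b ∧
      ((∃ a : ℝ, a ≠ 0 ∧ (∀ u ∈ S.chart, S.D V u = a) ∧
          (∀ u ∈ S.chart, S.h u = (b : ℝ) ^ 2) ∧ ∃ u ∈ S.chart, 0 < a * deriv S.f u) ∨
        ∃ (k c : ℝ) (y : ℝ → ℝ), k ≠ 0 ∧ S.IsTheta y ∧ (∀ u ∈ S.chart, y u ≠ 0) ∧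
          (∀ u ∈ S.chart, V u = k / y u ^ 2 + c) ∧
          (∀ u ∈ S.chart, y u * (S.h u - (b : ℝ) ^ 2) = 3 * (deriv S.f u / S.f u)) ∧
          ∃ u ∈ S.chart, k * y u * deriv S.f u < 0) := by
  obtain ⟨b, hb, ⟨c, d, hcd, hJ, hpos⟩, R1, R2⟩ := hV.differential_equations hf hm
  have hVa := hV.central.analytic
  have v1 := analyticOnNhd_D hf hVa
  have v2 := analyticOnNhd_D hf v1
  have v3 := analyticOnNhd_D hf v2
  obtain ⟨u₀, hu₀⟩ := nonempty_Ioo.2 hcd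
  have hu₀J := hJ hu₀
  have hV1 : ∀ u ∈ Ioo c d, S.D V u ≠ 0 := fun u hu h => by
    have := hpos u hu; rw [h] at this; simp at this
  refine ⟨b, hb, ?_⟩
  -- A first integral of `3 V₁ V₃ = 4 V₂²`, where `Vᵢ` is the `i`-th derivative of `V` in `Θ`.
  -- Whether it vanishes separates the two types.
  set C := S.D (S.D V) u₀ ^ 3 / S.D V u₀ ^ 4 with hC
  have R3 : ∀ u ∈ S.chart, S.D (S.D V) u ^ 3 = C * S.D V u ^ 4 := by
    refine eqOn_chart_of_eqOn_Ioo hcd hJ (v2.pow 3) (analyticOnNhd_const.mul (v1.pow 4))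
      fun u hu => ?_
    have hd : ∀ w ∈ Ioo c d, HasDerivAt (fun w => S.D (S.D V) w ^ 3 / S.D V w ^ 4) 0 w := by
      intro w hw
      have hw1 := hV1 w hw
      refine (((hasDerivAt_of_D v2 (hJ hw)).fun_pow 3).fun_div
        ((hasDerivAt_of_D v1 (hJ hw)).fun_pow 4) (pow_ne_zero 4 hw1)).congr_deriv ?_
      have hp := S.f_pos_of_mem_chart (hJ hw)
      have := R2 w (hJ hw)
      push_cast
      rw [div_eq_zero_iff]
      left
      field_simp
      linear_combination (S.D (S.D V) w ^ 2 * S.D V w ^ 3) * this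
    have := isOpen_Ioo.is_const_of_deriv_eq_zero isPreconnected_Ioo
      (fun w hw => (hd w hw).differentiableAt.differentiableWithinAt)
      (fun w hw => (hd w hw).deriv) hu hu₀
    have hu1 := hV1 u hu
    rw [hC, ← this]
    field_simp
  rcases eq_or_ne C 0 with hC0 | hC0
  · left
    have h2 : ∀ u ∈ S.chart, S.D (S.D V) u = 0 := fun u hu => by
      have := R3 u hu
      rw [hC0, zero_mul] at this
      exact pow_eq_zero_iff (three_ne_zero) |>.1 this
    have hconst : ∀ u ∈ S.chart, S.D V u = S.D V u₀ := fun u hu =>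
      eq_of_hasDerivAt_zero (fun w hw => by
        have := hasDerivAt_of_D v1 hw
        rwa [h2 w hw, zero_div] at this) hu hu₀J
    refine ⟨S.D V u₀, hV1 u₀ hu₀, hconst, fun u hu => ?_, u₀, hu₀J, hpos u₀ hu₀⟩
    have := R1 u hu
    rw [h2 u hu, D_D_F hf hu, hconst u hu] at this
    exact mul_left_cancel₀ (hV1 u₀ hu₀) (by linarith)
  · right
    -- At a zero of `V₁` the first integral gives `|V₂| ≤ L |V₁|` nearby, so by Gronwall `V₁`
    -- vanishes on an interval and then, by analyticity, everywhere.
    have hne : ∀ u ∈ S.chart, S.D V u ≠ 0 := by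
      intro u hu h0
      obtain ⟨w, hw⟩ : ∃ w, u < w ∧ Icc u w ⊆ S.chart := by
        obtain ⟨ε, hε, hsub⟩ := Metric.isOpen_iff.1 S.isOpen_chart u hu
        refine ⟨u + ε / 2, by linarith, fun x hx => hsub ?_⟩
        rw [Metric.mem_ball, Real.dist_eq, abs_of_nonneg (by linarith [hx.1])]
        linarith [hx.2]
      obtain ⟨M, hM⟩ := isCompact_Icc.exists_bound_of_continuousOn (v1.continuousOn.mono hw.2)
      have hρc : ContinuousOn (fun u => 1 / S.f u ^ 2) (Icc u w) :=
        continuousOn_const.div ((hf.continuousOn.mono hw.2).pow 2) fun x hx =>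
          (pow_pos (S.f_pos_of_mem_chart (hw.2 hx)) 2).ne'
      obtain ⟨N, hN⟩ := isCompact_Icc.exists_bound_of_continuousOn hρc
      -- The estimate holds for cubes; `L ≥ 1` ensures `L ≤ L³`, so that cube roots can be taken.
      set L := max 1 (|C| * M) with hL
      have hL1 : 1 ≤ L := le_max_left _ _
      have hbound : ∀ x ∈ Icc u w, |S.D (S.D V) x| ≤ L * |S.D V x| := fun x hx => by
        have h1 : |S.D (S.D V) x| ^ 3 = |C| * |S.D V x| * |S.D V x| ^ 3 := by
          rw [← abs_pow, R3 x (hw.2 hx), abs_mul, abs_pow]; ring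
        have h2 : |C| * |S.D V x| ≤ L :=
          (mul_le_mul_of_nonneg_left (hM x hx) (abs_nonneg C)).trans (le_max_right _ _)
        have h3 : L ≤ L ^ 3 := le_self_pow₀ hL1 three_ne_zero
        refine le_of_pow_le_pow_left₀ three_ne_zero (by positivity) ?_
        rw [h1, mul_pow]
        exact mul_le_mul_of_nonneg_right (h2.trans h3) (by positivity)
      have hz := eq_zero_of_abs_deriv_le_mul_abs_self_of_eq_zero_right (f := S.D V)
        (f' := fun x => S.D (S.D V) x / S.f x ^ 2) (K := N * L) (a := u) (b := w)
        (v1.continuousOn.mono hw.2)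
        (fun x hx => (hasDerivAt_of_D v1 (hw.2 (Ico_subset_Icc_self hx))).hasDerivWithinAt) h0
        (fun x hx => by
          have hx' := Ico_subset_Icc_self hx
          have h1 := hN x hx'
          rw [Real.norm_eq_abs] at h1
          rw [Real.norm_eq_abs, Real.norm_eq_abs, div_eq_mul_one_div, abs_mul, mul_comm, mul_assoc]
          exact mul_le_mul h1 (hbound x hx') (abs_nonneg _) ((abs_nonneg _).trans h1))
      have := eqOn_chart_of_eqOn_Ioo hw.1 (Ioo_subset_Icc_self.trans hw.2) v1
        (analyticOnNhd_const (v := 0)) (fun x hx => hz x (Ioo_subset_Icc_self hx)) u₀ hu₀J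
      exact hV1 u₀ hu₀ this
    have hne2 : ∀ u ∈ S.chart, S.D (S.D V) u ≠ 0 := fun u hu h => by
      have := R3 u hu
      rw [h, zero_pow three_ne_zero] at this
      exact mul_ne_zero hC0 (pow_ne_zero 4 (hne u hu)) this.symm
    -- For `V = k / y²` one has `V₁ / V₂ = -y / 3`, which suggests this choice; the second equation
    -- then says that `y` has derivative `1` in `Θ`.
    set y : ℝ → ℝ := fun u => -3 * S.D V u / S.D (S.D V) u with hy
    have hyT : S.IsTheta y := fun u hu => by
      have h2 := hne2 u hu
      refine (((hasDerivAt_of_D v1 hu).const_mul (-3)).fun_div (hasDerivAt_of_D v2 hu)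
        h2).congr_deriv ?_
      have hp := S.f_pos_of_mem_chart hu
      have := R2 u hu
      field_simp
      linear_combination this
    have hy0 : ∀ u ∈ S.chart, y u ≠ 0 := fun u hu =>
      div_ne_zero (mul_ne_zero (by norm_num) (hne u hu)) (hne2 u hu)
    have hDV : ∀ u ∈ S.chart, S.D V u = -27 / (C * y u ^ 3) := fun u hu => by
      have h1 := hne u hu
      have h2 := hne2 u hu
      have h3 := R3 u hu
      have : y u ^ 3 = -27 / (C * S.D V u) := by
        simp only [hy]
        rw [div_pow, h3]
        field_simp
        ring
      rw [this]
      field_simp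
    have hconst : ∀ u ∈ S.chart, V u - 27 / (2 * C) / y u ^ 2 =
        V u₀ - 27 / (2 * C) / y u₀ ^ 2 := fun u hu =>
      eq_of_hasDerivAt_zero (g := fun u => V u - 27 / (2 * C) / y u ^ 2) (fun w hw => by
        have hyw := hy0 w hw
        have hp := S.f_pos_of_mem_chart hw
        refine ((hasDerivAt_of_D hVa hw).fun_sub
          ((hasDerivAt_const w (27 / (2 * C))).fun_div ((hyT w hw).fun_pow 2)
            (pow_ne_zero 2 hyw))).congr_deriv ?_
        rw [hDV w hw]
        push_cast
        field_simp
        ring) hu hu₀J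
    refine ⟨27 / (2 * C), V u₀ - 27 / (2 * C) / y u₀ ^ 2, y, by positivity, hyT, hy0,
      fun u hu => by linarith [hconst u hu], fun u hu => ?_, u₀, hu₀J, ?_⟩
    · have h1 := R1 u hu
      have h2 := hne2 u hu
      rw [D_F hf hu, D_D_F hf hu] at h1
      simp only [hy]
      rw [div_mul_eq_mul_div, div_eq_iff h2]
      linear_combination 3 * h1
    · have h1 := hpos u₀ hu₀
      have h2 := hy0 u₀ hu₀J
      rw [hDV u₀ hu₀J] at h1
      have h3 : 27 / (2 * C) * y u₀ * deriv S.f u₀ =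
          -(-27 / (C * y u₀ ^ 3) * deriv S.f u₀) * y u₀ ^ 4 / 2 := by
        field_simp
      have h4 : 0 < y u₀ ^ 4 := by positivity
      rw [h3]
      nlinarith [mul_pos h1 h4]

end SurfaceOfRevolution
end

/-! ### Criteria for closed orbits; surfaces with constant h -/

open Set
open scoped ContDiff
noncomputable section

open Filter Topology

theorem growth_of_le_deriv {g g' : ℝ → ℝ} {δ t₀ : ℝ}
    (hg : ∀ t, t₀ ≤ t → HasDerivWithinAt g (g' t) (Ici t₀) t) (hle : ∀ t, t₀ ≤ t → δ ≤ g' t) {t : ℝ}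
    (ht : t₀ ≤ t) : g t₀ + δ * (t - t₀) ≤ g t := by
  have hd : ∀ s, t₀ < s → HasDerivAt (fun s => g s - δ * s) (g' s - δ) s := fun s hs => by
    have := ((hg s hs.le).hasDerivAt (Ici_mem_nhds hs)).fun_sub ((hasDerivAt_id s).const_mul δ)
    simpa using this
  have hmono : MonotoneOn (fun s => g s - δ * s) (Ici t₀) := by
    refine monotoneOn_of_deriv_nonneg (convex_Ici t₀)
      (fun s hs => ((hg s hs).continuousWithinAt).sub (by fun_prop)) ?_ ?_
    · intro s hs
      rw [interior_Ici] at hs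
      exact (hd s hs).differentiableAt.differentiableWithinAt
    · intro s hs
      rw [interior_Ici] at hs
      rw [(hd s hs).deriv]
      exact sub_nonneg.2 (hle s (le_of_lt hs))
  have := hmono (mem_Ici.2 le_rfl) (mem_Ici.2 ht) ht
  simp only at this
  linarith

theorem Function.Periodic.exists_lipschitzWith {Ψ : ℝ → ℝ} {P : ℝ} (hP : 0 < P)
    (hper : Function.Periodic Ψ P) (hd : ContDiff ℝ 1 Ψ) : ∃ K, LipschitzWith K Ψ := by
  have hc : Continuous (deriv Ψ) := hd.continuous_deriv le_rfl
  have hper' : Function.Periodic (deriv Ψ) P := fun s => by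
    have : (fun x => Ψ (x + P)) = Ψ := funext hper
    rw [← deriv_comp_add_const, this]
  obtain ⟨M, hM⟩ := (isCompact_Icc (a := 0) (b := P)).exists_bound_of_continuousOn hc.continuousOn
  refine ⟨M.toNNReal, lipschitzWith_of_nnnorm_deriv_le (hd.differentiable one_ne_zero) fun s => ?_⟩
  obtain ⟨v, hv, hsv⟩ := hper'.exists_mem_Ico₀ hP s
  rw [hsv, ← NNReal.coe_le_coe, coe_nnnorm]
  exact (hM v (Ico_subset_Icc_self hv)).trans (Real.le_coe_toNNReal M)

/-- A monotone solution of a periodic autonomous equation advances by a period in constant time. -/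
theorem exists_time_of_period {φ Ψ : ℝ → ℝ} {P δ : ℝ} {K : NNReal} (hP : P ≠ 0)
    (hΨ : LipschitzWith K Ψ) (hper : Function.Periodic Ψ P) (hδ : 0 < δ)
    (hφ : ∀ t, 0 ≤ t → HasDerivWithinAt φ (Ψ (φ t)) (Ici 0) t)
    (hle : ∀ t, 0 ≤ t → δ ≤ P * Ψ (φ t)) : ∃ T, 0 < T ∧ ∀ t, 0 ≤ t → φ (t + T) = φ t + P := by
  have hφc : ContinuousOn φ (Ici 0) := fun t ht => (hφ t ht).continuousWithinAt
  -- `P` may be negative; `P φ` increases in either case.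
  have hgrow : ∀ t, 0 ≤ t → P * φ 0 + δ * (t - 0) ≤ P * φ t := fun t ht =>
    growth_of_le_deriv (g := fun t => P * φ t) (g' := fun t => P * Ψ (φ t))
      (fun s hs => (hφ s hs).const_mul P) hle ht
  have hP2 : 0 < P ^ 2 := by positivity
  obtain ⟨T, hT, hTφ⟩ : ∃ T ∈ Icc 0 (P ^ 2 / δ), P * φ T = P * φ 0 + P ^ 2 := by
    have hc : ContinuousOn (fun t => P * φ t) (Icc 0 (P ^ 2 / δ)) :=
      continuousOn_const.mul (hφc.mono Icc_subset_Ici_self)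
    refine intermediate_value_Icc (by positivity) hc ⟨by linarith, ?_⟩
    have := hgrow (P ^ 2 / δ) (by positivity)
    rwa [sub_zero, mul_div_cancel₀ _ hδ.ne'] at this
  have hTφ' : φ T = φ 0 + P := mul_left_cancel₀ hP (by rw [hTφ]; ring)
  have hT0 : 0 < T := by
    refine lt_of_le_of_ne hT.1 fun h => hP ?_
    rw [← h] at hTφ'
    linarith
  refine ⟨T, hT0, fun t ht => ?_⟩
  have huniq := ODE_solution_unique (v := fun _ => Ψ) (K := K) (f := fun s => φ (s + T))
    (g := fun s => φ s + P) (a := 0) (b := t) (fun _ => hΨ)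
    (hφc.comp (by fun_prop) fun s hs => by
      have := hs.1; simp only [mem_Ici]; linarith) (fun s hs => by
      have h1 : HasDerivAt φ (Ψ (φ (s + T))) (s + T) :=
        (hφ _ (by linarith [hs.1])).hasDerivAt (Ici_mem_nhds (by linarith [hs.1]))
      exact (h1.comp_add_const s T).hasDerivWithinAt)
    ((hφc.mono Icc_subset_Ici_self).add continuousOn_const) (fun s hs => by
      have h1 := (hφ s hs.1).mono (Ici_subset_Ici.2 hs.1)
      have h2 := h1.add_const P
      rwa [← hper (φ s)] at h2) (by simpa using hTφ')
  exact huniq ⟨ht, le_rfl⟩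

/-- A planar rotation with angle `w φ`. -/
theorem eq_cos_add_sin_of_rotation {ξ η φ φ' : ℝ → ℝ} {w : ℝ}
    (hξ : ∀ t, 0 ≤ t → HasDerivWithinAt ξ (w * φ' t * η t) (Ici 0) t)
    (hη : ∀ t, 0 ≤ t → HasDerivWithinAt η (-(w * φ' t * ξ t)) (Ici 0) t)
    (hφ : ∀ t, 0 ≤ t → HasDerivWithinAt φ (φ' t) (Ici 0) t) :
    ∃ A B : ℝ, ∀ t, 0 ≤ t → ξ t = A * Real.cos (w * φ t) + B * Real.sin (w * φ t) := by
  have hconst : ∀ {g : ℝ → ℝ}, (∀ t, 0 ≤ t → HasDerivWithinAt g 0 (Ici 0) t) →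
      ∀ t, 0 ≤ t → g t = g 0 := fun {g} hg t ht =>
    constant_of_has_deriv_right_zero (a := 0) (b := t)
      (fun s hs => ((hg s hs.1).continuousWithinAt).mono Icc_subset_Ici_self)
      (fun s hs => (hg s hs.1).mono (Ici_subset_Ici.2 hs.1)) t ⟨ht, le_rfl⟩
  have h1 := hconst (g := fun t => ξ t * Real.cos (w * φ t) - η t * Real.sin (w * φ t))
    fun t ht => by
      have hc := ((hφ t ht).const_mul w).cos
      have hs := ((hφ t ht).const_mul w).sin
      refine (((hξ t ht).fun_mul hc).fun_sub ((hη t ht).fun_mul hs)).congr_deriv ?_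
      ring
  have h2 := hconst (g := fun t => ξ t * Real.sin (w * φ t) + η t * Real.cos (w * φ t))
    fun t ht => by
      have hc := ((hφ t ht).const_mul w).cos
      have hs := ((hφ t ht).const_mul w).sin
      refine (((hξ t ht).fun_mul hs).fun_add ((hη t ht).fun_mul hc)).congr_deriv ?_
      ring
  refine ⟨ξ 0 * Real.cos (w * φ 0) - η 0 * Real.sin (w * φ 0),
    ξ 0 * Real.sin (w * φ 0) + η 0 * Real.cos (w * φ 0), fun t ht => ?_⟩
  rw [← h1 t ht, ← h2 t ht]
  linear_combination (-ξ t) * Real.sin_sq_add_cos_sq (w * φ t)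

namespace SurfaceOfRevolution

variable {S : SurfaceOfRevolution} {m : ℝ} {V : ℝ → ℝ} {b : ℝ}

/-- Otherwise `f' / f` would be both periodic and strictly decreasing. -/
theorem kind_ne_toroidal_of_h_pos (hf : AnalyticOnNhd ℝ S.f S.chart)
    (hh : ∀ u ∈ S.chart, 0 < S.h u) : S.kind ≠ .toroidal := by
  intro hk
  have huniv := chart_eq_univ hk
  have hp := S.profile
  rw [hk] at hp
  obtain ⟨c, d, hcd, -, -, hfp, -⟩ := hp
  have hanti : StrictAnti fun u => deriv S.f u / S.f u := by
    refine strictAnti_of_deriv_neg fun u => ?_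
    have hu : u ∈ S.chart := huniv ▸ mem_univ u
    rw [(hasDerivAt_logDeriv hf hu).deriv]
    exact neg_neg_of_pos (div_pos (hh u hu) (pow_pos (S.f_pos_of_mem_chart hu) 2))
  have h1 := hanti hcd
  have h2 : deriv S.f (c + (d - c)) = deriv S.f c := by
    have : (fun x => S.f (x + (d - c))) = S.f := funext hfp
    rw [← deriv_comp_add_const, this]
  have h3 := hfp c
  rw [add_sub_cancel] at h2 h3
  simp only [h2, h3] at h1
  exact lt_irrefl _ h1

theorem isTheta_of_h_const (hf : AnalyticOnNhd ℝ S.f S.chart) (hb : b ≠ 0)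
    (hh : ∀ u ∈ S.chart, S.h u = b ^ 2) :
    S.IsTheta fun u => -(deriv S.f u / S.f u) / b ^ 2 := fun u hu => by
  refine ((hasDerivAt_logDeriv hf hu).fun_neg.div_const _).congr_deriv ?_
  have := S.f_pos_of_mem_chart hu
  rw [hh u hu]
  field_simp

/-- A bounded orbit along which `u` is a periodic function of `φ` is closed. -/
theorem isClosedOrbit_of_periodic (hm : 0 < m) {u φ pu pφ : ℝ → ℝ}
    (horb : S.IsNonsingularOrbit m V u φ pu pφ) (hbdd : S.IsBoundedOrbit u φ) (hL : pφ 0 ≠ 0)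
    {Z X Ψ : ℝ → ℝ} (hZ : InjOn Z S.chart) {N : ℕ} (hN : 0 < N)
    (hX : Function.Periodic X (2 * Real.pi * N)) (hZX : ∀ t, 0 ≤ t → Z (u t) = X (φ t))
    (hΨ : Function.Periodic Ψ (2 * Real.pi * N)) (hΨd : ContDiff ℝ 1 Ψ)
    (hΨφ : ∀ t, 0 ≤ t → 1 / S.f (u t) ^ 2 = Ψ (φ t)) : S.IsClosedOrbit u φ := by
  obtain ⟨R, hR, hfR⟩ := S.exists_f_le_of_isBoundedOrbit hbdd
  have hN' : (0 : ℝ) < N := by exact_mod_cast hN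
  have hP0 : 0 < 2 * Real.pi * N := by positivity
  obtain ⟨K, hK⟩ := (show Function.Periodic (fun s => pφ 0 / m * Ψ s) (2 * Real.pi * N) from
    fun s => by simp only [hΨ s]).exists_lipschitzWith hP0 (contDiff_const.mul hΨd)
  -- The integer `k = ± N` has the sign of the angular momentum, so that `φ` advances towards `φ + 2
  -- π k`.
  obtain ⟨k, hk0, hk⟩ : ∃ k : ℤ, (k : ℝ) * pφ 0 = N * |pφ 0| ∧
      ∀ g : ℝ → ℝ, Function.Periodic g (2 * Real.pi * N) →
        Function.Periodic g (k * (2 * Real.pi)) := by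
    rcases lt_or_gt_of_ne hL with h | h
    · refine ⟨-N, by push_cast; rw [abs_of_neg h]; ring, fun g hg => ?_⟩
      have e : ((-(N : ℤ) : ℤ) : ℝ) * (2 * Real.pi) = -(2 * Real.pi * N) := by push_cast; ring
      rw [e]
      exact hg.neg
    · refine ⟨N, by push_cast; rw [abs_of_pos h], fun g hg => ?_⟩
      have e : ((N : ℤ) : ℝ) * (2 * Real.pi) = 2 * Real.pi * N := by push_cast; ring
      rwa [e]
  have hL' : 0 < |pφ 0| := abs_pos.2 hL
  have hk1 : (k : ℝ) ≠ 0 := by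
    intro h
    rw [h, zero_mul] at hk0
    exact (mul_pos hN' hL').ne hk0
  have hφd : ∀ t, 0 ≤ t → HasDerivWithinAt φ (pφ 0 / m * Ψ (φ t)) (Ici 0) t := fun t ht => by
    have := horb.φ_dot t ht
    rw [horb.pφ_eq ht] at this
    refine this.congr_deriv ?_
    rw [← hΨφ t ht]
    have := S.f_pos_of_mem_chart (horb.mem t ht)
    field_simp
  obtain ⟨T, hT, hφT⟩ := exists_time_of_period (P := k * (2 * Real.pi))
    (δ := 2 * Real.pi * (N * |pφ 0|) / m * (1 / R ^ 2)) (mul_ne_zero hk1 (by positivity)) hK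
    (fun s => by simp only [hk Ψ hΨ s]) (by positivity) hφd fun t ht => by
      have hp := S.f_pos_of_mem_chart (horb.mem t ht)
      have h1 : 1 / R ^ 2 ≤ Ψ (φ t) := by
        rw [← hΨφ t ht]
        exact one_div_le_one_div_of_le (by positivity) (pow_le_pow_left₀ hp.le (hfR t ht) 2)
      calc 2 * Real.pi * (N * |pφ 0|) / m * (1 / R ^ 2)
          ≤ 2 * Real.pi * (N * |pφ 0|) / m * Ψ (φ t) :=
            mul_le_mul_of_nonneg_left h1 (by positivity)
        _ = k * (2 * Real.pi) * (pφ 0 / m * Ψ (φ t)) := by rw [← hk0]; ring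
  refine ⟨T, hT, fun t ht => ?_⟩
  have h1 : u (t + T) = u t := by
    refine hZ (horb.mem _ (by linarith)) (horb.mem t ht) ?_
    rw [hZX _ (by linarith), hZX t ht, hφT t ht]
    exact hk X hX _
  rw [S.point_ext_iff, h1, hφT t ht, Real.cos_add_int_mul_two_pi, Real.sin_add_int_mul_two_pi]
  exact ⟨rfl, rfl, rfl⟩

/-- The profile function of a surface with `h = b²`. -/
structure IsBertrandSurface (S : SurfaceOfRevolution) (b : ℝ) (Θ : ℝ → ℝ) : Prop where
  analytic : AnalyticOnNhd ℝ S.f S.chart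
  pos : 0 < b
  h_eq : ∀ u ∈ S.chart, S.h u = b ^ 2
  isTheta : S.IsTheta Θ
  logDeriv : ∀ u ∈ S.chart, deriv S.f u / S.f u = -b ^ 2 * Θ u

variable {Θ : ℝ → ℝ}

namespace IsBertrandSurface

variable (hS : S.IsBertrandSurface b Θ)
include hS

theorem deriv_f {u : ℝ} (hu : u ∈ S.chart) : deriv S.f u = -b ^ 2 * Θ u * S.f u := by
  have := S.f_pos_of_mem_chart hu
  rw [← hS.logDeriv u hu]; field_simp

theorem kind_ne : S.kind ≠ .toroidal :=
  kind_ne_toroidal_of_h_pos hS.analytic fun u hu => by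
    rw [hS.h_eq u hu]; have := hS.pos; positivity

theorem analytic_Θ : AnalyticOnNhd ℝ Θ S.chart := by
  have hb := hS.pos
  have h1 : AnalyticOnNhd ℝ (fun u => -(deriv S.f u / S.f u) / b ^ 2) S.chart := fun u hu =>
    (((hS.analytic.deriv u hu).div (hS.analytic u hu) (S.f_pos_of_mem_chart hu).ne').neg).div
      analyticAt_const (by positivity)
  refine h1.congr S.isOpen_chart fun u hu => ?_
  rw [hS.logDeriv u hu]
  field_simp

/-- The centrifugal potential is quadratic in `Θ`. -/
theorem exists_inv_sq : ∃ κ, ∀ u ∈ S.chart, 1 / S.f u ^ 2 = b ^ 2 * Θ u ^ 2 + κ := by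
  obtain ⟨a, ha⟩ := S.chart_nonempty
  refine ⟨1 / S.f a ^ 2 - b ^ 2 * Θ a ^ 2, fun u hu => ?_⟩
  have : 1 / S.f u ^ 2 - b ^ 2 * Θ u ^ 2 = 1 / S.f a ^ 2 - b ^ 2 * Θ a ^ 2 :=
    eq_of_hasDerivAt_zero (g := fun u => 1 / S.f u ^ 2 - b ^ 2 * Θ u ^ 2) (fun w hw => by
      have hp := S.f_pos_of_mem_chart hw
      have h1 := ((hasDerivAt_const w (1 : ℝ)).fun_div ((hasDerivAt_f hS.analytic hw).fun_pow 2)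
        (pow_pos hp 2).ne').fun_sub (((hS.isTheta w hw).fun_pow 2).const_mul (b ^ 2))
      refine h1.congr_deriv ?_
      rw [hS.deriv_f hw]
      push_cast
      field_simp
      ring) hu ha
  linarith

/-- On an infinitely long surface with `h = b²` the function `f` grows at infinity. -/
theorem nonneg_of_ray {σ u₀ : ℝ} (hσ : σ ^ 2 = 1) (hray : ∀ s, 0 ≤ s → u₀ + σ * s ∈ S.chart) :
    0 ≤ σ * deriv S.f u₀ := by
  by_contra hneg
  push Not at hneg
  have hb := hS.pos
  have hu₀ : u₀ ∈ S.chart := by simpa using hray 0 le_rfl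
  set G : ℝ → ℝ := fun s => σ * (deriv S.f (u₀ + σ * s) / S.f (u₀ + σ * s)) with hG
  have hd : ∀ s, 0 ≤ s → HasDerivAt G (-(b ^ 2 / S.f (u₀ + σ * s) ^ 2)) s := fun s hs => by
    have h1 := hasDerivAt_logDeriv hS.analytic (hray s hs)
    rw [hS.h_eq _ (hray s hs)] at h1
    have h2 : HasDerivAt (fun s => u₀ + σ * s) σ s := by
      simpa using ((hasDerivAt_id s).const_mul σ).const_add u₀
    refine ((HasDerivAt.comp (h := fun s => u₀ + σ * s) s h1 h2).const_mul σ).congr_deriv ?_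
    linear_combination (-(b ^ 2 / S.f (u₀ + σ * s) ^ 2)) * hσ
  have hG0 : G 0 < 0 := by
    have e : G 0 = σ * deriv S.f u₀ / S.f u₀ := by simp only [hG, mul_zero, add_zero]; ring
    rw [e]
    exact div_neg_of_neg_of_pos hneg (S.f_pos_of_mem_chart hu₀)
  have hGneg : ∀ s, 0 ≤ s → G s < 0 := fun s hs => by
    have := growth_of_le_deriv (g := fun s => -G s) (t₀ := 0) (δ := 0)
      (fun t ht => (hd t ht).fun_neg.hasDerivWithinAt) (fun t ht => by
        have := S.f_pos_of_mem_chart (hray t ht)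
        rw [neg_neg]; positivity) hs
    linarith
  -- The derivative of `1 / G` is `b² / (f')²`, which is at least `b²` because the profile has unit
  -- speed. So the negative quantity `1 / G` would reach zero at a finite distance.
  have hle : ∀ s, 0 ≤ s → (G 0)⁻¹ + b ^ 2 * (s - 0) ≤ (G s)⁻¹ := fun s hs => by
    refine growth_of_le_deriv (g := fun s => (G s)⁻¹)
      (fun t ht => ((hd t ht).fun_inv (hGneg t ht).ne).hasDerivWithinAt) (fun t ht => ?_) hs
    have hp := S.f_pos_of_mem_chart (hray t ht)
    have hGt := hGneg t ht
    have hle1 := abs_deriv_f_le_one hS.kind_ne (hray t ht)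
    have e : G t ^ 2 * S.f (u₀ + σ * t) ^ 2 = deriv S.f (u₀ + σ * t) ^ 2 := by
      simp only [hG]
      field_simp
      rw [hσ, one_mul]
    have h1 : deriv S.f (u₀ + σ * t) ^ 2 ≤ 1 := by
      rw [← sq_abs]
      exact pow_le_one₀ (abs_nonneg _) hle1
    have h2 : 0 < G t ^ 2 * S.f (u₀ + σ * t) ^ 2 :=
      mul_pos (sq_pos_of_neg hGt) (pow_pos hp 2)
    rw [neg_neg, div_div, mul_comm (S.f _ ^ 2), le_div_iff₀ h2, e]
    nlinarith [pow_pos hb 2]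
  have hs : 0 ≤ -(G 0)⁻¹ / b ^ 2 :=
    div_nonneg (neg_nonneg.2 (inv_nonpos.2 hG0.le)) (by positivity)
  have h1 := hle _ hs
  have h2 := inv_neg''.2 (hGneg _ hs)
  rw [sub_zero, mul_div_cancel₀ _ (by positivity)] at h1
  linarith

/-- A radial orbit that escapes moves in a direction in which `f` does not decrease. -/
theorem nonneg_of_escape (hm : 0 < m) {u φ pu pφ : ℝ → ℝ}
    (horb : S.IsNonsingularOrbit m V u φ pu pφ) {σ δ t₁ : ℝ} (hσ : σ ^ 2 = 1) (hδ : 0 < δ)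
    (ht₁ : 0 ≤ t₁) (hle : ∀ t, t₁ ≤ t → δ ≤ σ * pu t) : 0 ≤ σ * deriv S.f (u t₁) := by
  refine hS.nonneg_of_ray hσ fun s hs => ?_
  have ht2 : t₁ ≤ t₁ + s * m / δ := by
    have : 0 ≤ s * m / δ := by positivity
    linarith
  have hg := growth_of_le_deriv (g := fun t => σ * u t) (g' := fun t => σ * (pu t / m))
    (δ := δ / m) (t₀ := t₁)
    (fun t ht => ((horb.u_dot t (ht₁.trans ht)).mono (Ici_subset_Ici.2 ht₁)).const_mul σ)
    (fun t ht => by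
      rw [← mul_div_assoc]
      exact div_le_div_of_nonneg_right (hle t ht) hm.le) ht2
  have e : δ / m * (t₁ + s * m / δ - t₁) = s := by field_simp; ring
  rw [e] at hg
  have h1 := horb.mem t₁ ht₁
  have h2 := horb.mem _ (ht₁.trans ht2)
  rcases sq_eq_sq_iff_eq_or_eq_neg.1 (hσ.trans (one_pow 2).symm) with h | h
  · rw [h] at hg ⊢
    exact S.ordConnected_chart.out h1 h2 ⟨by linarith, by linarith⟩
  · rw [h] at hg ⊢
    exact S.ordConnected_chart.out h2 h1 ⟨by linarith, by linarith⟩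

end IsBertrandSurface

end SurfaceOfRevolution
end

/-! ### The potentials on a surface with constant h have closed orbits -/

open Set
open scoped ContDiff
noncomputable section

open Filter Topology

theorem exists_forall_le_of_le_deriv {g g' : ℝ → ℝ} {δ t₀ : ℝ} (hδ : 0 < δ)
    (hg : ∀ t, t₀ ≤ t → HasDerivWithinAt g (g' t) (Ici t₀) t) (hle : ∀ t, t₀ ≤ t → δ ≤ g' t)
    (M : ℝ) : ∃ t₁, t₀ ≤ t₁ ∧ ∀ t, t₁ ≤ t → M ≤ g t := by
  have h0 : 0 ≤ |M - g t₀| / δ := by positivity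
  refine ⟨t₀ + |M - g t₀| / δ, by linarith, fun t ht => ?_⟩
  have h1 := growth_of_le_deriv hg hle (t := t) (by linarith)
  have h2 : δ * (|M - g t₀| / δ) ≤ δ * (t - t₀) :=
    mul_le_mul_of_nonneg_left (by linarith) hδ.le
  rw [mul_div_cancel₀ _ hδ.ne'] at h2
  linarith [le_abs_self (M - g t₀)]

theorem periodic_cos_add_sin {w : ℝ} {N : ℕ} {z : ℤ} (h : w * N = z) (C A B : ℝ) :
    Function.Periodic (fun s => C + (A * Real.cos (w * s) + B * Real.sin (w * s)))
      (2 * Real.pi * N) := fun s => by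
  have e : w * (s + 2 * Real.pi * N) = w * s + z * (2 * Real.pi) := by rw [← h]; ring
  simp only [e, Real.cos_add_int_mul_two_pi, Real.sin_add_int_mul_two_pi]

namespace SurfaceOfRevolution

variable {S : SurfaceOfRevolution} {m : ℝ} {V : ℝ → ℝ} {b : ℝ} {Θ : ℝ → ℝ}

theorem IsTheta.hasDerivWithinAt_comp (hΘ : S.IsTheta Θ) {u φ pu pφ : ℝ → ℝ}
    (horb : S.IsNonsingularOrbit m V u φ pu pφ) {t : ℝ} (ht : 0 ≤ t) :
    HasDerivWithinAt (fun t => Θ (u t)) (pu t / (m * S.f (u t) ^ 2)) (Ici 0) t := by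
  refine ((hΘ _ (horb.mem t ht)).comp_hasDerivWithinAt t (horb.u_dot t ht)).congr_deriv ?_
  rw [div_mul_div_comm, one_mul, mul_comm]

namespace IsBertrandSurface

theorem isCentralPotential (hS : S.IsBertrandSurface b Θ) (hV : AnalyticOnNhd ℝ V S.chart) :
    S.IsCentralPotential V :=
  ⟨hV, fun u hu v hv h1 h2 => by rw [eq_of_profile_eq hS.kind_ne hu hv h1 h2]⟩

theorem pu_dot (hS : S.IsBertrandSurface b Θ) (hm : 0 < m) {u φ pu pφ : ℝ → ℝ}
    (horb : S.IsNonsingularOrbit m V u φ pu pφ) {V' t : ℝ} (ht : 0 ≤ t)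
    (hV : HasDerivAt V V' (u t)) :
    HasDerivWithinAt pu (-(pφ 0 ^ 2 * b ^ 2 * Θ (u t) / (m * S.f (u t) ^ 2)) - V') (Ici 0) t := by
  have hu := horb.mem t ht
  have hp := S.f_pos_of_mem_chart hu
  refine (horb.pu_dot t ht).congr_deriv ?_
  rw [hV.deriv, hS.deriv_f hu, horb.pφ_eq ht]
  field_simp

theorem hasDerivAt_effPot (hS : S.IsBertrandSurface b Θ) {V' u μ : ℝ} (hu : u ∈ S.chart)
    (hV : HasDerivAt V V' u) :
    HasDerivAt (S.effPot V μ) (V' + μ * (b ^ 2 * Θ u / S.f u ^ 2)) u := by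
  have hp := S.f_pos_of_mem_chart hu
  refine (hV.add ((hasDerivAt_F hS.analytic hu).const_mul μ)).congr_deriv ?_
  rw [hS.deriv_f hu]
  field_simp

/-- A potential with an orbit oscillating between two radii. -/
theorem exists_noncircular (hS : S.IsBertrandSurface b Θ) (hm : 0 < m)
    (hV : AnalyticOnNhd ℝ V S.chart) {p q μ : ℝ} (hμ : 0 ≤ μ) (hp : p ∈ S.chart)
    (hq : q ∈ S.chart) (h : IsWell (S.effPot V μ) p q) :
    ∃ u φ pu pφ : ℝ → ℝ, S.IsNonsingularOrbit m V u φ pu pφ ∧ S.IsBoundedOrbit u φ ∧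
      ¬ IsCircularOrbit u := by
  have e : √(m * μ) ^ 2 / m = μ := by
    rw [Real.sq_sqrt (by positivity)]; field_simp
  obtain ⟨u, φ, pu, h1, h2, h3, -⟩ := exists_orbit_of_isWell hS.analytic hV hm (√(m * μ)) hp hq
    (by rwa [e])
  exact ⟨u, φ, pu, _, h1, h2, h3⟩

/-! ### Potentials linear in Θ (Kepler type) -/

section Harmonic

variable {a c : ℝ} (hS : S.IsBertrandSurface b Θ) (hV : ∀ u ∈ S.chart, V u = a * Θ u + c)
include hS hV

theorem analyticOnNhd_of_eq_mul : AnalyticOnNhd ℝ V S.chart :=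
  AnalyticOnNhd.congr S.isOpen_chart
    (fun u hu => (analyticAt_const.mul (hS.analytic_Θ u hu)).add analyticAt_const)
    fun u hu => (hV u hu).symm

theorem hasDerivAt_of_eq_mul {u : ℝ} (hu : u ∈ S.chart) : HasDerivAt V (a / S.f u ^ 2) u := by
  have h1 := ((hS.isTheta u hu).const_mul a).add_const c
  rw [mul_one_div] at h1
  refine h1.congr_of_eventuallyEq ?_
  filter_upwards [S.chart_mem_nhds hu] with w hw using hV w hw

/-- For `L = 0` the force has a fixed direction `σ`, and boundedness keeps it from fading. Hence the
particle ends up moving in that direction at a speed bounded below, and `σ Θ` becomes positive. But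
then `σ f' < 0`, while an escaping orbit requires `σ f' ≥ 0`. -/
theorem pφ_ne_zero_of_eq_mul (hm : 0 < m) (ha : a ≠ 0) {u φ pu pφ : ℝ → ℝ}
    (horb : S.IsNonsingularOrbit m V u φ pu pφ) (hbdd : S.IsBoundedOrbit u φ) : pφ 0 ≠ 0 := by
  intro hL
  obtain ⟨R, hR, hfR⟩ := S.exists_f_le_of_isBoundedOrbit hbdd
  obtain ⟨σ, hσ, hσa⟩ : ∃ σ : ℝ, σ ^ 2 = 1 ∧ σ * a = -|a| := by
    rcases lt_or_gt_of_ne ha with h | h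
    · exact ⟨1, by norm_num, by rw [abs_of_neg h]; ring⟩
    · exact ⟨-1, by norm_num, by rw [abs_of_pos h]; ring⟩
  have ha' : 0 < |a| := abs_pos.2 ha
  have hpu : ∀ t, 0 ≤ t → HasDerivWithinAt (fun t => σ * pu t) (|a| / S.f (u t) ^ 2) (Ici 0) t :=
    fun t ht => by
      refine ((hS.pu_dot hm horb ht
        (hS.hasDerivAt_of_eq_mul hV (horb.mem t ht))).const_mul σ).congr_deriv ?_
      rw [hL]
      linear_combination (-1 / S.f (u t) ^ 2) * hσa
  obtain ⟨t₁, ht₁, h1⟩ := exists_forall_le_of_le_deriv (δ := |a| / R ^ 2) (by positivity) hpu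
    (fun t ht => by
      have := S.f_pos_of_mem_chart (horb.mem t ht)
      gcongr
      exact hfR t ht) 1
  obtain ⟨t₂, ht₂, h2⟩ := exists_forall_le_of_le_deriv (g := fun t => σ * Θ (u t))
    (g' := fun t => σ * (pu t / (m * S.f (u t) ^ 2))) (δ := 1 / (m * R ^ 2)) (t₀ := t₁)
    (by positivity)
    (fun t ht => ((hS.isTheta.hasDerivWithinAt_comp horb (ht₁.trans ht)).mono
      (Ici_subset_Ici.2 ht₁)).const_mul σ)
    (fun t ht => by
      have := S.f_pos_of_mem_chart (horb.mem t (ht₁.trans ht))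
      rw [← mul_div_assoc]
      have h3 := h1 t ht
      gcongr
      exact hfR t (ht₁.trans ht)) 1
  have h3 := hS.nonneg_of_escape hm horb hσ one_pos (ht₁.trans ht₂) fun t ht =>
    h1 t (ht₂.trans ht)
  have hu := horb.mem t₂ (ht₁.trans ht₂)
  rw [hS.deriv_f hu] at h3
  have h4 := h2 t₂ le_rfl
  have h5 : 0 < b ^ 2 * S.f (u t₂) * (σ * Θ (u t₂)) :=
    mul_pos (mul_pos (pow_pos hS.pos 2) (S.f_pos_of_mem_chart hu)) (by linarith)
  nlinarith

end Harmonic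

/-- The effective potential is a quadratic polynomial in `Θ`, so `Θ` minus its equilibrium value is
harmonic in `φ` with frequency `b`. The sign condition serves only to produce a well: somewhere the
central force must balance the centrifugal one. -/
theorem isClosedOrbitPotential_of_eq_mul {b : ℚ} {a c : ℝ} (hS : S.IsBertrandSurface b Θ)
    (hm : 0 < m) (ha : a ≠ 0) (hV : ∀ u ∈ S.chart, V u = a * Θ u + c)
    (hpos : ∃ u ∈ S.chart, 0 < a * deriv S.f u) : S.IsClosedOrbitPotential m V := by
  have hVa := hS.analyticOnNhd_of_eq_mul hV
  have hb := hS.pos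
  obtain ⟨κ, hκ⟩ := hS.exists_inv_sq
  obtain ⟨p, hp, hap⟩ := hpos
  have hΘp : a * Θ p < 0 := by
    have hfp := S.f_pos_of_mem_chart hp
    rw [hS.deriv_f hp] at hap
    have h1 : 0 < (b : ℝ) ^ 2 * S.f p := by positivity
    nlinarith
  obtain ⟨q, ⟨hΘq, hq⟩, hpq⟩ : ∃ q, (a * Θ q < 0 ∧ q ∈ S.chart) ∧ p < q := by
    have h1 : ∀ᶠ q in 𝓝 p, a * Θ q < 0 ∧ q ∈ S.chart :=
      ((continuousAt_const.mul (hS.isTheta p hp).continuousAt).eventually_lt_const hΘp).and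
        (S.chart_mem_nhds hp)
    exact ((h1.filter_mono nhdsWithin_le_nhds).and
      (self_mem_nhdsWithin : Ioi p ∈ 𝓝[>] p)).exists
  have hmono := hS.isTheta.strictMonoOn
  have hlt := hmono hp hq hpq
  refine ⟨hS.isCentralPotential hVa, ⟨p, hp, q, hq, ?_⟩, ?_, ?_⟩
  · rw [hV p hp, hV q hq]
    intro h
    exact hlt.ne (mul_left_cancel₀ ha (add_right_cancel h))
  · have hs : a * (Θ p + Θ q) < 0 := by linarith
    have hs0 : Θ p + Θ q ≠ 0 := by
      intro h; rw [h, mul_zero] at hs; exact lt_irrefl _ hs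
    -- Chosen so that the vertex of the parabola lies at the midpoint of `Θ p` and `Θ q`.
    set μ : ℝ := -2 * a / (b ^ 2 * (Θ p + Θ q)) with hμ
    have haμ : a = -(μ * b ^ 2 * (Θ p + Θ q) / 2) := by rw [hμ]; field_simp
    have hμ0 : 0 < μ := by
      have e : μ = 2 * -(a * (Θ p + Θ q)) / (b ^ 2 * (Θ p + Θ q) ^ 2) := by
        rw [hμ]; field_simp
      rw [e]
      exact div_pos (by linarith) (by positivity)
    have hW : ∀ u ∈ S.chart, S.effPot V μ u - S.effPot V μ q =
        μ * b ^ 2 / 2 * ((Θ u - Θ p) * (Θ u - Θ q)) := fun u hu => by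
      have e : ∀ v ∈ S.chart, S.F v = (b ^ 2 * Θ v ^ 2 + κ) / 2 := fun v hv => by
        rw [← hκ v hv, F]; field_simp
      rw [effPot, effPot, e u hu, e q hq, hV u hu, hV q hq, haμ]
      ring
    have hd : ∀ u ∈ S.chart, deriv (S.effPot V μ) u =
        μ * b ^ 2 / (2 * S.f u ^ 2) * ((Θ u - Θ p) + (Θ u - Θ q)) := fun u hu => by
      have hfp := S.f_pos_of_mem_chart hu
      rw [(hS.hasDerivAt_effPot hu (hS.hasDerivAt_of_eq_mul hV hu)).deriv, haμ]
      field_simp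
      ring
    refine hS.exists_noncircular hm hVa hμ0.le hp hq ⟨hpq, ?_, fun u hu => ?_, ?_, ?_⟩
    · have := hW p hp
      rw [sub_self, zero_mul, mul_zero] at this
      linarith
    · have huc := S.ordConnected_chart.out hp hq (Ioo_subset_Icc_self hu)
      have h1 := hmono hp huc hu.1
      have h2 := hmono huc hq hu.2
      refine sub_neg.1 ?_
      rw [hW u huc]
      exact mul_neg_of_pos_of_neg (by positivity)
        (mul_neg_of_pos_of_neg (sub_pos.2 h1) (sub_neg.2 h2))
    · have hfp := S.f_pos_of_mem_chart hp
      rw [hd p hp]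
      exact mul_neg_of_pos_of_neg (by positivity) (by linarith)
    · have hfp := S.f_pos_of_mem_chart hq
      rw [hd q hq]
      exact mul_pos (by positivity) (by linarith)
  · intro u φ pu pφ horb hbdd
    have hL := hS.pφ_ne_zero_of_eq_mul hV hm ha horb hbdd
    set L := pφ 0 with hLdef
    -- The vertex of the parabola `a Θ + (L² / m) b² Θ² / 2`.
    set x₀ : ℝ := -(a * m / (L ^ 2 * b ^ 2)) with hx₀
    obtain ⟨A, B, hAB⟩ := eq_cos_add_sin_of_rotation (ξ := fun t => Θ (u t) - x₀)
      (η := fun t => pu t / (L * b)) (φ := φ) (φ' := fun t => L / (m * S.f (u t) ^ 2)) (w := b)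
      (fun t ht => by
        have hfp := S.f_pos_of_mem_chart (horb.mem t ht)
        refine ((hS.isTheta.hasDerivWithinAt_comp horb ht).sub_const x₀).congr_deriv ?_
        field_simp)
      (fun t ht => by
        have hfp := S.f_pos_of_mem_chart (horb.mem t ht)
        refine ((hS.pu_dot hm horb ht (hS.hasDerivAt_of_eq_mul hV (horb.mem t ht))).div_const
          (L * b)).congr_deriv ?_
        rw [← hLdef, hx₀]
        field_simp
        ring)
      (fun t ht => by rw [hLdef, ← horb.pφ_eq ht]; exact horb.φ_dot t ht)
    have hN : (b : ℝ) * b.den = (b.num : ℤ) := by exact_mod_cast b.mul_den_eq_num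
    have hX := periodic_cos_add_sin hN x₀ A B
    refine isClosedOrbit_of_periodic hm horb hbdd hL hmono.injOn b.den_pos hX
      (Ψ := fun s => b ^ 2 * (x₀ + (A * Real.cos (b * s) + B * Real.sin (b * s))) ^ 2 + κ)
      (fun t ht => ?_) (fun s => ?_) (by fun_prop) fun t ht => ?_
    · simp only [← hAB t ht]; ring
    · have := hX s
      simp only at this
      simp only [this]
    · rw [hκ _ (horb.mem t ht)]
      simp only [← hAB t ht]
      ring

/-! ### Potentials k / Θ² (oscillator type) -/

section InverseSquare

variable {k c : ℝ} (hS : S.IsBertrandSurface b Θ) (hne : ∀ u ∈ S.chart, Θ u ≠ 0)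
  (hV : ∀ u ∈ S.chart, V u = k / Θ u ^ 2 + c)
include hS hne hV

theorem analyticOnNhd_of_eq_div : AnalyticOnNhd ℝ V S.chart :=
  AnalyticOnNhd.congr S.isOpen_chart
    (fun u hu => (analyticAt_const.div ((hS.analytic_Θ u hu).pow 2)
      (pow_ne_zero 2 (hne u hu))).add analyticAt_const)
    fun u hu => (hV u hu).symm

theorem hasDerivAt_of_eq_div {u : ℝ} (hu : u ∈ S.chart) :
    HasDerivAt V (-(2 * k / (Θ u ^ 3 * S.f u ^ 2))) u := by
  have hΘ := hne u hu
  have hp := S.f_pos_of_mem_chart hu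
  have h1 := ((hasDerivAt_const u k).fun_div ((hS.isTheta u hu).fun_pow 2)
    (pow_ne_zero 2 hΘ)).add_const c
  refine (h1.congr_of_eventuallyEq ?_).congr_deriv ?_
  · filter_upwards [S.chart_mem_nhds hu] with w hw using hV w hw
  · push_cast
    field_simp
    ring

/-- Let `σ` be the sign of `Θ`. For `L = 0` the momentum `σ p_u` increases. Once positive it would
let the orbit escape in a direction in which `f` decreases, so it is never positive. Then `σ Θ`
decreases and the force stays bounded below, which makes the momentum positive after all. -/
theorem pφ_ne_zero_of_eq_div (hm : 0 < m) (hk : 0 < k) {u φ pu pφ : ℝ → ℝ}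
    (horb : S.IsNonsingularOrbit m V u φ pu pφ) (hbdd : S.IsBoundedOrbit u φ) : pφ 0 ≠ 0 := by
  intro hL
  obtain ⟨R, hR, hfR⟩ := S.exists_f_le_of_isBoundedOrbit hbdd
  obtain ⟨σ, hσ, hσΘ⟩ : ∃ σ : ℝ, σ ^ 2 = 1 ∧ ∀ u ∈ S.chart, 0 < σ * Θ u := by
    rcases S.isPreconnected_chart.pos_or_neg_of_ne_zero hS.analytic_Θ.continuousOn hne with h | h
    · exact ⟨1, by norm_num, fun u hu => by rw [one_mul]; exact h u hu⟩
    · exact ⟨-1, by norm_num, fun u hu => by have := h u hu; linarith⟩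
  have hb := hS.pos
  have hΘt : ∀ t, 0 ≤ t → 0 < σ * Θ (u t) := fun t ht => hσΘ _ (horb.mem t ht)
  have hft : ∀ t, 0 ≤ t → 0 < S.f (u t) := fun t ht => S.f_pos_of_mem_chart (horb.mem t ht)
  have hpu : ∀ t, 0 ≤ t → HasDerivWithinAt (fun t => σ * pu t)
      (2 * k / ((σ * Θ (u t)) ^ 3 * S.f (u t) ^ 2)) (Ici 0) t := fun t ht => by
    have hu := horb.mem t ht
    have hΘ := hne _ hu
    have hp := hft t ht
    have hσ0 : σ ≠ 0 := fun h => by rw [h] at hσ; norm_num at hσ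
    refine ((hS.pu_dot hm horb ht (hS.hasDerivAt_of_eq_div hne hV hu)).const_mul σ).congr_deriv ?_
    rw [hL]
    field_simp
    linear_combination (2 * m * k * (σ ^ 2 + 1)) * hσ
  have hesc : ∀ t₁, 0 ≤ t₁ → σ * pu t₁ ≤ 0 := fun t₁ ht₁ => by
    by_contra hpos
    push Not at hpos
    have h1 := hS.nonneg_of_escape hm horb hσ hpos ht₁ fun t ht => by
      have := growth_of_le_deriv (δ := 0)
        (fun t ht => (hpu t (ht₁.trans ht)).mono (Ici_subset_Ici.2 ht₁)) (fun t ht => by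
          have h2 := hΘt t (ht₁.trans ht)
          have h3 := hft t (ht₁.trans ht)
          positivity) ht
      linarith
    rw [hS.deriv_f (horb.mem t₁ ht₁)] at h1
    have h5 := mul_pos (mul_pos (pow_pos hb 2) (hft t₁ ht₁)) (hΘt t₁ ht₁)
    nlinarith
  have hdec : ∀ t, 0 ≤ t → σ * Θ (u t) ≤ σ * Θ (u 0) := fun t ht => by
    have := growth_of_le_deriv (g := fun t => -(σ * Θ (u t))) (δ := 0)
      (g' := fun t => -(σ * (pu t / (m * S.f (u t) ^ 2)))) (t₀ := 0)
      (fun t ht => ((hS.isTheta.hasDerivWithinAt_comp horb ht).const_mul σ).fun_neg) (fun t ht => by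
        have h3 := hft t ht
        rw [← mul_div_assoc, neg_nonneg]
        exact div_nonpos_of_nonpos_of_nonneg (hesc t ht) (by positivity)) ht
    linarith
  have h0 := hΘt 0 le_rfl
  obtain ⟨t₁, ht₁, h1⟩ := exists_forall_le_of_le_deriv
    (δ := 2 * k / ((σ * Θ (u 0)) ^ 3 * R ^ 2)) (by positivity) hpu
    (fun t ht => by
      have h2 := hΘt t ht
      have h3 := hft t ht
      have h4 := hfR t ht
      have h5 := hdec t ht
      gcongr) 1
  linarith [h1 t₁ le_rfl, hesc t₁ ht₁]

/-- As for the planar oscillator, the square linearizes the motion: `Θ²` minus a constant is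
harmonic in `φ` with frequency `2 b`, the constant being fixed by the conserved energy. -/
theorem exists_rotation_of_eq_div (hm : 0 < m) {u φ pu pφ : ℝ → ℝ}
    (horb : S.IsNonsingularOrbit m V u φ pu pφ) (hL : pφ 0 ≠ 0) :
    ∃ C A B : ℝ, ∀ t, 0 ≤ t → Θ (u t) ^ 2 =
      C + (A * Real.cos (2 * b * φ t) + B * Real.sin (2 * b * φ t)) := by
  have hb := hS.pos
  set L := pφ 0 with hLdef
  have hpu : ∀ t, 0 ≤ t → HasDerivWithinAt pu (-(L ^ 2 * b ^ 2 * Θ (u t) / (m * S.f (u t) ^ 2))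
      - -(2 * k / (Θ (u t) ^ 3 * S.f (u t) ^ 2))) (Ici 0) t := fun t ht =>
    hS.pu_dot hm horb ht (hS.hasDerivAt_of_eq_div hne hV (horb.mem t ht))
  set E : ℝ → ℝ := fun t => pu t ^ 2 + L ^ 2 * b ^ 2 * Θ (u t) ^ 2 + 2 * m * k / Θ (u t) ^ 2
    with hE
  have hEd : ∀ t, 0 ≤ t → HasDerivWithinAt E 0 (Ici 0) t := fun t ht => by
    have hΘ := hne _ (horb.mem t ht)
    have hfp := S.f_pos_of_mem_chart (horb.mem t ht)
    have hd := hS.isTheta.hasDerivWithinAt_comp horb ht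
    refine ((((hpu t ht).fun_pow 2).fun_add ((hd.fun_pow 2).const_mul (L ^ 2 * b ^ 2))).fun_add
      ((hasDerivWithinAt_const t (Ici 0) (2 * m * k)).fun_div (hd.fun_pow 2)
        (pow_ne_zero 2 hΘ))).congr_deriv ?_
    push_cast
    field_simp
    ring
  have hEc : ∀ t, 0 ≤ t → E t = E 0 := fun t ht =>
    constant_of_has_deriv_right_zero (a := 0) (b := t)
      (fun s hs => ((hEd s hs.1).continuousWithinAt).mono Icc_subset_Ici_self)
      (fun s hs => (hEd s hs.1).mono (Ici_subset_Ici.2 hs.1)) t ⟨ht, le_rfl⟩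
  set x₀ : ℝ := E 0 / (2 * L ^ 2 * b ^ 2) with hx₀
  obtain ⟨A, B, hAB⟩ := eq_cos_add_sin_of_rotation (ξ := fun t => Θ (u t) ^ 2 - x₀)
    (η := fun t => Θ (u t) * pu t / (L * b)) (φ := φ) (φ' := fun t => L / (m * S.f (u t) ^ 2))
    (w := 2 * b)
    (fun t ht => by
      have hfp := S.f_pos_of_mem_chart (horb.mem t ht)
      refine (((hS.isTheta.hasDerivWithinAt_comp horb ht).fun_pow 2).sub_const x₀).congr_deriv ?_
      push_cast
      field_simp)
    (fun t ht => by
      have hΘ := hne _ (horb.mem t ht)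
      have hfp := S.f_pos_of_mem_chart (horb.mem t ht)
      refine (((hS.isTheta.hasDerivWithinAt_comp horb ht).fun_mul (hpu t ht)).div_const
        (L * b)).congr_deriv ?_
      have e := hEc t ht
      have e' : x₀ = (pu t ^ 2 + L ^ 2 * b ^ 2 * Θ (u t) ^ 2 + 2 * m * k / Θ (u t) ^ 2) /
          (2 * L ^ 2 * b ^ 2) := by rw [hx₀, ← e]
      rw [e']
      field_simp
      ring)
    (fun t ht => by rw [hLdef, ← horb.pφ_eq ht]; exact horb.φ_dot t ht)
  exact ⟨x₀, A, B, fun t ht => by rw [← hAB t ht]; ring⟩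

end InverseSquare

/-- Here `Θ` has no zero, so it keeps its sign and `Θ²` still determines `u`. Harmonic motion of
`Θ²` then gives periodicity in `φ`. -/
theorem isClosedOrbitPotential_of_eq_div {b : ℚ} {k c : ℝ} (hS : S.IsBertrandSurface b Θ)
    (hm : 0 < m) (hk : 0 < k) (hne : ∀ u ∈ S.chart, Θ u ≠ 0)
    (hV : ∀ u ∈ S.chart, V u = k / Θ u ^ 2 + c) : S.IsClosedOrbitPotential m V := by
  have hVa := hS.analyticOnNhd_of_eq_div hne hV
  have hb := hS.pos
  obtain ⟨κ, hκ⟩ := hS.exists_inv_sq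
  have hmono := hS.isTheta.strictMonoOn
  have hmul : ∀ u ∈ S.chart, ∀ v ∈ S.chart, 0 < Θ u * Θ v := fun u hu v hv => by
    rcases S.isPreconnected_chart.pos_or_neg_of_ne_zero hS.analytic_Θ.continuousOn hne with h | h
    · exact mul_pos (h u hu) (h v hv)
    · exact mul_pos_of_neg_of_neg (h u hu) (h v hv)
  have hinj : InjOn (fun u => Θ u ^ 2) S.chart := fun u hu v hv h => by
    rcases sq_eq_sq_iff_eq_or_eq_neg.1 h with h | h
    · exact hmono.injOn hu hv h
    · have := hmul u hu v hv
      rw [h] at this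
      nlinarith [sq_nonneg (Θ v)]
  obtain ⟨p, hp⟩ := S.chart_nonempty
  obtain ⟨q, hq, hpq⟩ : ∃ q, q ∈ S.chart ∧ p < q :=
    ((Filter.Eventually.filter_mono nhdsWithin_le_nhds (S.chart_mem_nhds hp)).and
      (self_mem_nhdsWithin : Ioi p ∈ 𝓝[>] p)).exists
  have hlt := hmono hp hq hpq
  have hΘp := hne p hp
  have hΘq := hne q hq
  refine ⟨hS.isCentralPotential hVa, ⟨p, hp, q, hq, ?_⟩, ?_, ?_⟩
  · rw [hV p hp, hV q hq]
    intro h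
    have h1 := add_right_cancel h
    rw [div_eq_div_iff (by positivity) (by positivity)] at h1
    exact hpq.ne' (hinj hq hp (mul_left_cancel₀ hk.ne' h1))
  · set μ : ℝ := 2 * k / (b ^ 2 * (Θ p ^ 2 * Θ q ^ 2)) with hμ
    have hμ0 : 0 < μ := by positivity
    have hW : ∀ u ∈ S.chart, S.effPot V μ u - S.effPot V μ q =
        k / (Θ u ^ 2 * Θ p ^ 2 * Θ q ^ 2) * ((Θ u + Θ p) * (Θ u + Θ q)) *
          ((Θ u - Θ p) * (Θ u - Θ q)) := fun u hu => by
      have hΘ := hne u hu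
      have e : ∀ v ∈ S.chart, S.F v = (b ^ 2 * Θ v ^ 2 + κ) / 2 := fun v hv => by
        rw [← hκ v hv, F]; field_simp
      rw [effPot, effPot, e u hu, e q hq, hV u hu, hV q hq, hμ]
      field_simp
      ring
    have hd : ∀ u ∈ S.chart, deriv (S.effPot V μ) u =
        2 * k / (S.f u ^ 2 * Θ u ^ 3 * Θ p ^ 2 * Θ q ^ 2) * (Θ u ^ 4 - Θ p ^ 2 * Θ q ^ 2) :=
      fun u hu => by
        have hΘ := hne u hu
        have hfp := S.f_pos_of_mem_chart hu
        rw [(hS.hasDerivAt_effPot hu (hS.hasDerivAt_of_eq_div hne hV hu)).deriv, hμ]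
        field_simp
        ring
    have hm1 := hmul p hp q hq
    have hm2 : 0 < Θ p ^ 2 + Θ p * Θ q := by positivity
    have hm3 : 0 < Θ q ^ 2 + Θ p * Θ q := by positivity
    refine hS.exists_noncircular hm hVa hμ0.le hp hq ⟨hpq, ?_, fun u hu => ?_, ?_, ?_⟩
    · have := hW p hp
      rw [sub_self, zero_mul, mul_zero] at this
      linarith
    · have huc := S.ordConnected_chart.out hp hq (Ioo_subset_Icc_self hu)
      have hΘ := hne u huc
      have h1 := hmono hp huc hu.1
      have h2 := hmono huc hq hu.2
      have h3 := hmul u huc p hp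
      have h4 := hmul u huc q hq
      have h5 : 0 < (Θ u + Θ p) * (Θ u + Θ q) := by
        have e : (Θ u + Θ p) * (Θ u + Θ q) = Θ u ^ 2 + Θ u * Θ p + Θ u * Θ q + Θ p * Θ q := by ring
        rw [e]; positivity
      refine sub_neg.1 ?_
      rw [hW u huc]
      exact mul_neg_of_pos_of_neg (by positivity)
        (mul_neg_of_pos_of_neg (sub_pos.2 h1) (sub_neg.2 h2))
    · have hfp := S.f_pos_of_mem_chart hp
      rw [hd p hp]
      have e : 2 * k / (S.f p ^ 2 * Θ p ^ 3 * Θ p ^ 2 * Θ q ^ 2) * (Θ p ^ 4 - Θ p ^ 2 * Θ q ^ 2) =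
          2 * k / (S.f p ^ 2 * Θ p ^ 4 * Θ q ^ 2) * (Θ p ^ 2 + Θ p * Θ q) * (Θ p - Θ q) := by
        field_simp
        ring
      rw [e]
      exact mul_neg_of_pos_of_neg (by positivity) (sub_neg.2 hlt)
    · have hfp := S.f_pos_of_mem_chart hq
      rw [hd q hq]
      have e : 2 * k / (S.f q ^ 2 * Θ q ^ 3 * Θ p ^ 2 * Θ q ^ 2) * (Θ q ^ 4 - Θ p ^ 2 * Θ q ^ 2) =
          2 * k / (S.f q ^ 2 * Θ q ^ 4 * Θ p ^ 2) * (Θ q ^ 2 + Θ p * Θ q) * (Θ q - Θ p) := by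
        field_simp
        ring
      rw [e]
      exact mul_pos (by positivity) (sub_pos.2 hlt)
  · intro u φ pu pφ horb hbdd
    have hL := hS.pφ_ne_zero_of_eq_div hne hV hm hk horb hbdd
    obtain ⟨C, A, B, hAB⟩ := hS.exists_rotation_of_eq_div hne hV hm horb hL
    have hN : (2 * b : ℝ) * b.den = ((2 * b.num : ℤ) : ℝ) := by
      have : (b : ℝ) * b.den = (b.num : ℤ) := by exact_mod_cast b.mul_den_eq_num
      push_cast
      rw [mul_assoc, this]
    have hX := periodic_cos_add_sin hN C A B
    refine isClosedOrbit_of_periodic hm horb hbdd hL hinj b.den_pos hX hAB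
      (Ψ := fun s => b ^ 2 * (C + (A * Real.cos (2 * b * s) + B * Real.sin (2 * b * s))) + κ)
      (fun s => ?_) (by fun_prop) fun t ht => ?_
    · have := hX s
      simp only at this
      simp only [this]
    · rw [hκ _ (horb.mem t ht), hAB t ht]

end IsBertrandSurface

end SurfaceOfRevolution
end

/-! ### Counting the potentials -/

open Set
open scoped ContDiff
noncomputable section

open Filter Topology

namespace SurfaceOfRevolution

variable {S : SurfaceOfRevolution} {m : ℝ} {V W : ℝ → ℝ} {b : ℝ} {Θ : ℝ → ℝ}

theorem IsTheta.sub_eq {y z : ℝ → ℝ} (hy : S.IsTheta y) (hz : S.IsTheta z) {u v : ℝ}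
    (hu : u ∈ S.chart) (hv : v ∈ S.chart) : y u - z u = y v - z v :=
  eq_of_hasDerivAt_zero (g := fun u => y u - z u)
    (fun w hw => ((hy w hw).fun_sub (hz w hw)).congr_deriv (sub_self _)) hu hv

theorem exists_gt_mem_chart {u : ℝ} (hu : u ∈ S.chart) : ∃ v ∈ S.chart, u < v :=
  ((Filter.Eventually.filter_mono nhdsWithin_le_nhds (S.chart_mem_nhds hu)).and
    (self_mem_nhdsWithin : Ioi u ∈ 𝓝[>] u)).exists

theorem exists_lt_mem_chart {u : ℝ} (hu : u ∈ S.chart) : ∃ v ∈ S.chart, v < u :=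
  ((Filter.Eventually.filter_mono nhdsWithin_le_nhds (S.chart_mem_nhds hu)).and
    (self_mem_nhdsWithin : Iio u ∈ 𝓝[<] u)).exists

/-- Two antiderivatives of `1 / f²` that satisfy the differential equation of an
oscillator coincide. -/
theorem IsTheta.eqOn_of_oscillator (hf : AnalyticOnNhd ℝ S.f S.chart) {y z : ℝ → ℝ} {β γ : ℝ}
    (hβ : β ≠ 0) (hy : S.IsTheta y) (hz : S.IsTheta z) (hy0 : ∀ u ∈ S.chart, y u ≠ 0)
    (hyh : ∀ u ∈ S.chart, y u * (S.h u - β ^ 2) = 3 * (deriv S.f u / S.f u))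
    (hzh : ∀ u ∈ S.chart, z u * (S.h u - γ ^ 2) = 3 * (deriv S.f u / S.f u)) :
    EqOn y z S.chart := fun p hp => by
  by_contra hne
  set δ : ℝ := y p - z p with hδ
  have hδ0 : δ ≠ 0 := sub_ne_zero.2 hne
  have hyz : ∀ u ∈ S.chart, y u - z u = δ := fun u hu => hy.sub_eq hz hu hp
  set K : ℝ := (β ^ 2 - γ ^ 2) / (3 * δ) with hK
  have hKδ : 3 * δ * K = β ^ 2 - γ ^ 2 := by rw [hK]; field_simp
  -- Subtracting the two equations, with `y - z` a nonzero constant, makes `f' / f` a multiple of `y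
  -- z`; its derivative expresses `h` through `y + z`.
  have hl : ∀ u ∈ S.chart, deriv S.f u / S.f u = K * (y u * z u) := fun u hu => by
    refine mul_left_cancel₀ (mul_ne_zero three_ne_zero hδ0) ?_
    linear_combination (-y u) * hzh u hu + z u * hyh u hu - (y u * z u) * hKδ
      - 3 * (deriv S.f u / S.f u) * hyz u hu
  have hh : ∀ u ∈ S.chart, S.h u = -(K * (y u + z u)) := fun u hu => by
    have hfp := S.f_pos_of_mem_chart hu
    have h1 := ((hy u hu).fun_mul (hz u hu)).const_mul K
    have h2 := (hasDerivAt_logDeriv hf hu).unique (h1.congr_of_eventuallyEq (by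
      filter_upwards [S.chart_mem_nhds hu] with w hw using hl w hw))
    field_simp at h2
    linarith
  -- Reinserting leaves a relation of first degree in `y` and `z`. Both increase by the same
  -- amounts, so `K = 0`, and then `β = 0`.
  have hlin : ∀ u ∈ S.chart, K * y u + 4 * (K * z u) + β ^ 2 = 0 := fun u hu => by
    refine mul_left_cancel₀ (hy0 u hu) ?_
    linear_combination (-1) * hyh u hu - 3 * hl u hu + y u * hh u hu
  obtain ⟨q, hq, hpq⟩ := exists_gt_mem_chart hp
  have hlt := hy.strictMonoOn hp hq hpq
  have hK0 : K = 0 := by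
    have h1 : K * (5 * (y q - y p)) = 0 := by
      linear_combination hlin q hq - hlin p hp + 4 * K * (hyz q hq - hyz p hp)
    rcases mul_eq_zero.1 h1 with h | h
    · exact h
    · linarith
  have h1 := hlin p hp
  rw [hK0] at h1
  exact hβ (pow_eq_zero_iff two_ne_zero |>.1 (by linarith))

/-- A potential that is linear in an antiderivative of `1 / f²`, on a surface with `h = b²`. -/
def IsKeplerian (S : SurfaceOfRevolution) (V : ℝ → ℝ) : Prop :=
  ∃ a : ℝ, a ≠ 0 ∧ (∀ u ∈ S.chart, HasDerivAt V (a / S.f u ^ 2) u) ∧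
    (∃ b : ℚ, 0 < b ∧ ∀ u ∈ S.chart, S.h u = (b : ℝ) ^ 2) ∧ ∃ u ∈ S.chart, 0 < a * deriv S.f u

/-- A potential of the form `k / y² + c`, for an antiderivative `y` of `1 / f²` such that
`y (h - β²) = 3 f' / f`. -/
def IsOscillator (S : SurfaceOfRevolution) (V : ℝ → ℝ) : Prop :=
  ∃ (β k c : ℝ) (y : ℝ → ℝ), β ≠ 0 ∧ k ≠ 0 ∧ S.IsTheta y ∧ (∀ u ∈ S.chart, y u ≠ 0) ∧
    (∀ u ∈ S.chart, V u = k / y u ^ 2 + c) ∧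
    (∀ u ∈ S.chart, y u * (S.h u - β ^ 2) = 3 * (deriv S.f u / S.f u)) ∧
    ∃ u ∈ S.chart, k * y u * deriv S.f u < 0

theorem IsClosedOrbitPotential.isKeplerian_or_isOscillator (hf : AnalyticOnNhd ℝ S.f S.chart)
    (hm : 0 < m) (hV : S.IsClosedOrbitPotential m V) : S.IsKeplerian V ∨ S.IsOscillator V := by
  obtain ⟨b, hb, ⟨a, ha, hD, hh, hpos⟩ | ⟨k, c, y, hk, hy, hy0, hVy, hyh, hneg⟩⟩ :=
    hV.classification hf hm
  · refine Or.inl ⟨a, ha, fun u hu => ?_, ⟨b, hb, hh⟩, hpos⟩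
    have := hasDerivAt_of_D hV.central.analytic hu
    rwa [hD u hu] at this
  · exact Or.inr ⟨b, k, c, y, by exact_mod_cast hb.ne', hk, hy, hy0, hVy, hyh, hneg⟩

theorem IsKeplerian.samePotential (hV : S.IsKeplerian V) (hW : S.IsKeplerian W) :
    S.SamePotential V W := by
  obtain ⟨a, ha, hVd, -⟩ := hV
  obtain ⟨a', ha', hWd, -⟩ := hW
  obtain ⟨p, hp⟩ := S.chart_nonempty
  refine ⟨a / a', V p - a / a' * W p, div_ne_zero ha ha', fun u hu => ?_⟩
  have := eq_of_hasDerivAt_zero (g := fun u => V u - a / a' * W u) (fun w hw =>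
    ((hVd w hw).fun_sub ((hWd w hw).const_mul (a / a'))).congr_deriv (by field_simp; ring)) hu hp
  linarith

theorem IsOscillator.samePotential (hf : AnalyticOnNhd ℝ S.f S.chart) (hV : S.IsOscillator V)
    (hW : S.IsOscillator W) : S.SamePotential V W := by
  obtain ⟨β, k, c, y, hβ, hk, hy, hy0, hVy, hyh, -⟩ := hV
  obtain ⟨γ, k', c', z, -, hk', hz, hz0, hWz, hzh, -⟩ := hW
  have e := hy.eqOn_of_oscillator hf hβ hz hy0 hyh hzh
  refine ⟨k / k', c - k / k' * c', div_ne_zero hk hk', fun u hu => ?_⟩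
  have := hz0 u hu
  rw [hVy u hu, hWz u hu, e hu]
  field_simp
  ring

/-- Each of the two types contains at most one potential up to constants. If a type is empty, its
representative is arbitrary. -/
theorem atMostTwo (hf : AnalyticOnNhd ℝ S.f S.chart) (hm : 0 < m) : S.AtMostTwo m := by
  have h1 : ∃ V₁, ∀ V, S.IsKeplerian V → S.SamePotential V V₁ := by
    by_cases h : ∃ V₁, S.IsKeplerian V₁
    · exact ⟨h.choose, fun V hV => hV.samePotential h.choose_spec⟩
    · exact ⟨0, fun V hV => absurd ⟨V, hV⟩ h⟩
  have h2 : ∃ V₂, ∀ V, S.IsOscillator V → S.SamePotential V V₂ := by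
    by_cases h : ∃ V₂, S.IsOscillator V₂
    · exact ⟨h.choose, fun V hV => hV.samePotential hf h.choose_spec⟩
    · exact ⟨0, fun V hV => absurd ⟨V, hV⟩ h⟩
  obtain ⟨V₁, h1⟩ := h1
  obtain ⟨V₂, h2⟩ := h2
  exact ⟨V₁, V₂, fun V hV => (hV.isKeplerian_or_isOscillator hf hm).imp (h1 V) (h2 V)⟩

theorem isBertrandSurface (hf : AnalyticOnNhd ℝ S.f S.chart) (hb : 0 < b)
    (hh : ∀ u ∈ S.chart, S.h u = b ^ 2) :
    S.IsBertrandSurface b fun u => -(deriv S.f u / S.f u) / b ^ 2 :=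
  ⟨hf, hb, hh, isTheta_of_h_const hf hb.ne' hh, fun u _ => by field_simp⟩

namespace IsBertrandSurface

variable (hS : S.IsBertrandSurface b Θ)
include hS

theorem eq_zero_iff {u : ℝ} (hu : u ∈ S.chart) : Θ u = 0 ↔ deriv S.f u = 0 := by
  have hfp := S.f_pos_of_mem_chart hu
  have hb := hS.pos
  rw [hS.deriv_f hu]
  simp [hb.ne', hfp.ne']

theorem exists_eq_mul (hV : S.IsKeplerian V) : ∃ a c : ℝ, a ≠ 0 ∧
    (∀ u ∈ S.chart, V u = a * Θ u + c) ∧ ∃ u ∈ S.chart, 0 < a * deriv S.f u := by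
  obtain ⟨a, ha, hVd, -, hpos⟩ := hV
  obtain ⟨p, hp⟩ := S.chart_nonempty
  refine ⟨a, V p - a * Θ p, ha, fun u hu => ?_, hpos⟩
  have := eq_of_hasDerivAt_zero (g := fun u => V u - a * Θ u) (fun w hw =>
    ((hVd w hw).fun_sub ((hS.isTheta w hw).const_mul a)).congr_deriv (by ring)) hu hp
  linarith

/-- Differentiating `y (b² - β²) = 3 f' / f` gives `β² = 4 b²`, which turns the equation into `y =
Θ`. The sign of `k` comes from the sign condition, as `Θ f'` is never positive. -/
theorem exists_eq_div (hV : S.IsOscillator V) : (∀ u ∈ S.chart, Θ u ≠ 0) ∧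
    ∃ k c : ℝ, 0 < k ∧ ∀ u ∈ S.chart, V u = k / Θ u ^ 2 + c := by
  obtain ⟨β, k, c, y, hβ, hk, hy, hy0, hVy, hyh, p, hp, hneg⟩ := hV
  have hb := hS.pos
  have hβb : β ^ 2 = 4 * b ^ 2 := by
    have hfp := S.f_pos_of_mem_chart hp
    have h1 := ((hy p hp).mul_const (b ^ 2 - β ^ 2)).congr_of_eventuallyEq
      (f₁ := fun u => 3 * (deriv S.f u / S.f u)) (by
        filter_upwards [S.chart_mem_nhds hp] with w hw
        rw [← hyh w hw, hS.h_eq w hw])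
    have h2 := h1.unique ((hasDerivAt_logDeriv hS.analytic hp).const_mul 3)
    rw [hS.h_eq p hp] at h2
    field_simp at h2
    linarith
  have hyΘ : ∀ u ∈ S.chart, y u = Θ u := fun u hu => by
    have h1 := hyh u hu
    rw [hS.h_eq u hu, hβb, hS.logDeriv u hu] at h1
    refine mul_left_cancel₀ (pow_pos hb 2).ne' ?_
    linarith
  refine ⟨fun u hu => hyΘ u hu ▸ hy0 u hu, k, c, ?_, fun u hu => by rw [hVy u hu, hyΘ u hu]⟩
  have hfp := S.f_pos_of_mem_chart hp
  have hΘ := hy0 p hp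
  rw [hyΘ p hp] at hneg hΘ
  rw [hS.deriv_f hp] at hneg
  have h1 : 0 < b ^ 2 * Θ p ^ 2 * S.f p := by positivity
  by_contra hk0
  push Not at hk0
  nlinarith [mul_nonneg_of_nonpos_of_nonpos hk0 (neg_nonpos.2 h1.le)]

/-- Equality would make the derivatives agree and hence `a Θ³` constant, whereas `Θ` is strictly
increasing. -/
theorem not_samePotential (hne : ∀ u ∈ S.chart, Θ u ≠ 0) {a k c d : ℝ} (ha : a ≠ 0)
    (hV : ∀ u ∈ S.chart, V u = a * Θ u + c) (hW : ∀ u ∈ S.chart, W u = k / Θ u ^ 2 + d) :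
    ¬ S.SamePotential V W := by
  rintro ⟨α, γ, -, h⟩
  have hV' : ∀ u ∈ S.chart, V u = (α * k) / Θ u ^ 2 + (α * d + γ) := fun u hu => by
    rw [h u hu, hW u hu]; ring
  have h3 : ∀ u ∈ S.chart, a * Θ u ^ 3 = -(2 * (α * k)) := fun u hu => by
    have hfp := S.f_pos_of_mem_chart hu
    have hΘ := hne u hu
    have := (hS.hasDerivAt_of_eq_mul hV hu).unique (hS.hasDerivAt_of_eq_div hne hV' hu)
    field_simp at this
    linarith
  obtain ⟨p, hp⟩ := S.chart_nonempty
  obtain ⟨q, hq, hpq⟩ := exists_gt_mem_chart hp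
  have h1 := mul_left_cancel₀ ha ((h3 p hp).trans (h3 q hq).symm)
  exact (hS.isTheta.strictMonoOn hp hq hpq).ne ((Odd.strictMono_pow (by decide)).injective h1)

end IsBertrandSurface

/-- Two different potentials must be of different types. The linear type forces `h = b²`, and the
other then needs `Θ` without zeros; these are the zeros of `f'`. -/
theorem exactlyTwo_iff (hf : AnalyticOnNhd ℝ S.f S.chart) (hm : 0 < m) :
    S.ExactlyTwo m ↔ (∃ b : ℚ, 0 < b ∧ ∀ u ∈ S.chart, S.h u = (b : ℝ) ^ 2) ∧
      ∀ u ∈ S.chart, deriv S.f u ≠ 0 := by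
  constructor
  · rintro ⟨V₁, V₂, h1, h2, hne, -⟩
    have key : ∀ {V W : ℝ → ℝ}, S.IsKeplerian V → S.IsOscillator W →
        (∃ b : ℚ, 0 < b ∧ ∀ u ∈ S.chart, S.h u = (b : ℝ) ^ 2) ∧
          ∀ u ∈ S.chart, deriv S.f u ≠ 0 := fun {V W} hV hW => by
      obtain ⟨a, -, -, ⟨b, hb, hh⟩, -⟩ := hV
      have hS := isBertrandSurface hf (by exact_mod_cast hb : (0 : ℝ) < b) hh
      exact ⟨⟨b, hb, hh⟩, fun u hu h =>
        (hS.exists_eq_div hW).1 u hu ((hS.eq_zero_iff hu).2 h)⟩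
    rcases h1.isKeplerian_or_isOscillator hf hm with k1 | o1 <;>
      rcases h2.isKeplerian_or_isOscillator hf hm with k2 | o2
    · exact absurd (k1.samePotential k2) hne
    · exact key k1 o2
    · exact key k2 o1
    · exact absurd (o1.samePotential hf o2) hne
  · rintro ⟨⟨b, hb, hh⟩, hf'⟩
    have hS := isBertrandSurface hf (by exact_mod_cast hb : (0 : ℝ) < b) hh
    set Θ : ℝ → ℝ := fun u => -(deriv S.f u / S.f u) / (b : ℝ) ^ 2
    have hΘ : ∀ u ∈ S.chart, Θ u ≠ 0 := fun u hu h => hf' u hu ((hS.eq_zero_iff hu).1 h)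
    obtain ⟨p, hp⟩ := S.chart_nonempty
    have hp' := hf' p hp
    have hV₁ : ∀ u ∈ S.chart, deriv S.f p * Θ u = deriv S.f p * Θ u + 0 := fun u _ =>
      (add_zero _).symm
    have hV₂ : ∀ u ∈ S.chart, 1 / Θ u ^ 2 = 1 / Θ u ^ 2 + 0 := fun u _ => (add_zero _).symm
    -- The coefficient `f' p` satisfies the sign condition at `p`, where it becomes a square.
    refine ⟨fun u => deriv S.f p * Θ u, fun u => 1 / Θ u ^ 2,
      hS.isClosedOrbitPotential_of_eq_mul hm hp' hV₁ ⟨p, hp, mul_self_pos.2 hp'⟩,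
      hS.isClosedOrbitPotential_of_eq_div hm one_pos hΘ hV₂,
      hS.not_samePotential hΘ hp' hV₁ hV₂, fun V hV => ?_⟩
    refine (hV.isKeplerian_or_isOscillator hf hm).imp (fun h => ?_) fun h => ?_
    · obtain ⟨a, c, ha, hVa, -⟩ := hS.exists_eq_mul h
      refine ⟨a / deriv S.f p, c, div_ne_zero ha hp', fun u hu => ?_⟩
      rw [hVa u hu]
      field_simp
    · obtain ⟨-, k, c, hk, hVk⟩ := hS.exists_eq_div h
      refine ⟨k, c, hk.ne', fun u hu => ?_⟩
      rw [hVk u hu, mul_one_div]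

namespace IsBertrandSurface

/-- As `f'` has no zero, the sign condition at one point propagates to the whole chart. -/
theorem isClosedOrbitPotential_iff {b : ℚ} (hS : S.IsBertrandSurface b Θ) (hm : 0 < m)
    (hf' : ∀ u ∈ S.chart, deriv S.f u ≠ 0) : S.IsClosedOrbitPotential m V ↔
      (∃ a c : ℝ, (∀ u ∈ S.chart, 0 < a * deriv S.f u) ∧ ∀ u ∈ S.chart, V u = a * Θ u + c) ∨
        ∃ k c : ℝ, 0 < k ∧ ∀ u ∈ S.chart, V u = k / Θ u ^ 2 + c := by
  constructor
  · intro hV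
    refine (hV.isKeplerian_or_isOscillator hS.analytic hm).imp (fun h => ?_) fun h =>
      (hS.exists_eq_div h).2
    obtain ⟨a, c, ha, hVa, p, hp, hpos⟩ := hS.exists_eq_mul h
    refine ⟨a, c, ?_, hVa⟩
    rcases S.isPreconnected_chart.pos_or_neg_of_ne_zero
      (continuousOn_const.mul hS.analytic.deriv.continuousOn)
      (fun u hu => mul_ne_zero ha (hf' u hu)) with h | h
    · exact h
    · exact absurd (h p hp) hpos.le.not_gt
  · rintro (⟨a, c, hpos, hVa⟩ | ⟨k, c, hk, hVk⟩)
    · obtain ⟨p, hp⟩ := S.chart_nonempty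
      exact hS.isClosedOrbitPotential_of_eq_mul hm (left_ne_zero_of_mul (hpos p hp).ne') hVa
        ⟨p, hp, hpos p hp⟩
    · exact hS.isClosedOrbitPotential_of_eq_div hm hk
        (fun u hu h => hf' u hu ((hS.eq_zero_iff hu).1 h)) hVk

/-- At a zero of `f'` the increasing function `Θ` changes sign, so either sign of `a` admits a well,
while `k / Θ²` has a pole. -/
theorem isClosedOrbitPotential_iff_of_deriv_eq_zero {b : ℚ} (hS : S.IsBertrandSurface b Θ)
    (hm : 0 < m) (hf' : ∃ u ∈ S.chart, deriv S.f u = 0) : S.IsClosedOrbitPotential m V ↔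
      ∃ a c : ℝ, a ≠ 0 ∧ ∀ u ∈ S.chart, V u = a * Θ u + c := by
  obtain ⟨p, hp, hp0⟩ := hf'
  have hΘp := (hS.eq_zero_iff hp).2 hp0
  constructor
  · intro hV
    rcases hV.isKeplerian_or_isOscillator hS.analytic hm with h | h
    · obtain ⟨a, c, ha, hVa, -⟩ := hS.exists_eq_mul h
      exact ⟨a, c, ha, hVa⟩
    · exact absurd hΘp ((hS.exists_eq_div h).1 p hp)
  · rintro ⟨a, c, ha, hVa⟩
    obtain ⟨v, hv, hav⟩ : ∃ v ∈ S.chart, a * Θ v < 0 := by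
      rcases lt_or_gt_of_ne ha with h | h
      · obtain ⟨v, hv, hpv⟩ := exists_gt_mem_chart hp
        exact ⟨v, hv, mul_neg_of_neg_of_pos h (hΘp ▸ hS.isTheta.strictMonoOn hp hv hpv)⟩
      · obtain ⟨v, hv, hpv⟩ := exists_lt_mem_chart hp
        exact ⟨v, hv, mul_neg_of_pos_of_neg h (hΘp ▸ hS.isTheta.strictMonoOn hv hp hpv)⟩
    refine hS.isClosedOrbitPotential_of_eq_mul hm ha hVa ⟨v, hv, ?_⟩
    have hpos := mul_pos (mul_pos (pow_pos hS.pos 2) (S.f_pos_of_mem_chart hv)) (neg_pos.2 hav)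
    rw [hS.deriv_f hv]
    linarith

end IsBertrandSurface

/-- The linear type requires constant `h`, so only the oscillator type is left, and its `y` serves
as `Θ` for all potentials. Without any such potential every antiderivative will do. -/
theorem atMostOne_and_exists_isTheta (hf : AnalyticOnNhd ℝ S.f S.chart) (hm : 0 < m)
    (hh : ¬ ∃ C : ℝ, ∀ u ∈ S.chart, S.h u = C) :
    S.AtMostOne m ∧ ∃ Θ : ℝ → ℝ, S.IsTheta Θ ∧ ∀ V : ℝ → ℝ, S.IsClosedOrbitPotential m V →
      (∀ u ∈ S.chart, Θ u ≠ 0) ∧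
        ∃ k c : ℝ, k ≠ 0 ∧ ∀ u ∈ S.chart, V u = k / Θ u ^ 2 + c := by
  have hosc : ∀ {V}, S.IsClosedOrbitPotential m V → S.IsOscillator V := fun {V} hV => by
    rcases hV.isKeplerian_or_isOscillator hf hm with ⟨-, -, -, ⟨b, -, hb⟩, -⟩ | h
    · exact absurd ⟨_, hb⟩ hh
    · exact h
  refine ⟨fun V W hV hW => (hosc hV).samePotential hf (hosc hW), ?_⟩
  by_cases hex : ∃ V, S.IsClosedOrbitPotential m V
  · obtain ⟨V, hV⟩ := hex
    obtain ⟨β, k, c, y, hβ, hk, hy, hy0, hVy, -⟩ := hosc hV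
    refine ⟨y, hy, fun W hW => ⟨hy0, ?_⟩⟩
    obtain ⟨a, d, ha, hWV⟩ := (hosc hW).samePotential hf (hosc hV)
    refine ⟨a * k, a * c + d, mul_ne_zero ha hk, fun u hu => ?_⟩
    rw [hWV u hu, hVy u hu]
    ring
  · obtain ⟨Θ, hΘ⟩ := S.exists_isTheta hf.continuousOn
    exact ⟨Θ, hΘ, fun V hV => absurd ⟨V, hV⟩ hex⟩

end SurfaceOfRevolution
end

theorem mainTheorem2 (S : SurfaceOfRevolution) (hf : AnalyticOnNhd ℝ S.f S.chart)
    (m : ℝ) (hm : 0 < m) :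
    S.AtMostTwo m ∧
    (S.ExactlyTwo m ↔
      (∃ b : ℚ, 0 < b ∧ ∀ u ∈ S.chart, S.h u = (b : ℝ) ^ 2) ∧
        ∀ u ∈ S.chart, deriv S.f u ≠ 0) ∧
    (∀ b : ℚ, 0 < b → (∀ u ∈ S.chart, S.h u = (b : ℝ) ^ 2) →
      ∃ Θ : ℝ → ℝ, S.IsTheta Θ ∧
        (∀ u ∈ S.chart, deriv S.f u / S.f u = -(b : ℝ) ^ 2 * Θ u) ∧
        ((∀ u ∈ S.chart, deriv S.f u ≠ 0) → ∀ V : ℝ → ℝ, S.IsClosedOrbitPotential m V ↔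
          (∃ a c : ℝ, (∀ u ∈ S.chart, 0 < a * deriv S.f u) ∧
              ∀ u ∈ S.chart, V u = a * Θ u + c) ∨
            (∃ k c : ℝ, 0 < k ∧ ∀ u ∈ S.chart, V u = k / Θ u ^ 2 + c)) ∧
        ((∃ u ∈ S.chart, deriv S.f u = 0) → ∀ V : ℝ → ℝ, S.IsClosedOrbitPotential m V ↔
          ∃ a c : ℝ, a ≠ 0 ∧ ∀ u ∈ S.chart, V u = a * Θ u + c)) ∧
    (∀ β : ℝ, S.FourthOrderCondition β → (¬ ∃ C : ℝ, ∀ u ∈ S.chart, S.h u = C) →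
      S.AtMostOne m ∧
        ∃ Θ : ℝ → ℝ, S.IsTheta Θ ∧ ∀ V : ℝ → ℝ, S.IsClosedOrbitPotential m V →
          (∀ u ∈ S.chart, Θ u ≠ 0) ∧
            ∃ k c : ℝ, k ≠ 0 ∧ ∀ u ∈ S.chart, V u = k / Θ u ^ 2 + c) := by
  refine ⟨SurfaceOfRevolution.atMostTwo hf hm, SurfaceOfRevolution.exactlyTwo_iff hf hm, fun b hb hh => ?_, fun β _ hh =>
    SurfaceOfRevolution.atMostOne_and_exists_isTheta hf hm hh⟩
  have hS := SurfaceOfRevolution.isBertrandSurface hf (by exact_mod_cast hb : (0 : ℝ) < b) hh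
  exact ⟨_, hS.isTheta, hS.logDeriv, fun hf' V => hS.isClosedOrbitPotential_iff hm hf',
    fun hf' V => hS.isClosedOrbitPotential_iff_of_deriv_eq_zero hm hf'⟩
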